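/- Work over $\mathbb{Q}$ with $\mathbb{Z}/2$-graded (super) vector spaces; $|a|$ is the parity of a homogeneous element $a$, and formulas stated for homogeneous elements are extended linearly. Let $V$ be a finite-dimensional super vector space, $T(V^*)$ the tensor algebra of its dual, and $$\mathfrak h=\mathfrak h[V]:=T(V^*)/[T(V^*),T(V^*)]=\bigoplus_{i\ge 0}\big((V^*)^{\otimes i}\big)_{\mathbb{Z}/i},\qquad \mathfrak h_{\ge n}:=\bigoplus_{i\ge n}\big((V^*)^{\otimes i}\big)_{\mathbb{Z}/i},$$ the space of noncommutative 0-forms, where $[\,,]$ is the span of the supercommutators $ab-(-1)^{|a||b|}ba$. Let $\Omega(V)$ be the algebra of noncommutative forms, freely generated by the symbols $x$ and $dx$ ($x\in V^*$, linear in $x$), with $|dx|=|x|+1$; let $d$ be its odd superderivation $x\mapsto dx\mapsto 0$, and $DR(V):=\Omega(V)/[\Omega(V),\Omega(V)]$. For a vector field (superderivation) $\xi$ of $T(V^*)$ let $i_\xi$ be the superderivation of $\Omega(V)$, of parity $|\xi|+1$, with $i_\xi(x)=0$ and $i_\xi(dx)=\xi(x)$. Let $\omega=\sum_i dx_i\,dy_i\in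 DR^2(V)$ be an odd constant symplectic form: an odd constant $2$-form, closed, such that $\xi\mapsto i_\xi(\omega)$ is a bijection from $\mathrm{Der}[T(V^*)]$ onto $DR^1(V)$. For $a\in\mathfrak h$ let $\alpha$ be the vector field with $da=i_\alpha(\omega)$. Then $\mathfrak h$ carries the odd bracket $\{a,b\}:=\alpha(b)$ and the odd cobracket $\Delta(a):=\frac12\nabla(\alpha)\in\mathfrak h\otimes\mathfrak h$, where, in homogeneous coordinates $x\in V^*$ and for $f_1,\dots,f_k\in V^*$, $$\nabla(f_1\cdots f_k\,\partial_{x})=\sum_{i=1}^k(-1)^{|x|(|f_i|+\dots+|f_k|)}\,\partial_{x}(f_i)\,(f_1\cdots f_{i-1})\otimes(f_{i+1}\cdots f_k).$$ Let $S(\mathfrak h)=\bigoplus_n(\mathfrak h^{\otimes n})_{S_n}$ be the graded symmetric algebra, with the odd bracket extending the bracket of $\mathfrak h$ by the Leibniz rules $$\{a,bc\}=\{a,b\}c+(-1)^{(|a|+1)|b|}b\{a,c\},\qquad \{ab,c\}=(-1)^{|a|}a\{b,c\}+(-1)^{|b||c|}\{a,c\}b,$$ with the Chevalley–Eilenberg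 differential $\delta$, determined by $\delta(1)=0$ and $\delta(gw)=\{g,w\}+(-1)^{|g|}g\,\delta(w)$ for $g\in\mathfrak h$, $w\in S(\mathfrak h)$, that is, $$\delta(g_1\cdots g_n)=\sum_{i<j}\pm\{g_i,g_j\}\,g_1\cdots\hat g_i\cdots\hat g_j\cdots g_n\quad(g_i\in\mathfrak h)$$ with the Koszul sign of moving $g_i,g_j$ to the front, and with the odd superderivation $\Delta$ extending the composite $\mathfrak h\to\mathfrak h\otimes\mathfrak h\to S^2(\mathfrak h)$. Let $$\mathfrak l:=\mathbb{Q}[\gamma]\otimes S(\mathfrak h),\qquad d:=\gamma\cdot\delta+\Delta,$$ with $\gamma$ even and the $\mathbb{Q}[\gamma]$-bilinear extension of the bracket. Let $\nu\in S(\mathfrak h)$ be the generator given by the $0$-form $1\in\mathbb{Q}\subset\mathfrak h=\mathbb{Q}\oplus\mathfrak h_{\ge1}$, so that $\mathfrak l=\mathbb{Q}[\gamma,\nu]\otimes S(\mathfrak h_{\ge 1})$; let $\mathfrak l':=\mathfrak l/\mathbb{Q}[\gamma,\nu]$ and let $\mathbb{Q}_+[\gamma,\nu]$ be the polynomials that vanish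 at the origin. Put $$\Lambda_{\gamma,\nu}[V]:=\big(\mathbb{Q}_+[\gamma,\nu]\otimes V^*\big)\oplus\big(\mathbb{Q}[\gamma,\nu]\otimes\mathfrak h_{\ge2}\big)\oplus\Big(\mathbb{Q}[\gamma,\nu]\otimes\bigoplus_{k\ge2}\big[(\mathfrak h_{\ge1})^{\otimes k}\big]_{S_k}\Big)\subset\mathfrak l'.$$ **Theorem.** There is exactly one structure of a differential graded Lie algebra with odd bracket on $\Lambda_{\gamma,\nu}[V]$ whose differential and bracket are induced by the differential $d=\gamma\cdot\delta+\Delta$ and the bracket of $\mathfrak l$, i.e. $d[x]=[dx]$ and $\{[x],[y]\}=[\{x,y\}]$ for all $x,y\in\mathfrak l$ whose classes in $\mathfrak l'$ lie in $\Lambda_{\gamma,\nu}[V]$. Here a differential graded Lie algebra with odd bracket is a super vector space with an odd map $d$ and an odd bilinear bracket such that $d^2=0$ and $$\{a,b\}=(-1)^{|a||b|}\{b,a\},\qquad \{a,\{b,c\}\}=(-1)^{|a|+1}\{\{a,b\},c\}+(-1)^{(|a|+1)(|b|+1)}\{b,\{a,c\}\},$$ $$d\{a,b\}+\{da,b\}+(-1)^{|a|}\{a,db\}=0.$$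 -/

import Mathlib

noncomputable section

namespace NCSymp

open TensorProduct


/-- The sign `(-1)^p`. -/
def sgn (p : ZMod 2) : ℚ := if p = 0 then 1 else -1

theorem sgn_zero : sgn 0 = 1 := by simp [sgn]
theorem sgn_one : sgn 1 = -1 := by simp [sgn]

theorem zmod_two_cases (p : ZMod 2) : p = 0 ∨ p = 1 := by
  revert p; decide

theorem sgn_add (p q : ZMod 2) : sgn (p + q) = sgn p * sgn q := by
  rcases zmod_two_cases p with rfl | rfl <;> rcases zmod_two_cases q with rfl | rfl <;>
    simp [sgn, show (1 + 1 : ZMod 2) = 0 from rfl]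

theorem sgn_mul_self (p : ZMod 2) : sgn p * sgn p = 1 := by
  rcases zmod_two_cases p with rfl | rfl <;> simp [sgn]

/-- A super vector space over `ℚ`: a `ℤ/2`-graded vector space `M = M₀ ⊕ M₁`, the grading being
recorded by its parity involution `par`, which is `+1` on `M₀` and `-1` on `M₁`. Every linear
involution is the parity involution of exactly one grading. -/
class SuperSpace (M : Type*) [AddCommGroup M] [Module ℚ M] where
  par : M →ₗ[ℚ] M
  par_par : ∀ x, par (par x) = x

open SuperSpace

section Basic
variable {M : Type*} [AddCommGroup M] [Module ℚ M] [SuperSpace M]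

variable (M) in
/-- The subspace `M_p` of homogeneous elements of parity `p`. -/
def hom (p : ZMod 2) : Submodule ℚ M where
  carrier := {x | par x = sgn p • x}
  add_mem' := by
    intro a b ha hb
    simp only [Set.mem_ofPred_eq] at *
    rw [map_add, ha, hb, smul_add]
  zero_mem' := by simp
  smul_mem' := by
    intro c a ha
    simp only [Set.mem_ofPred_eq] at *
    rw [map_smul, ha, smul_comm]

theorem mem_hom {p : ZMod 2} {x : M} : x ∈ hom M p ↔ par x = sgn p • x := Iff.rfl

variable (M) in
/-- The projection of `M` onto `M_p`. -/
def proj (p : ZMod 2) : M →ₗ[ℚ] M := (1 / 2 : ℚ) • (LinearMap.id + sgn p • par)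

theorem proj_apply (p : ZMod 2) (x : M) :
    proj M p x = (1 / 2 : ℚ) • (x + sgn p • par x) := rfl

theorem proj_mem (p : ZMod 2) (x : M) : proj M p x ∈ hom M p := by
  rw [mem_hom, proj_apply, map_smul, map_add, map_smul, par_par, smul_comm (sgn p) (1 / 2 : ℚ),
    smul_add (sgn p), smul_smul (sgn p), sgn_mul_self, one_smul, add_comm]

theorem proj_add_proj (x : M) : proj M 0 x + proj M 1 x = x := by
  simp only [proj_apply, sgn_zero, sgn_one]
  module

theorem proj_of_mem {p : ZMod 2} {x : M} (hx : x ∈ hom M p) : proj M p x = x := by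
  rw [mem_hom] at hx
  rw [proj_apply, hx, smul_smul, sgn_mul_self]
  module

variable (M) in
/-- The operator that multiplies homogeneous `x` by the sign `(-1)^{p|x|}`. -/
def tw (p : ZMod 2) : M →ₗ[ℚ] M := if p = 0 then LinearMap.id else par

theorem tw_zero (x : M) : tw M 0 x = x := by simp [tw]
theorem tw_one (x : M) : tw M 1 x = par x := by simp [tw]

theorem tw_of_mem {p q : ZMod 2} {x : M} (hx : x ∈ hom M q) :
    tw M p x = sgn (p * q) • x := by
  rcases zmod_two_cases p with rfl | rfl
  · simp [tw_zero, sgn_zero]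
  · rw [tw_one, one_mul, mem_hom.1 hx]

/-- Two linear maps that agree on homogeneous elements are equal. -/
theorem ext_hom {N : Type*} [AddCommGroup N] [Module ℚ N] {f g : M →ₗ[ℚ] N}
    (h : ∀ p, ∀ x ∈ hom M p, f x = g x) : f = g := by
  ext x
  rw [← proj_add_proj x, map_add, map_add, h 0 _ (proj_mem 0 x), h 1 _ (proj_mem 1 x)]

theorem hom_inf {p : ZMod 2} {x : M}
    (h0 : x ∈ hom M p) (h1 : x ∈ hom M (p + 1)) : x = 0 := by
  rw [mem_hom] at *
  rw [h0, sgn_add, sgn_one, mul_neg_one, neg_smul] at h1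
  have h2 : sgn p • x = 0 := by
    have : sgn p • x = (1 / 2 : ℚ) • (sgn p • x + sgn p • x) := by module
    rw [this]
    nth_rewrite 1 [h1]
    simp
  have h3 := congrArg (fun y => sgn p • y) h2
  simpa [smul_smul, sgn_mul_self] using h3

end Basic

/-- An associative unital superalgebra: a product of even degree. -/
class SuperAlgebra (R : Type*) [Ring R] [Algebra ℚ R] extends SuperSpace R where
  par_one : par (1 : R) = 1
  par_mul : ∀ a b : R, par (a * b) = par a * par b

open SuperAlgebra

section Alg
variable (R : Type*) [Ring R] [Algebra ℚ R] [SuperAlgebra R]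

/-- The parity involution as an algebra homomorphism. -/
def parAlg : R →ₐ[ℚ] R := AlgHom.ofLinearMap par par_one par_mul

/-- The operator `tw` as an algebra homomorphism. -/
def twAlg (p : ZMod 2) : R →ₐ[ℚ] R := if p = 0 then AlgHom.id ℚ R else parAlg R

variable {R}
theorem parAlg_apply (a : R) : parAlg R a = par a := rfl

theorem twAlg_apply (p : ZMod 2) (a : R) : twAlg R p a = tw R p a := by
  rcases zmod_two_cases p with rfl | rfl <;> simp [twAlg, tw, parAlg_apply]

theorem tw_mul (p : ZMod 2) (a b : R) : tw R p (a * b) = tw R p a * tw R p b := by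
  simp [← twAlg_apply]

theorem mul_mem_hom {p q : ZMod 2} {a b : R} (ha : a ∈ hom R p) (hb : b ∈ hom R q) :
    a * b ∈ hom R (p + q) := by
  rw [mem_hom] at *
  rw [par_mul, ha, hb, sgn_add, smul_mul_smul_comm]

variable (R) in
/-- Superderivations of parity `p`: `D(ab) = D(a) b + (-1)^{p|a|} a D(b)`. -/
def derOf (p : ZMod 2) : Submodule ℚ (R →ₗ[ℚ] R) where
  carrier := {D | (∀ a, par (D a) = sgn p • D (par a)) ∧
    ∀ a b, D (a * b) = D a * b + tw R p a * D b}
  add_mem' := by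
    rintro D E ⟨h1, h2⟩ ⟨h3, h4⟩
    refine ⟨fun a => ?_, fun a b => ?_⟩
    · simp only [LinearMap.add_apply, map_add, h1, h3, smul_add]
    · simp only [LinearMap.add_apply, h2, h4, add_mul, mul_add]; abel
  zero_mem' := by simp
  smul_mem' := by
    rintro c D ⟨h1, h2⟩
    refine ⟨fun a => ?_, fun a b => ?_⟩
    · simp only [LinearMap.smul_apply, map_smul, h1]; rw [smul_comm]
    · simp only [LinearMap.smul_apply, h2, smul_add, smul_mul_assoc, mul_smul_comm]

theorem derOf_mem_hom {p q : ZMod 2} {D : R →ₗ[ℚ] R} (hD : D ∈ derOf R p) {a : R}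
    (ha : a ∈ hom R q) : D a ∈ hom R (p + q) := by
  rw [mem_hom] at *
  rw [hD.1, ha, map_smul, smul_smul, sgn_add]

variable (R) in
/-- The space `Der[R]` of all superderivations (vector fields), sums of an even and an odd one. -/
def Der : Submodule ℚ (R →ₗ[ℚ] R) := derOf R 0 ⊔ derOf R 1

variable (R) in
/-- The subspace `[R, R]` spanned by the supercommutators `ab - (-1)^{|a||b|} ba`. -/
def comm : Submodule ℚ R := Submodule.span ℚ
  {x | ∃ p q : ZMod 2, ∃ a ∈ hom R p, ∃ b ∈ hom R q, x = a * b - sgn (p * q) • (b * a)}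

theorem comm_mem {p q : ZMod 2} {a b : R} (ha : a ∈ hom R p) (hb : b ∈ hom R q) :
    a * b - sgn (p * q) • (b * a) ∈ comm R :=
  Submodule.subset_span ⟨p, q, a, ha, b, hb, rfl⟩

theorem derOf_comm {p : ZMod 2} {D : R →ₗ[ℚ] R} (hD : D ∈ derOf R p) :
    comm R ≤ (comm R).comap D := by
  refine Submodule.span_le.2 ?_
  rintro _ ⟨q, r, a, ha, b, hb, rfl⟩
  have h1 := comm_mem (derOf_mem_hom hD ha) hb
  have h2 := (comm R).smul_mem (sgn (p * q)) (comm_mem ha (derOf_mem_hom hD hb))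
  have h := add_mem h1 h2
  change D _ ∈ comm R
  convert h using 1
  rw [map_sub, map_smul, hD.2, hD.2, tw_of_mem ha, tw_of_mem hb]
  have e1 : sgn ((p + q) * r) = sgn (p * r) * sgn (q * r) := by rw [add_mul, sgn_add]
  have e2 : sgn (q * (p + r)) = sgn (p * q) * sgn (q * r) := by rw [mul_add, sgn_add, mul_comm q p]
  have e3 := sgn_mul_self (p * q)
  rw [e1, e2, smul_sub, smul_smul, ← mul_assoc, e3, one_mul]
  simp only [smul_mul_assoc, smul_add, smul_smul]
  rw [mul_comm (sgn (p * r))]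
  abel

theorem Der_comm {D : R →ₗ[ℚ] R} (hD : D ∈ Der R) : comm R ≤ (comm R).comap D := by
  obtain ⟨E, hE, F, hF, rfl⟩ := Submodule.mem_sup.1 hD
  exact fun x hx => (comm R).add_mem (derOf_comm hE hx) (derOf_comm hF hx)

theorem par_comm : comm R ≤ (comm R).comap (par : R →ₗ[ℚ] R) := by
  refine Submodule.span_le.2 ?_
  rintro _ ⟨q, r, a, ha, b, hb, rfl⟩
  change par _ ∈ comm R
  rw [map_sub, map_smul, par_mul, par_mul, mem_hom.1 ha, mem_hom.1 hb,
    smul_mul_smul_comm, smul_mul_smul_comm, smul_comm, mul_comm (sgn r), ← smul_sub]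
  exact (comm R).smul_mem _ (comm_mem ha hb)

variable (R) in
/-- The quotient `R / [R, R]`. -/
def Cyc : Type _ := R ⧸ comm R

instance : AddCommGroup (Cyc R) := inferInstanceAs (AddCommGroup (R ⧸ comm R))
instance : Module ℚ (Cyc R) := inferInstanceAs (Module ℚ (R ⧸ comm R))

variable (R) in
/-- The class of an element in `R / [R, R]`. -/
def Cyc.mk : R →ₗ[ℚ] Cyc R := (comm R).mkQ

theorem Cyc.mk_surjective : Function.Surjective (Cyc.mk R) := (comm R).mkQ_surjective

instance : SuperSpace (Cyc R) where
  par := (comm R).mapQ (comm R) par par_comm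
  par_par := by
    intro x
    obtain ⟨x, rfl⟩ := Cyc.mk_surjective x
    change Cyc.mk R (par (par x)) = _
    rw [par_par]

theorem Cyc.par_mk (a : R) : par (Cyc.mk R a) = Cyc.mk R (par a) := rfl

variable (R) in
/-- The action of superderivations on `R / [R, R]`. -/
def cycDer : Der R →ₗ[ℚ] Cyc R →ₗ[ℚ] Cyc R where
  toFun D := (comm R).mapQ (comm R) D.1 (Der_comm D.2)
  map_add' D E := by
    apply Submodule.linearMap_qext
    ext x; rfl
  map_smul' c D := by
    apply Submodule.linearMap_qext
    ext x; rfl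

theorem cycDer_mk (D : Der R) (a : R) : cycDer R D (Cyc.mk R a) = Cyc.mk R (D.1 a) := rfl

end Alg

section TwistedDerivations
variable {W : Type*} [AddCommGroup W] [Module ℚ W]
variable {B : Type*} [Ring B] [Algebra ℚ B]

/-- A linear map on the tensor algebra satisfying a twisted Leibniz rule is determined by its
values on generators. -/
theorem leibniz_ext {φ ψ : TensorAlgebra ℚ W →ₐ[ℚ] B} {D E : TensorAlgebra ℚ W →ₗ[ℚ] B}
    (hD : ∀ a b, D (a * b) = φ a * D b + D a * ψ b)
    (hE : ∀ a b, E (a * b) = φ a * E b + E a * ψ b)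
    (h : ∀ w, D (TensorAlgebra.ι ℚ w) = E (TensorAlgebra.ι ℚ w)) : D = E := by
  have hD1 : D 1 = 0 := by simpa using hD 1 1
  have hE1 : E 1 = 0 := by simpa using hE 1 1
  ext x
  induction x using TensorAlgebra.induction with
  | algebraMap r => rw [Algebra.algebraMap_eq_smul_one, map_smul, map_smul, hD1, hE1]
  | ι w => exact h w
  | mul a b ha hb => rw [hD, hE, ha, hb]
  | add a b ha hb => rw [map_add, map_add, ha, hb]

/-- The upper triangular matrix `[[φ w, f w], [0, ψ w]]`. -/
def triLin {M : Type*} [AddCommGroup M] [Module ℚ M] (φ f ψ : M →ₗ[ℚ] B) :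
    M →ₗ[ℚ] Matrix (Fin 2) (Fin 2) B where
  toFun w := !![φ w, f w; 0, ψ w]
  map_add' v w := by ext i j; fin_cases i <;> fin_cases j <;> simp
  map_smul' c w := by ext i j; fin_cases i <;> fin_cases j <;> simp

/-- The linear map `D` on the tensor algebra with `D w = f w` on generators and
`D (a b) = φ a * D b + D a * ψ b`: the corner entry of the algebra homomorphism
`w ↦ [[φ w, f w], [0, ψ w]]`. -/
def tder (φ ψ : TensorAlgebra ℚ W →ₐ[ℚ] B) (f : W →ₗ[ℚ] B) : TensorAlgebra ℚ W →ₗ[ℚ] B :=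
  Matrix.entryLinearMap ℚ B 0 1 ∘ₗ
    (TensorAlgebra.lift ℚ (triLin (φ.toLinearMap ∘ₗ TensorAlgebra.ι ℚ) f
      (ψ.toLinearMap ∘ₗ TensorAlgebra.ι ℚ))).toLinearMap

theorem tder_matrix (φ ψ : TensorAlgebra ℚ W →ₐ[ℚ] B) (f : W →ₗ[ℚ] B)
    (x : TensorAlgebra ℚ W) :
    TensorAlgebra.lift ℚ (triLin (φ.toLinearMap ∘ₗ TensorAlgebra.ι ℚ) f
      (ψ.toLinearMap ∘ₗ TensorAlgebra.ι ℚ)) x = !![φ x, tder φ ψ f x; 0, ψ x] := by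
  have key : ∀ x, (TensorAlgebra.lift ℚ (triLin (φ.toLinearMap ∘ₗ TensorAlgebra.ι ℚ) f
      (ψ.toLinearMap ∘ₗ TensorAlgebra.ι ℚ)) x) 0 0 = φ x ∧
      (TensorAlgebra.lift ℚ (triLin (φ.toLinearMap ∘ₗ TensorAlgebra.ι ℚ) f
      (ψ.toLinearMap ∘ₗ TensorAlgebra.ι ℚ)) x) 1 0 = 0 ∧
      (TensorAlgebra.lift ℚ (triLin (φ.toLinearMap ∘ₗ TensorAlgebra.ι ℚ) f
      (ψ.toLinearMap ∘ₗ TensorAlgebra.ι ℚ)) x) 1 1 = ψ x := by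
    intro x
    induction x using TensorAlgebra.induction with
    | algebraMap r => simp [Matrix.algebraMap_matrix_apply]
    | ι w => simp [triLin]
    | mul a b ha hb =>
      simp only [map_mul, Matrix.mul_apply, Fin.sum_univ_two, ha, hb]
      simp
    | add a b ha hb =>
      simp only [map_add, Matrix.add_apply, ha, hb]
      simp
  ext i j
  fin_cases i <;> fin_cases j
  · simpa using (key x).1
  · rfl
  · simpa using (key x).2.1
  · simpa using (key x).2.2

theorem tder_ι (φ ψ : TensorAlgebra ℚ W →ₐ[ℚ] B) (f : W →ₗ[ℚ] B) (w : W) :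
    tder φ ψ f (TensorAlgebra.ι ℚ w) = f w := by
  simp [tder, triLin]

theorem tder_mul (φ ψ : TensorAlgebra ℚ W →ₐ[ℚ] B) (f : W →ₗ[ℚ] B)
    (a b : TensorAlgebra ℚ W) :
    tder φ ψ f (a * b) = φ a * tder φ ψ f b + tder φ ψ f a * ψ b := by
  have h := congrFun (congrFun (tder_matrix φ ψ f (a * b)) 0) 1
  rw [map_mul, tder_matrix, tder_matrix, Matrix.mul_apply] at h
  simpa [Fin.sum_univ_two] using h.symm

theorem tder_add (φ ψ : TensorAlgebra ℚ W →ₐ[ℚ] B) (f g : W →ₗ[ℚ] B) :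
    tder φ ψ (f + g) = tder φ ψ f + tder φ ψ g := by
  refine leibniz_ext (tder_mul φ ψ _) (fun a b => ?_) (fun w => ?_)
  · simp only [LinearMap.add_apply, tder_mul, mul_add, add_mul]; abel
  · simp only [LinearMap.add_apply, tder_ι]

theorem tder_smul (φ ψ : TensorAlgebra ℚ W →ₐ[ℚ] B) (c : ℚ) (f : W →ₗ[ℚ] B) :
    tder φ ψ (c • f) = c • tder φ ψ f := by
  refine leibniz_ext (tder_mul φ ψ _) (fun a b => ?_) (fun w => ?_)
  · simp only [LinearMap.smul_apply, tder_mul, mul_smul_comm, smul_mul_assoc, smul_add]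
  · simp only [LinearMap.smul_apply, tder_ι]

end TwistedDerivations

section TA
variable (W : Type*) [AddCommGroup W] [Module ℚ W] [SuperSpace W]

/-- The parity involution of the tensor algebra. -/
def parT : TensorAlgebra ℚ W →ₐ[ℚ] TensorAlgebra ℚ W :=
  TensorAlgebra.lift ℚ (TensorAlgebra.ι ℚ ∘ₗ par)

theorem parT_ι (w : W) : parT W (TensorAlgebra.ι ℚ w) = TensorAlgebra.ι ℚ (par w) := by
  simp [parT]

instance : SuperAlgebra (TensorAlgebra ℚ W) where
  par := (parT W).toLinearMap
  par_par := by
    intro x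
    have : (parT W).comp (parT W) = AlgHom.id ℚ _ := by
      ext w; simp [parT_ι, par_par]
    exact DFunLike.congr_fun this x
  par_one := map_one (parT W)
  par_mul := map_mul (parT W)

variable {W}

theorem par_ι (w : W) :
    par (TensorAlgebra.ι ℚ w) = TensorAlgebra.ι ℚ (par w) := parT_ι W w

theorem ι_mem_hom {p : ZMod 2} {w : W} (hw : w ∈ hom W p) :
    TensorAlgebra.ι ℚ w ∈ hom (TensorAlgebra ℚ W) p := by
  rw [mem_hom, par_ι, mem_hom.1 hw, map_smul]

/-- The component of parity `p` of a linear map. -/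
def linProj {M N : Type*} [AddCommGroup M] [Module ℚ M] [SuperSpace M]
    [AddCommGroup N] [Module ℚ N] [SuperSpace N] (p : ZMod 2) :
    (M →ₗ[ℚ] N) →ₗ[ℚ] (M →ₗ[ℚ] N) where
  toFun f := (1 / 2 : ℚ) • (f + sgn p • (par ∘ₗ f ∘ₗ par))
  map_add' f g := by
    ext x; simp only [LinearMap.add_apply, LinearMap.smul_apply, LinearMap.comp_apply, map_add]
    module
  map_smul' c f := by
    ext x
    simp only [LinearMap.add_apply, LinearMap.smul_apply, LinearMap.comp_apply, map_smul,
      RingHom.id_apply]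
    module

section linProj
variable {M N : Type*} [AddCommGroup M] [Module ℚ M] [SuperSpace M]
    [AddCommGroup N] [Module ℚ N] [SuperSpace N]

theorem linProj_apply (p : ZMod 2) (f : M →ₗ[ℚ] N) (x : M) :
    linProj p f x = (1 / 2 : ℚ) • (f x + sgn p • par (f (par x))) := rfl

theorem par_linProj (p : ZMod 2) (f : M →ₗ[ℚ] N) (x : M) :
    par (linProj p f x) = sgn p • linProj p f (par x) := by
  simp only [linProj_apply, map_smul, map_add, par_par]
  have := sgn_mul_self p
  rw [smul_comm (sgn p) (1 / 2 : ℚ), smul_add (sgn p), smul_smul (sgn p), this, one_smul, add_comm]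

theorem linProj_add_linProj (f : M →ₗ[ℚ] N) : linProj 0 f + linProj 1 f = f := by
  ext x
  simp only [LinearMap.add_apply, linProj_apply, sgn_zero, sgn_one]
  module

theorem linProj_self {p : ZMod 2} {f : M →ₗ[ℚ] N} (hf : ∀ x, par (f x) = sgn p • f (par x)) :
    linProj p f = f := by
  ext x
  rw [linProj_apply, hf, par_par, smul_smul, sgn_mul_self]
  module

theorem linProj_other {p : ZMod 2} {f : M →ₗ[ℚ] N} (hf : ∀ x, par (f x) = sgn p • f (par x)) :
    linProj (p + 1) f = 0 := by
  ext x
  rw [linProj_apply, hf, par_par, smul_smul, sgn_add, sgn_one,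
    show sgn p * -1 * sgn p = -(sgn p * sgn p) by ring, sgn_mul_self]
  simp

end linProj

/-- The superderivation of parity `p` extending the component of parity `p` of `f`. -/
def superDerOf (p : ZMod 2) (f : W →ₗ[ℚ] TensorAlgebra ℚ W) :
    TensorAlgebra ℚ W →ₗ[ℚ] TensorAlgebra ℚ W :=
  tder (twAlg _ p) (AlgHom.id ℚ _) (linProj p f)

theorem superDerOf_mem (p : ZMod 2) (f : W →ₗ[ℚ] TensorAlgebra ℚ W) :
    superDerOf p f ∈ derOf (TensorAlgebra ℚ W) p := by
  have hmul : ∀ a b, superDerOf p f (a * b) =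
      twAlg _ p a * superDerOf p f b + superDerOf p f a * AlgHom.id ℚ _ b := tder_mul _ _ _
  refine ⟨fun a => ?_, fun a b => ?_⟩
  · have h : (sgn p • (par ∘ₗ superDerOf p f ∘ₗ par)) = superDerOf p f := by
      refine leibniz_ext (φ := twAlg _ p) (ψ := AlgHom.id ℚ _) (fun a b => ?_) hmul (fun w => ?_)
      · have : par (twAlg (TensorAlgebra ℚ W) p (par a)) = twAlg (TensorAlgebra ℚ W) p a := by
          rcases zmod_two_cases p with rfl | rfl
          · simp [twAlg, par_par]
          · simp [twAlg, par_par, parAlg_apply]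
        simp only [LinearMap.smul_apply, LinearMap.comp_apply, par_mul, hmul, map_add, this,
          AlgHom.id_apply, par_par, smul_add, mul_smul_comm, smul_mul_assoc]
      · simp only [LinearMap.smul_apply, LinearMap.comp_apply, par_ι, superDerOf, tder_ι,
          par_linProj, par_par, smul_smul, sgn_mul_self, one_smul]
    have h2 := congrArg (fun g : TensorAlgebra ℚ W →ₗ[ℚ] TensorAlgebra ℚ W => g (par a)) h
    simp only [LinearMap.smul_apply, LinearMap.comp_apply, par_par] at h2
    rw [← h2, smul_smul, sgn_mul_self, one_smul]
  · rw [hmul, twAlg_apply, add_comm]; rfl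

/-- The superderivation of the tensor algebra that extends an arbitrary linear map `f` on the
generators (sum of its even and its odd component). -/
def superDer : (W →ₗ[ℚ] TensorAlgebra ℚ W) →ₗ[ℚ] Der (TensorAlgebra ℚ W) where
  toFun f := ⟨superDerOf 0 f + superDerOf 1 f,
    Submodule.add_mem_sup (superDerOf_mem 0 f) (superDerOf_mem 1 f)⟩
  map_add' f g := by
    ext1
    simp only [superDerOf, map_add, tder_add, Submodule.coe_add]
    abel
  map_smul' c f := by
    ext1
    simp only [superDerOf, map_smul, tder_smul, RingHom.id_apply, Submodule.coe_smul, smul_add]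

theorem superDer_ι (f : W →ₗ[ℚ] TensorAlgebra ℚ W) (w : W) :
    (superDer f).1 (TensorAlgebra.ι ℚ w) = f w := by
  change superDerOf 0 f _ + superDerOf 1 f _ = f w
  rw [superDerOf, superDerOf, tder_ι, tder_ι, ← LinearMap.add_apply, linProj_add_linProj]

theorem superDer_mem {p : ZMod 2} {f : W →ₗ[ℚ] TensorAlgebra ℚ W}
    (hf : ∀ w, par (f w) = sgn p • f (par w)) : (superDer f).1 ∈ derOf (TensorAlgebra ℚ W) p := by
  have h0 : tder (twAlg (TensorAlgebra ℚ W) (p + 1)) (AlgHom.id ℚ _)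
      (0 : W →ₗ[ℚ] TensorAlgebra ℚ W) = 0 := by
    simpa using tder_smul (twAlg (TensorAlgebra ℚ W) (p + 1)) (AlgHom.id ℚ _) 0 0
  have h : (superDer f).1 = superDerOf p f := by
    have h1 : superDerOf (p + 1) f = 0 := by rw [superDerOf, linProj_other hf, h0]
    change superDerOf 0 f + superDerOf 1 f = _
    rcases zmod_two_cases p with rfl | rfl
    · rw [zero_add] at h1; rw [h1, add_zero]
    · rw [show (1 + 1 : ZMod 2) = 0 from rfl] at h1; rw [h1, zero_add]
  rw [h]
  exact superDerOf_mem p f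

end TA

section Geometry
variable (V : Type*) [AddCommGroup V] [Module ℚ V] [SuperSpace V]

/-- The dual `V*`: `V*_p` consists of the functionals that vanish on `V_{p+1}`. -/
instance : SuperSpace (Module.Dual ℚ V) where
  par := LinearMap.lcomp ℚ ℚ (par : V →ₗ[ℚ] V)
  par_par f := by ext v; simp [par_par]

/-- The tensor algebra `T(V*)`. -/
abbrev Fun : Type _ := TensorAlgebra ℚ (Module.Dual ℚ V)

/-- The space `V* ⊕ ΠV*` spanned by the generators `x` and `dx` of the noncommutative forms. -/
def FormGen : Type _ := Module.Dual ℚ V × Module.Dual ℚ V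

instance : AddCommGroup (FormGen V) :=
  inferInstanceAs (AddCommGroup (Module.Dual ℚ V × Module.Dual ℚ V))
instance : Module ℚ (FormGen V) :=
  inferInstanceAs (Module ℚ (Module.Dual ℚ V × Module.Dual ℚ V))

/-- The second summand is parity reversed: `|dx| = |x| + 1`. -/
instance : SuperSpace (FormGen V) where
  par := LinearMap.prodMap par (-par)
  par_par := by
    rintro ⟨x, y⟩
    change ((par (par x), -par (-par y)) : Module.Dual ℚ V × Module.Dual ℚ V) = (x, y)
    simp [par_par]

/-- The algebra of noncommutative forms. With `A = T(V*)` the bimodule of 1-forms is the free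
bimodule `A ⊗ V* ⊗ A` on the symbols `dx`, so that the tensor algebra of its parity reversion over
`A` is the free algebra on `V* ⊕ ΠV*`. -/
abbrev Forms : Type _ := TensorAlgebra ℚ (FormGen V)

/-- The generator `x`. -/
def genX : Module.Dual ℚ V →ₗ[ℚ] FormGen V := LinearMap.inl ℚ _ _
/-- The generator `dx`. -/
def genDX : Module.Dual ℚ V →ₗ[ℚ] FormGen V := LinearMap.inr ℚ _ _
/-- The map `x ↦ x`, `dx ↦ 0`. -/
def fstGen : FormGen V →ₗ[ℚ] Module.Dual ℚ V := LinearMap.fst ℚ _ _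
/-- The map `x ↦ 0`, `dx ↦ x`. -/
def sndGen : FormGen V →ₗ[ℚ] Module.Dual ℚ V := LinearMap.snd ℚ _ _

variable {V} in
theorem par_genX (x : Module.Dual ℚ V) : par (genX V x) = genX V (par x) := by
  change ((par x, -par (0 : Module.Dual ℚ V)) : Module.Dual ℚ V × Module.Dual ℚ V) = (par x, 0)
  simp

variable {V} in
theorem par_genDX (x : Module.Dual ℚ V) : par (genDX V x) = - genDX V (par x) := by
  change ((par (0 : Module.Dual ℚ V), -par x) : Module.Dual ℚ V × Module.Dual ℚ V) =
    -(0, par x)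
  simp

variable {V} in
theorem fstGen_par (w : FormGen V) : fstGen V (par w) = par (fstGen V w) := rfl
variable {V} in
theorem sndGen_par (w : FormGen V) : sndGen V (par w) = - par (sndGen V w) := rfl
variable {V} in
theorem fstGen_genX (x : Module.Dual ℚ V) : fstGen V (genX V x) = x := rfl
variable {V} in
theorem sndGen_genX (x : Module.Dual ℚ V) : sndGen V (genX V x) = 0 := rfl

/-- The 1-form `dx`. -/
def dx : Module.Dual ℚ V →ₗ[ℚ] Forms V := TensorAlgebra.ι ℚ ∘ₗ genDX V

/-- The inclusion of `T(V*)` into the forms. -/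
def incl : Fun V →ₐ[ℚ] Forms V := TensorAlgebra.lift ℚ (TensorAlgebra.ι ℚ ∘ₗ genX V)

/-- The projection of the forms onto `T(V*)` that sends `dx` to `0`. -/
def retr : Forms V →ₐ[ℚ] Fun V := TensorAlgebra.lift ℚ (TensorAlgebra.ι ℚ ∘ₗ fstGen V)

variable {V}

theorem incl_ι (x : Module.Dual ℚ V) :
    incl V (TensorAlgebra.ι ℚ x) = TensorAlgebra.ι ℚ (genX V x) := by simp [incl]

theorem par_incl (a : Fun V) : par (incl V a) = incl V (par a) := by
  have : (parT (FormGen V)).comp (incl V) = (incl V).comp (parT _) := by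
    ext x
    simp [incl_ι, parT_ι, par_genX]
  exact DFunLike.congr_fun this a

theorem par_retr (a : Forms V) : par (retr V a) = retr V (par a) := by
  have : (parT _).comp (retr V) = (retr V).comp (parT _) := by
    ext x
    simp [retr, parT_ι, fstGen_par]
  exact DFunLike.congr_fun this a

theorem retr_incl (a : Fun V) : retr V (incl V a) = a := by
  have : (retr V).comp (incl V) = AlgHom.id ℚ _ := by
    ext x
    simp [incl_ι, retr, fstGen_genX]
  exact DFunLike.congr_fun this a

section CycMap
variable {R S : Type*} [Ring R] [Algebra ℚ R] [SuperAlgebra R] [Ring S] [Algebra ℚ S]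
  [SuperAlgebra S]

theorem comm_le_comap (f : R →ₐ[ℚ] S) (hf : ∀ a, par (f a) = f (par a)) :
    comm R ≤ (comm S).comap f.toLinearMap := by
  refine Submodule.span_le.2 ?_
  rintro _ ⟨q, r, a, ha, b, hb, rfl⟩
  have h : ∀ {q} {a : R}, a ∈ hom R q → f a ∈ hom S q := by
    intro q a ha
    rw [mem_hom, hf, mem_hom.1 ha, map_smul]
  have := comm_mem (h ha) (h hb)
  simpa using this

/-- The map `R / [R, R] → S / [S, S]` induced by a parity-preserving algebra homomorphism. -/
def cycMap (f : R →ₐ[ℚ] S) (hf : ∀ a, par (f a) = f (par a)) : Cyc R →ₗ[ℚ] Cyc S :=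
  (comm R).mapQ (comm S) f.toLinearMap (comm_le_comap f hf)

theorem cycMap_mk (f : R →ₐ[ℚ] S) (hf : ∀ a, par (f a) = f (par a)) (a : R) :
    cycMap f hf (Cyc.mk R a) = Cyc.mk S (f a) := rfl

theorem par_cycDer {p : ZMod 2} {D : Der R} (hD : D.1 ∈ derOf R p) (x : Cyc R) :
    par (cycDer R D x) = sgn p • cycDer R D (par x) := by
  obtain ⟨x, rfl⟩ := Cyc.mk_surjective x
  rw [cycDer_mk, Cyc.par_mk, Cyc.par_mk, cycDer_mk, hD.1, map_smul]

end CycMap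

variable (V)

/-- The noncommutative de Rham complex `DR(V)`: forms modulo supercommutators. -/
abbrev DR : Type _ := Cyc (Forms V)
/-- The space `𝔥[V] = DR⁰(V) = T(V*)/[T(V*), T(V*)]` of noncommutative 0-forms, which is
`⨁ᵢ ((V*)^{⊗ i})_{ℤ/i}`. -/
abbrev Ham : Type _ := Cyc (Fun V)

/-- The de Rham differential: the superderivation with `x ↦ dx`, `dx ↦ 0`. -/
def deRham : Der (Forms V) := superDer (dx V ∘ₗ fstGen V)

theorem deRham_mem : (deRham V).1 ∈ derOf (Forms V) 1 := by
  refine superDer_mem (fun w => ?_)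
  simp only [LinearMap.comp_apply, dx, par_ι, fstGen_par, par_genDX, sgn_one, map_neg]
  module

/-- The contraction `i_ξ`: the superderivation of the forms with `x ↦ 0`, `dx ↦ ξ(x)`. -/
def contr : Der (Fun V) →ₗ[ℚ] Der (Forms V) where
  toFun ξ := superDer ((incl V).toLinearMap ∘ₗ ξ.1 ∘ₗ TensorAlgebra.ι ℚ ∘ₗ sndGen V)
  map_add' ξ η := by
    rw [← map_add]; congr 1; ext x; simp
  map_smul' c ξ := by
    rw [← map_smul]; congr 1; ext x; simp

variable {V}

theorem contr_genX (ξ : Der (Fun V)) (x : Module.Dual ℚ V) :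
    (contr V ξ).1 (TensorAlgebra.ι ℚ (genX V x)) = 0 := by
  simp [contr, superDer_ι, sndGen_genX]

theorem contr_mem {p : ZMod 2} {ξ : Der (Fun V)} (hξ : ξ.1 ∈ derOf (Fun V) p) :
    (contr V ξ).1 ∈ derOf (Forms V) (p + 1) := by
  refine superDer_mem (fun w => ?_)
  simp only [LinearMap.comp_apply, AlgHom.toLinearMap_apply, par_incl, hξ.1, par_ι, sndGen_par,
    map_neg, map_smul, sgn_add, sgn_one]
  module

variable (V)

/-- The map `𝔥[V] → DR(V)` -/
def inclDR : Ham V →ₗ[ℚ] DR V := cycMap (incl V) par_incl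

/-- The de Rham differential on 0-forms. -/
def dHam : Ham V →ₗ[ℚ] DR V := cycDer _ (deRham V) ∘ₗ inclDR V

/-- The subspace `DR¹(V)` of `DR(V)`. -/
def oneForms : Submodule ℚ (DR V) := Submodule.span ℚ
  {θ | ∃ (a b : Fun V) (x : Module.Dual ℚ V), θ = Cyc.mk _ (incl V a * dx V x * incl V b)}

/-- The constant 2-forms `∑ dxᵢ dyᵢ`. -/
def constTwoForms : Submodule ℚ (DR V) := Submodule.span ℚ
  {θ | ∃ x y : Module.Dual ℚ V, θ = Cyc.mk _ (dx V x * dx V y)}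

/-- `ξ ↦ i_ξ(ω)`. -/
def contrWith (ω : DR V) : Der (Fun V) →ₗ[ℚ] DR V :=
  (cycDer (Forms V)).flip ω ∘ₗ contr V

/-- A constant odd symplectic form on `V`: a constant odd 2-form that is closed and for which
`ξ ↦ i_ξ(ω)` is a bijection of `Der[T(V*)]` onto `DR¹(V)`. -/
structure OddSymplecticForm where
  form : DR V
  const : form ∈ constTwoForms V
  odd : form ∈ hom (DR V) 1
  closed : cycDer _ (deRham V) form = 0
  injective : Function.Injective (contrWith V form)
  range_eq : LinearMap.range (contrWith V form) = oneForms V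

variable {V}

theorem deRham_incl_mem (a : Fun V) : Cyc.mk _ ((deRham V).1 (incl V a)) ∈ oneForms V := by
  have hL := (deRham_mem V).2
  have h1 : (deRham V).1 1 = 0 := by
    have := hL 1 1
    rw [← twAlg_apply, map_one (twAlg (Forms V) 1)] at this
    simpa using this
  suffices h : ∀ a : Fun V, ∀ b c : Fun V,
      Cyc.mk _ (incl V b * (deRham V).1 (incl V a) * incl V c) ∈ oneForms V by
    simpa using h a 1 1
  intro a
  induction a using TensorAlgebra.induction with
  | algebraMap r =>
    intro b c
    rw [AlgHom.commutes, Algebra.algebraMap_eq_smul_one, map_smul, h1]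
    simp
  | ι x =>
    intro b c
    refine Submodule.subset_span ⟨b, c, x, ?_⟩
    simp [incl_ι, deRham, superDer_ι, fstGen_genX]
  | mul a a' ha ha' =>
    intro b c
    have e : incl V b * (deRham V).1 (incl V (a * a')) * incl V c =
        incl V b * (deRham V).1 (incl V a) * incl V (a' * c) +
        incl V (b * tw _ 1 a) * (deRham V).1 (incl V a') * incl V c := by
      simp only [map_mul, hL, tw_one, par_incl]
      noncomm_ring
    rw [e, map_add]
    exact add_mem (ha _ _) (ha' _ _)
  | add a a' ha ha' =>
    intro b c
    rw [map_add, map_add, mul_add, add_mul, map_add]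
    exact add_mem (ha _ _) (ha' _ _)

theorem dHam_mem (a : Ham V) : dHam V a ∈ oneForms V := by
  obtain ⟨a, rfl⟩ := Cyc.mk_surjective a
  exact deRham_incl_mem a

theorem inclDR_injective : Function.Injective (inclDR V) := by
  have : Function.LeftInverse (cycMap (retr V) par_retr) (inclDR V) := by
    intro x
    obtain ⟨x, rfl⟩ := Cyc.mk_surjective x
    rw [inclDR, cycMap_mk, cycMap_mk, retr_incl]
  exact this.injective

namespace OddSymplecticForm
variable (ω : OddSymplecticForm V)

/-- The vector field `α` attached to a 0-form `a` by `da = i_α(ω)`. -/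
def hamVec : Ham V →ₗ[ℚ] Der (Fun V) :=
  (LinearEquiv.ofInjective (contrWith V ω.form) ω.injective).symm.toLinearMap ∘ₗ
    (dHam V).codRestrict (LinearMap.range (contrWith V ω.form))
      (fun a => ω.range_eq ▸ dHam_mem a)

theorem hamVec_spec (a : Ham V) : cycDer _ (contr V (ω.hamVec a)) ω.form = dHam V a := by
  have := (LinearEquiv.ofInjective (contrWith V ω.form) ω.injective).apply_symm_apply
    ((dHam V).codRestrict (LinearMap.range (contrWith V ω.form))
      (fun a => ω.range_eq ▸ dHam_mem a) a)
  exact congrArg Subtype.val this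

/-- The odd bracket `{a, b} = L_α(b)` on `𝔥[V]`; on 0-forms `L_α` is induced by `α`. -/
def bracket : Ham V →ₗ[ℚ] Ham V →ₗ[ℚ] Ham V := cycDer _ ∘ₗ ω.hamVec

theorem dHam_hom {p : ZMod 2} {a : Ham V} (ha : a ∈ hom (Ham V) p) :
    dHam V a ∈ hom (DR V) (p + 1) := by
  obtain ⟨a, rfl⟩ := Cyc.mk_surjective a
  rw [mem_hom] at *
  have h : par (inclDR V (Cyc.mk _ a)) = sgn p • inclDR V (Cyc.mk _ a) := by
    rw [← map_smul, ← ha, inclDR, cycMap_mk, Cyc.par_mk, Cyc.par_mk, cycMap_mk, par_incl]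
  rw [dHam, LinearMap.comp_apply, par_cycDer (deRham_mem V), h, map_smul, smul_smul, sgn_add,
    mul_comm]

theorem contr_form_hom {p : ZMod 2} {ξ : Der (Fun V)} (hξ : ξ.1 ∈ derOf (Fun V) p) :
    cycDer _ (contr V ξ) ω.form ∈ hom (DR V) p := by
  rw [mem_hom, par_cycDer (contr_mem hξ), mem_hom.1 ω.odd, map_smul, smul_smul, ← sgn_add]
  rcases zmod_two_cases p with rfl | rfl <;> rfl

theorem hamVec_mem {p : ZMod 2} {a : Ham V} (ha : a ∈ hom (Ham V) p) :
    (ω.hamVec a).1 ∈ derOf (Fun V) (p + 1) := by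
  obtain ⟨E, hE, F, hF, h⟩ : ∃ E ∈ derOf (Fun V) p, ∃ F ∈ derOf (Fun V) (p + 1),
      E + F = (ω.hamVec a).1 := by
    obtain ⟨E, hE, F, hF, h⟩ := Submodule.mem_sup.1 (ω.hamVec a).2
    rcases zmod_two_cases p with rfl | rfl
    · exact ⟨E, hE, F, hF, h⟩
    · exact ⟨F, hF, E, hE, by rw [add_comm, h]⟩
  have hle : ∀ q, derOf (Fun V) q ≤ Der (Fun V) := by
    intro q
    rcases zmod_two_cases q with rfl | rfl
    · exact le_sup_left
    · exact le_sup_right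
  let E' : Der (Fun V) := ⟨E, hle _ hE⟩
  let F' : Der (Fun V) := ⟨F, hle _ hF⟩
  have hEF : ω.hamVec a = E' + F' := Subtype.ext h.symm
  have h1 := ω.contr_form_hom (ξ := E') hE
  have h2 := ω.contr_form_hom (ξ := F') hF
  have h3 := ω.hamVec_spec a
  rw [hEF, map_add, map_add, LinearMap.add_apply] at h3
  have h4 : cycDer _ (contr V E') ω.form ∈ hom (DR V) (p + 1) := by
    rw [eq_sub_of_add_eq h3]
    exact sub_mem (dHam_hom ha) h2
  have h5 : contrWith V ω.form E' = contrWith V ω.form 0 := by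
    rw [map_zero]; exact hom_inf h1 h4
  have h6 : E = 0 := congrArg Subtype.val (ω.injective h5)
  rw [← h, h6, zero_add]
  exact hF

theorem bracket_mem {p q : ZMod 2} {a b : Ham V} (ha : a ∈ hom (Ham V) p)
    (hb : b ∈ hom (Ham V) q) : ω.bracket a b ∈ hom (Ham V) (p + q + 1) := by
  rw [mem_hom] at *
  change par (cycDer _ (ω.hamVec a) b) = _
  rw [par_cycDer (ω.hamVec_mem ha), hb, map_smul, smul_smul, ← sgn_add,
    show p + 1 + q = p + q + 1 by ring]
  rfl

theorem contr_deRham (ξ : Der (Fun V)) (b : Fun V) :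
    (contr V ξ).1 ((deRham V).1 (incl V b)) = incl V (ξ.1 b) := by
  suffices h : ∀ p, ∀ ξ : Der (Fun V), ξ.1 ∈ derOf (Fun V) p →
      (contr V ξ).1 ((deRham V).1 (incl V b)) = incl V (ξ.1 b) by
    obtain ⟨E, hE, F, hF, hs⟩ := Submodule.mem_sup.1 ξ.2
    let E' : Der (Fun V) := ⟨E, Submodule.mem_sup_left hE⟩
    let F' : Der (Fun V) := ⟨F, Submodule.mem_sup_right hF⟩
    have e : ξ = E' + F' := Subtype.ext hs.symm
    rw [e, map_add]
    simp only [Submodule.coe_add, LinearMap.add_apply, map_add]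
    rw [h 0 E' hE, h 1 F' hF]
  clear ξ
  intro p ξ hξ
  have hc := contr_mem hξ
  have hz : ∀ a : Fun V, (contr V ξ).1 (incl V a) = 0 := by
    have : (contr V ξ).1 ∘ₗ (incl V).toLinearMap = 0 := by
      refine leibniz_ext (φ := (incl V).comp (twAlg _ (p + 1))) (ψ := incl V)
        (fun a b => ?_) (fun a b => by simp) (fun w => ?_)
      · simp only [LinearMap.comp_apply, AlgHom.toLinearMap_apply, map_mul, hc.2,
          AlgHom.comp_apply, twAlg_apply]
        rw [add_comm]
        rcases zmod_two_cases (p + 1) with h | h <;> rw [h] <;>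
          simp only [tw_zero, tw_one, par_incl]
      · simp [incl_ι, contr_genX]
    intro a
    exact DFunLike.congr_fun this a
  have : (contr V ξ).1 ∘ₗ (deRham V).1 ∘ₗ (incl V).toLinearMap =
      (incl V).toLinearMap ∘ₗ ξ.1 := by
    refine leibniz_ext (φ := (incl V).comp (twAlg _ p)) (ψ := incl V)
      (fun a b => ?_) (fun a b => ?_) (fun w => ?_)
    · simp only [LinearMap.comp_apply, AlgHom.toLinearMap_apply, map_mul, hc.2, map_add,
        (deRham_mem V).2, AlgHom.comp_apply, twAlg_apply, tw_one, par_incl, hz, mul_zero,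
        zero_mul, zero_add, add_zero]
      rw [add_comm]
      congr 2
      rcases zmod_two_cases p with rfl | rfl
      · simp only [zero_add, tw_one, tw_zero, par_incl, par_par]
      · simp only [show (1 + 1 : ZMod 2) = 0 from rfl, tw_one, tw_zero]
    · simp only [LinearMap.comp_apply, AlgHom.toLinearMap_apply, map_mul, hξ.2, map_add,
        AlgHom.comp_apply, twAlg_apply]
      rw [add_comm]
    · simp [incl_ι, contr, deRham, superDer_ι, fstGen_genX, dx,
        show ∀ x : Module.Dual ℚ V, sndGen V (genDX V x) = x from fun _ => rfl]
  exact DFunLike.congr_fun this b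

theorem contr_comm {p q : ZMod 2} {ξ η : Der (Fun V)}
    (hξ : ξ.1 ∈ derOf (Fun V) (p + 1)) (hη : η.1 ∈ derOf (Fun V) (q + 1)) (x : Forms V) :
    (contr V ξ).1 ((contr V η).1 x) = sgn (p * q) • (contr V η).1 ((contr V ξ).1 x) := by
  have e : ∀ r : ZMod 2, r + 1 + 1 = r := by decide
  have hξ' := contr_mem hξ
  have hη' := contr_mem hη
  rw [e] at hξ' hη'
  have hinc : ∀ (r : ZMod 2) (ζ : Der (Fun V)), (contr V ζ).1 ∈ derOf (Forms V) r →
      ∀ a : Fun V, (contr V ζ).1 (incl V a) = 0 := by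
    intro r ζ hζ a
    have : (contr V ζ).1 ∘ₗ (incl V).toLinearMap = 0 := by
      refine leibniz_ext (φ := (incl V).comp (twAlg _ r)) (ψ := incl V)
        (fun a b => ?_) (fun a b => by simp) (fun w => ?_)
      · simp only [LinearMap.comp_apply, AlgHom.toLinearMap_apply, map_mul, hζ.2,
          AlgHom.comp_apply, twAlg_apply]
        rw [add_comm]
        rcases zmod_two_cases r with h | h <;> rw [h] <;>
          simp only [tw_zero, tw_one, par_incl]
      · simp [incl_ι, contr_genX]
    exact DFunLike.congr_fun this a
  have hgen : ∀ (ζ : Der (Fun V)) (w : FormGen V),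
      (contr V ζ).1 (TensorAlgebra.ι ℚ w) = incl V (ζ.1 (TensorAlgebra.ι ℚ (sndGen V w))) := by
    intro ζ w
    simp [contr, superDer_ι]
  have htw : ∀ (r s : ZMod 2) (ζ : Der (Fun V)), (contr V ζ).1 ∈ derOf (Forms V) r →
      ∀ a, (contr V ζ).1 (tw _ s a) = sgn (r * s) • tw _ s ((contr V ζ).1 a) := by
    intro r s ζ hζ a
    rcases zmod_two_cases s with rfl | rfl
    · simp [tw_zero, sgn_zero]
    · rw [tw_one, tw_one, hζ.1, smul_smul, mul_one, sgn_mul_self, one_smul]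
  have htt : ∀ (r s : ZMod 2) (a : Forms V), tw _ r (tw _ s a) = tw _ (r + s) a := by
    intro r s a
    rcases zmod_two_cases r with rfl | rfl <;> rcases zmod_two_cases s with rfl | rfl <;>
      simp [tw_zero, tw_one, par_par, show (1 + 1 : ZMod 2) = 0 from rfl]
  have : (contr V ξ).1 ∘ₗ (contr V η).1 - sgn (p * q) • ((contr V η).1 ∘ₗ (contr V ξ).1) = 0 := by
    refine leibniz_ext (φ := twAlg _ (p + q)) (ψ := AlgHom.id ℚ _)
      (fun a b => ?_) (fun a b => by simp) (fun w => ?_)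
    · simp only [LinearMap.sub_apply, LinearMap.smul_apply, LinearMap.comp_apply, hξ'.2, hη'.2,
        map_add, htw p q ξ hξ', htw q p η hη', htt, twAlg_apply, AlgHom.id_apply]
      rw [add_comm q p, mul_comm q p]
      simp only [smul_add, smul_mul_assoc, smul_smul, sgn_mul_self, one_smul, mul_sub, sub_mul,
        mul_smul_comm]
      abel
    · simp only [LinearMap.sub_apply, LinearMap.smul_apply, LinearMap.comp_apply, hgen,
        hinc p ξ hξ', hinc q η hη', smul_zero, sub_zero, LinearMap.zero_apply]
  have h := DFunLike.congr_fun this x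
  simpa [sub_eq_zero] using h

theorem bracket_symm {p q : ZMod 2} {a b : Ham V} (ha : a ∈ hom (Ham V) p)
    (hb : b ∈ hom (Ham V) q) : ω.bracket a b = sgn (p * q) • ω.bracket b a := by
  have key : ∀ a b : Ham V, inclDR V (ω.bracket a b) =
      cycDer _ (contr V (ω.hamVec a)) (cycDer _ (contr V (ω.hamVec b)) ω.form) := by
    intro a b
    rw [hamVec_spec]
    obtain ⟨b, rfl⟩ := Cyc.mk_surjective b
    exact congrArg (Cyc.mk _) (contr_deRham (ω.hamVec a) b).symm
  apply inclDR_injective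
  rw [map_smul, key, key]
  obtain ⟨w, hw⟩ := Cyc.mk_surjective ω.form
  rw [← hw]
  simp only [cycDer_mk]
  rw [← map_smul, contr_comm (ω.hamVec_mem ha) (ω.hamVec_mem hb)]

end OddSymplecticForm

end Geometry

instance {M N : Type*} [AddCommGroup M] [Module ℚ M] [SuperSpace M] [AddCommGroup N] [Module ℚ N]
    [SuperSpace N] : SuperSpace (M ⊗[ℚ] N) where
  par := TensorProduct.map par par
  par_par := by
    intro x
    induction x with
    | zero => simp
    | tmul x y => rw [TensorProduct.map_tmul, TensorProduct.map_tmul, par_par, par_par]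
    | add x y hx hy => rw [map_add, map_add, hx, hy]

section CE
variable (g : Type*) [AddCommGroup g] [Module ℚ g] [SuperSpace g]

/-- The relation `ab = (-1)^{|a||b|} ba` of graded commutativity. -/
inductive SymRel : TensorAlgebra ℚ g → TensorAlgebra ℚ g → Prop
  | swap {p q : ZMod 2} {a b : g} (ha : a ∈ hom g p) (hb : b ∈ hom g q) :
      SymRel (TensorAlgebra.ι ℚ a * TensorAlgebra.ι ℚ b)
        (sgn (p * q) • (TensorAlgebra.ι ℚ b * TensorAlgebra.ι ℚ a))

/-- The symmetric superalgebra `S(g) = ⨁ₙ (g^{⊗ n})_{Sₙ}`, the underlying space of the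
Chevalley–Eilenberg complex. -/
def CE : Type _ := RingQuot (SymRel g)

instance : Ring (CE g) := inferInstanceAs (Ring (RingQuot (SymRel g)))
instance : Algebra ℚ (CE g) := inferInstanceAs (Algebra ℚ (RingQuot (SymRel g)))

namespace CE

/-- The quotient map from the tensor algebra. -/
def mk : TensorAlgebra ℚ g →ₐ[ℚ] CE g := RingQuot.mkAlgHom ℚ (SymRel g)

/-- The inclusion of the generators. -/
def ι : g →ₗ[ℚ] CE g := (mk g).toLinearMap ∘ₗ TensorAlgebra.ι ℚ

variable {g}

theorem mk_surjective : Function.Surjective (mk g) := RingQuot.mkAlgHom_surjective ℚ (SymRel g)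

theorem ι_mul_ι {p q : ZMod 2} {a b : g} (ha : a ∈ hom g p) (hb : b ∈ hom g q) :
    ι g a * ι g b = sgn (p * q) • (ι g b * ι g a) := by
  have h := RingQuot.mkAlgHom_rel ℚ (SymRel.swap ha hb)
  rw [map_smul, map_mul, map_mul] at h
  exact h

variable {B : Type*} [Ring B] [Algebra ℚ B]

/-- The universal property of the symmetric superalgebra. -/
def lift (f : g →ₗ[ℚ] B) (hf : ∀ p q : ZMod 2, ∀ a ∈ hom g p, ∀ b ∈ hom g q,
    f a * f b = sgn (p * q) • (f b * f a)) : CE g →ₐ[ℚ] B :=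
  RingQuot.liftAlgHom ℚ ⟨TensorAlgebra.lift ℚ f, by
    rintro _ _ ⟨ha, hb⟩
    simpa using hf _ _ _ ha _ hb⟩

theorem lift_mk (f : g →ₗ[ℚ] B) (hf) (x : TensorAlgebra ℚ g) :
    lift f hf (mk g x) = TensorAlgebra.lift ℚ f x := by
  unfold lift mk
  exact RingQuot.liftAlgHom_mkAlgHom_apply ℚ _ _ x

theorem lift_ι (f : g →ₗ[ℚ] B) (hf) (x : g) : lift f hf (ι g x) = f x := by
  rw [ι, LinearMap.comp_apply, AlgHom.toLinearMap_apply, lift_mk, TensorAlgebra.lift_ι_apply]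

theorem induction {C : CE g → Prop} (algebraMap : ∀ r : ℚ, C (algebraMap ℚ (CE g) r))
    (ι : ∀ x, C (ι g x)) (mul : ∀ a b, C a → C b → C (a * b))
    (add : ∀ a b, C a → C b → C (a + b)) (x : CE g) : C x := by
  obtain ⟨x, rfl⟩ := mk_surjective x
  induction x using TensorAlgebra.induction with
  | algebraMap r => rw [AlgHom.commutes]; exact algebraMap r
  | ι x => exact ι x
  | mul a b ha hb => rw [map_mul]; exact mul _ _ ha hb
  | add a b ha hb => rw [map_add]; exact add _ _ ha hb

theorem algHom_ext {φ ψ : CE g →ₐ[ℚ] B} (h : ∀ x, φ (ι g x) = ψ (ι g x)) : φ = ψ := by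
  ext x
  induction x using CE.induction with
  | algebraMap r => simp
  | ι x => exact h x
  | mul a b ha hb => rw [map_mul, map_mul, ha, hb]
  | add a b ha hb => rw [map_add, map_add, ha, hb]

/-- The parity involution of the symmetric superalgebra. -/
def parS : CE g →ₐ[ℚ] CE g := lift (ι g ∘ₗ par) (by
  intro p q a ha b hb
  simp only [LinearMap.comp_apply, mem_hom.1 ha, mem_hom.1 hb, map_smul]
  rw [smul_mul_smul_comm, ι_mul_ι ha hb, smul_mul_smul_comm, smul_comm, mul_comm (sgn q)])

theorem parS_ι (x : g) : parS (ι g x) = ι g (par x) := by simp [parS, lift_ι]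

instance : SuperAlgebra (CE g) where
  par := parS.toLinearMap
  par_par := by
    intro x
    have : (parS (g := g)).comp parS = AlgHom.id ℚ _ :=
      algHom_ext fun x => by simp [parS_ι, par_par]
    exact DFunLike.congr_fun this x
  par_one := map_one (parS (g := g))
  par_mul := map_mul (parS (g := g))

theorem par_ι (x : g) : par (ι g x) = ι g (par x) := parS_ι x

theorem ι_mem {p : ZMod 2} {x : g} (hx : x ∈ hom g p) : ι g x ∈ hom (CE g) p := by
  rw [mem_hom, par_ι, mem_hom.1 hx, map_smul]

theorem mul_ι {q : ZMod 2} {b : g} (hb : b ∈ hom g q) (x : CE g) :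
    x * ι g b = ι g b * tw (CE g) q x := by
  induction x using CE.induction with
  | algebraMap r =>
    rw [← twAlg_apply, AlgHom.commutes, Algebra.commutes]
  | ι a =>
    have h := LinearMap.congr_fun (ext_hom (f := LinearMap.mulRight ℚ (ι g b) ∘ₗ ι g)
      (g := LinearMap.mulLeft ℚ (ι g b) ∘ₗ tw _ q ∘ₗ ι g) (fun p a ha => by
        simp only [LinearMap.comp_apply, LinearMap.mulRight_apply, LinearMap.mulLeft_apply]
        rw [tw_of_mem (ι_mem ha), mul_smul_comm, ι_mul_ι ha hb, mul_comm])) a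
    exact h
  | mul x y hx hy => rw [tw_mul, mul_assoc, hy, ← mul_assoc, hx, mul_assoc]
  | add x y hx hy => rw [add_mul, hx, hy, map_add, mul_add]

theorem mul_ι_of_mem {p q : ZMod 2} {x : CE g} (hx : x ∈ hom (CE g) p) {b : g}
    (hb : b ∈ hom g q) : x * ι g b = sgn (p * q) • (ι g b * x) := by
  rw [mul_ι hb, tw_of_mem hx, mul_smul_comm, mul_comm]

theorem leibniz_ext {φ ψ : CE g →ₐ[ℚ] B} {D E : CE g →ₗ[ℚ] B}
    (hD : ∀ a b, D (a * b) = φ a * D b + D a * ψ b)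
    (hE : ∀ a b, E (a * b) = φ a * E b + E a * ψ b)
    (h : ∀ w, D (ι g w) = E (ι g w)) : D = E := by
  have hD1 : D 1 = 0 := by simpa using hD 1 1
  have hE1 : E 1 = 0 := by simpa using hE 1 1
  ext x
  induction x using CE.induction with
  | algebraMap r => rw [Algebra.algebraMap_eq_smul_one, map_smul, map_smul, hD1, hE1]
  | ι w => exact h w
  | mul a b ha hb => rw [hD, hE, ha, hb]
  | add a b ha hb => rw [map_add, map_add, ha, hb]

/-- The condition under which `f` extends from generators to a map `D` on `S(g)` with
`D (a b) = φ a * D b + D a * ψ b`. -/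
def Compat (φ ψ : CE g →ₐ[ℚ] B) (f : g →ₗ[ℚ] B) : Prop :=
  ∀ p q : ZMod 2, ∀ a ∈ hom g p, ∀ b ∈ hom g q,
    φ (ι g a) * f b + f a * ψ (ι g b) = sgn (p * q) • (φ (ι g b) * f a + f b * ψ (ι g a))

/-- The algebra homomorphism `a ↦ [[φ a, D a], [0, ψ a]]`. -/
def cderHom (φ ψ : CE g →ₐ[ℚ] B) (f : g →ₗ[ℚ] B) (hf : Compat φ ψ f) :
    CE g →ₐ[ℚ] Matrix (Fin 2) (Fin 2) B :=
  lift (triLin (φ.toLinearMap ∘ₗ ι g) f (ψ.toLinearMap ∘ₗ ι g)) (by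
    intro p q a ha b hb
    have h1 := congrArg φ (ι_mul_ι ha hb)
    have h2 := congrArg ψ (ι_mul_ι ha hb)
    have h3 := hf p q a ha b hb
    simp only [map_mul, map_smul] at h1 h2
    ext i j
    fin_cases i <;> fin_cases j <;>
      simp [triLin, Matrix.mul_apply, Fin.sum_univ_two, h1, h2, h3])

/-- The linear map `D` on `S(g)` with `D a = f a` on generators and `D (a b) = φ a * D b + D a * ψ b`. -/
def cder (φ ψ : CE g →ₐ[ℚ] B) (f : g →ₗ[ℚ] B) (hf : Compat φ ψ f) : CE g →ₗ[ℚ] B :=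
  Matrix.entryLinearMap ℚ B 0 1 ∘ₗ (cderHom φ ψ f hf).toLinearMap

theorem cder_ι (φ ψ : CE g →ₐ[ℚ] B) (f : g →ₗ[ℚ] B) (hf : Compat φ ψ f) (x : g) :
    cder φ ψ f hf (ι g x) = f x := by
  simp [cder, cderHom, lift_ι, triLin]

theorem cderHom_apply (φ ψ : CE g →ₐ[ℚ] B) (f : g →ₗ[ℚ] B) (hf : Compat φ ψ f) (x : CE g) :
    cderHom φ ψ f hf x = !![φ x, cder φ ψ f hf x; 0, ψ x] := by
  have key : (cderHom φ ψ f hf x) 0 0 = φ x ∧ (cderHom φ ψ f hf x) 1 0 = 0 ∧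
      (cderHom φ ψ f hf x) 1 1 = ψ x := by
    induction x using CE.induction with
    | algebraMap r => simp [Matrix.algebraMap_matrix_apply]
    | ι w => simp [cderHom, lift_ι, triLin]
    | mul a b ha hb =>
      simp only [map_mul, Matrix.mul_apply, Fin.sum_univ_two, ha, hb]
      simp
    | add a b ha hb =>
      simp only [map_add, Matrix.add_apply, ha, hb]
      simp
  ext i j
  fin_cases i <;> fin_cases j
  · simpa using key.1
  · rfl
  · simpa using key.2.1
  · simpa using key.2.2

theorem cder_mul (φ ψ : CE g →ₐ[ℚ] B) (f : g →ₗ[ℚ] B) (hf : Compat φ ψ f) (a b : CE g) :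
    cder φ ψ f hf (a * b) = φ a * cder φ ψ f hf b + cder φ ψ f hf a * ψ b := by
  have h := congrFun (congrFun (cderHom_apply φ ψ f hf (a * b)) 0) 1
  rw [map_mul, cderHom_apply, cderHom_apply, Matrix.mul_apply] at h
  simpa [Fin.sum_univ_two] using h.symm

theorem cder_lin (φ ψ : CE g →ₐ[ℚ] B) {f f₁ f₂ : g →ₗ[ℚ] B} (c : ℚ) (h : f = c • f₁ + f₂)
    (hf : Compat φ ψ f) (hf₁ : Compat φ ψ f₁) (hf₂ : Compat φ ψ f₂) :
    cder φ ψ f hf = c • cder φ ψ f₁ hf₁ + cder φ ψ f₂ hf₂ := by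
  refine leibniz_ext (cder_mul φ ψ f hf) (fun a b => ?_) (fun x => ?_)
  · simp only [LinearMap.add_apply, LinearMap.smul_apply, cder_mul, mul_add, add_mul, smul_add,
      mul_smul_comm, smul_mul_assoc]
    abel
  · simp only [LinearMap.add_apply, LinearMap.smul_apply, cder_ι, h]

end CE

/-- A graded symmetric bracket of odd degree (the Jacobi identity is not part of the data). -/
structure OddBracket where
  br : g →ₗ[ℚ] g →ₗ[ℚ] g
  mem : ∀ {p q : ZMod 2} {a b : g}, a ∈ hom g p → b ∈ hom g q → br a b ∈ hom g (p + q + 1)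
  symm : ∀ {p q : ZMod 2} {a b : g}, a ∈ hom g p → b ∈ hom g q →
    br a b = sgn (p * q) • br b a

/-- A linear map `g → g ⊗ g` of odd degree. -/
structure OddCobracket where
  cobr : g →ₗ[ℚ] g ⊗[ℚ] g
  mem : ∀ {p : ZMod 2} {a : g}, a ∈ hom g p → cobr a ∈ hom (g ⊗[ℚ] g) (p + 1)

variable {g}

namespace OddBracket
open CE
variable (L : OddBracket g)

theorem compat_ad (p : ZMod 2) (a : g) :
    Compat (twAlg (CE g) (p + 1)) (AlgHom.id ℚ _) (ι g ∘ₗ L.br (proj g p a)) := by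
  intro q r b hb c hc
  have ha := proj_mem p a
  have e1 : ∀ p q r : ZMod 2, (p + q + 1) * r = q * r + (p + 1) * r := by decide
  have e2 : ∀ p q r : ZMod 2, q * r + (p + r + 1) * q = (p + 1) * q := by decide
  simp only [LinearMap.comp_apply, twAlg_apply, AlgHom.id_apply, tw_of_mem (ι_mem hb),
    tw_of_mem (ι_mem hc)]
  rw [ι_mul_ι (L.mem ha hb) hc, smul_mul_assoc, smul_mul_assoc, ι_mul_ι (L.mem ha hc) hb,
    smul_add, smul_smul, smul_smul, ← sgn_add, ← sgn_add, e2, e1, add_comm]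

/-- For `a ∈ g`, the superderivation `{a, -}` of `S(g)` of parity `|a| + 1` extending `{a, -}` on `g`. -/
def ad : g →ₗ[ℚ] CE g →ₗ[ℚ] CE g where
  toFun a := ∑ p : ZMod 2, cder (twAlg (CE g) (p + 1)) (AlgHom.id ℚ _) _ (L.compat_ad p a)
  map_add' a b := by
    rw [← Finset.sum_add_distrib]
    refine Finset.sum_congr rfl fun p _ => ?_
    rw [cder_lin (c := 1) (hf₁ := L.compat_ad p a) (hf₂ := L.compat_ad p b), one_smul]
    ext x; simp
  map_smul' c a := by
    rw [RingHom.id_apply, Finset.smul_sum]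
    refine Finset.sum_congr rfl fun p _ => ?_
    rw [cder_lin (c := c - 1) (hf₁ := L.compat_ad p a) (hf₂ := L.compat_ad p a)]
    · module
    · ext x; simp; module

theorem ad_ι (a b : g) : L.ad a (ι g b) = ι g (L.br a b) := by
  have h : L.ad a (ι g b) = ∑ p : ZMod 2, ι g (L.br (proj g p a) b) := by
    simp [ad, cder_ι]
  rw [h, show (Finset.univ : Finset (ZMod 2)) = {0, 1} from rfl,
    Finset.sum_pair (by decide), ← map_add, ← LinearMap.add_apply, ← map_add, proj_add_proj]

theorem ad_eq {p : ZMod 2} {a : g} (ha : a ∈ hom g p) : L.ad a =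
    cder (twAlg (CE g) (p + 1)) (AlgHom.id ℚ _) _ (L.compat_ad p a) := by
  have h0 : proj g (p + 1) a = 0 := by
    rw [proj_apply, mem_hom.1 ha, smul_smul, sgn_add, sgn_one,
      show sgn p * -1 * sgn p = -(sgn p * sgn p) by ring, sgn_mul_self]
    simp
  have h : cder (twAlg (CE g) (p + 1 + 1)) (AlgHom.id ℚ _) _ (L.compat_ad (p + 1) a) = 0 :=
    CE.leibniz_ext (cder_mul _ _ _ _) (fun a b => by simp) (fun x => by simp [cder_ι, h0])
  have h2 : L.ad a = ∑ p : ZMod 2,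
    cder (twAlg (CE g) (p + 1)) (AlgHom.id ℚ _) _ (L.compat_ad p a) := rfl
  rw [h2, show (Finset.univ : Finset (ZMod 2)) = {0, 1} from rfl, Finset.sum_pair (by decide)]
  rcases zmod_two_cases p with rfl | rfl
  · exact (congrArg _ h).trans (add_zero _)
  · exact (congrArg (· + _) h).trans (zero_add _)

theorem ad_mul {p : ZMod 2} {a : g} (ha : a ∈ hom g p) (x y : CE g) :
    L.ad a (x * y) = L.ad a x * y + tw (CE g) (p + 1) x * L.ad a y := by
  rw [L.ad_eq ha, cder_mul, twAlg_apply, AlgHom.id_apply, add_comm]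

theorem ad_mem {p q : ZMod 2} {a : g} {x : CE g} (ha : a ∈ hom g p) (hx : x ∈ hom (CE g) q) :
    L.ad a x ∈ hom (CE g) (p + q + 1) := by
  have h : par ∘ₗ L.ad a = sgn (p + 1) • (L.ad a ∘ₗ par) := by
    refine CE.leibniz_ext (φ := (parAlg _).comp (twAlg _ (p + 1))) (ψ := parAlg _)
      (fun x y => ?_) (fun x y => ?_) (fun b => ?_)
    · simp only [LinearMap.comp_apply, L.ad_mul ha, map_add, par_mul, AlgHom.comp_apply,
        parAlg_apply, twAlg_apply]
      rw [add_comm]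
    · simp only [LinearMap.comp_apply, LinearMap.smul_apply, L.ad_mul ha, par_mul,
        AlgHom.comp_apply, parAlg_apply, twAlg_apply, smul_add, smul_mul_assoc, mul_smul_comm]
      rw [add_comm]
      rcases zmod_two_cases (p + 1) with h | h <;> rw [h] <;> simp only [tw_zero, tw_one]
    · simp only [LinearMap.comp_apply, LinearMap.smul_apply, CE.par_ι, ad_ι, ← map_smul]
      congr 1
      have := ext_hom (f := par ∘ₗ L.br a) (g := sgn (p + 1) • (L.br a ∘ₗ par))
        (fun q b hb => by
          simp only [LinearMap.comp_apply, LinearMap.smul_apply, mem_hom.1 (L.mem ha hb),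
            mem_hom.1 hb, map_smul, smul_smul, ← sgn_add]
          rw [add_right_comm])
      simpa using LinearMap.congr_fun this b
  have h2 := LinearMap.congr_fun h x
  rw [LinearMap.comp_apply, LinearMap.smul_apply, LinearMap.comp_apply, mem_hom.1 hx, map_smul,
    smul_smul, ← sgn_add, add_right_comm] at h2
  exact h2

theorem compat_bracket (q : ZMod 2) (y : CE g) :
    Compat (parAlg (CE g)) (twAlg (CE g) q) (L.ad.flip (proj (CE g) q y)) := by
  intro p r a ha b hb
  have hy := proj_mem q y
  have e1 : ∀ p q r : ZMod 2, q * r + (p + q + 1) * r = p * r + r := by decide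
  have e2 : ∀ p r : ZMod 2, p * r + (r * p + p) = p := by decide
  simp only [LinearMap.flip_apply, twAlg_apply, parAlg_apply, tw_of_mem (ι_mem ha),
    tw_of_mem (ι_mem hb), mem_hom.1 (ι_mem ha), mem_hom.1 (ι_mem hb), smul_mul_assoc,
    mul_smul_comm, mul_ι_of_mem (L.ad_mem ha hy) hb, mul_ι_of_mem (L.ad_mem hb hy) ha, smul_add,
    smul_smul, ← sgn_add, e1, e2]
  rw [add_comm]

/-- The odd bracket on `S(g)` extending that of `g` by the Leibniz rule in both arguments:
`{a, -}` is `ad a` for `a ∈ g`, and `{xx', y} = (-1)^{|x|} x {x', y} + (-1)^{|x'||y|} {x, y} x'`. -/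
def bracket : CE g →ₗ[ℚ] CE g →ₗ[ℚ] CE g := LinearMap.flip
  { toFun := fun y => ∑ q : ZMod 2, cder _ _ _ (L.compat_bracket q y)
    map_add' := by
      intro a b
      rw [← Finset.sum_add_distrib]
      refine Finset.sum_congr rfl fun p _ => ?_
      rw [cder_lin (c := 1) (hf₁ := L.compat_bracket p a) (hf₂ := L.compat_bracket p b), one_smul]
      ext x; simp
    map_smul' := by
      intro c a
      rw [RingHom.id_apply, Finset.smul_sum]
      refine Finset.sum_congr rfl fun p _ => ?_
      rw [cder_lin (c := c - 1) (hf₁ := L.compat_bracket p a) (hf₂ := L.compat_bracket p a)]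
      · module
      · ext x; simp; module }

/-- Multiplication by `a` on pairs `(x, δ x)`, by the rule `δ(ax) = {a, x} + (-1)^{|a|} a δ(x)`. -/
def deltaStep : g →ₗ[ℚ] Module.End ℚ (CE g × CE g) where
  toFun a := (LinearMap.mulLeft ℚ (ι g a) ∘ₗ LinearMap.fst ℚ _ _).prod
    (L.ad a ∘ₗ LinearMap.fst ℚ _ _ +
      LinearMap.mulLeft ℚ (par (ι g a)) ∘ₗ LinearMap.snd ℚ _ _)
  map_add' a b := by
    ext x <;> simp [add_mul, add_comm]
  map_smul' c a := by
    ext x <;> simp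

theorem deltaStep_apply (a : g) (x y : CE g) :
    L.deltaStep a (x, y) = (ι g a * x, L.ad a x + par (ι g a) * y) := rfl

/-- The algebra homomorphism defined by `deltaStep`. -/
def deltaHom : CE g →ₐ[ℚ] Module.End ℚ (CE g × CE g) := lift L.deltaStep (by
  intro p q a ha b hb
  have hxy : ∀ x y : CE g, L.deltaStep a (L.deltaStep b (x, y)) =
      sgn (p * q) • L.deltaStep b (L.deltaStep a (x, y)) := by
    intro x y
    have hs := congrArg (ι g) (L.symm ha hb)
    rw [map_smul] at hs
    have hm := ι_mul_ι ha hb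
    simp only [deltaStep_apply, Prod.smul_mk, L.ad_mul ha, L.ad_mul hb, ad_ι,
      tw_of_mem (ι_mem ha), tw_of_mem (ι_mem hb), mem_hom.1 (ι_mem ha), mem_hom.1 (ι_mem hb),
      hs, mul_add, smul_add, smul_mul_assoc, mul_smul_comm, ← mul_assoc, hm, smul_smul]
    refine Prod.ext rfl ?_
    simp only [← sgn_add]
    have e1 : ∀ p q : ZMod 2, (p + 1) * q = p * q + q := by decide
    have e2 : ∀ p q : ZMod 2, p * q + (q + 1) * p = p := by decide
    have e3 : ∀ p q : ZMod 2, q + p + p * q = p * q + p + q := by decide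
    rw [e1, e2, e3]
    abel
  exact LinearMap.ext fun z => hxy z.1 z.2)

/-- The Chevalley–Eilenberg differential (`g` has zero differential),
`δ(g₁⋯gₙ) = ∑_{i<j} ± {gᵢ, gⱼ} g₁⋯ĝᵢ⋯ĝⱼ⋯gₙ` with the Koszul sign of moving `gᵢ, gⱼ` to the front. It is
the map with `δ(1) = 0` and `δ(ax) = {a, x} + (-1)^{|a|} a δ(x)` for `a ∈ g`. -/
def delta : CE g →ₗ[ℚ] CE g where
  toFun x := (L.deltaHom x (1, 0)).2
  map_add' x y := by simp
  map_smul' c x := by simp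

theorem delta_one : L.delta 1 = 0 := by simp [delta]

theorem delta_ι_mul (a : g) (x : CE g) :
    L.delta (ι g a * x) = L.ad a x + par (ι g a) * L.delta x := by
  have h : ∀ x : CE g, (L.deltaHom x (1, 0)).1 = x := by
    intro x
    have h2 : ∀ (x y : CE g) (z : CE g), (L.deltaHom x (y, z)).1 = x * y := by
      intro x
      induction x using CE.induction with
      | algebraMap r => intro y z; simp [Algebra.algebraMap_eq_smul_one]
      | ι a => intro y z; rw [deltaHom, lift_ι, deltaStep_apply]
      | mul u v hu hv =>
        intro y z
        rw [map_mul, Module.End.mul_apply, ← Prod.mk.eta (p := L.deltaHom v (y, z)), hu, hv,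
          mul_assoc]
      | add u v hu hv =>
        intro y z
        rw [map_add, LinearMap.add_apply, Prod.fst_add, hu, hv, add_mul]
    rw [h2, mul_one]
  change (L.deltaHom (ι g a * x) (1, 0)).2 = _
  rw [map_mul, Module.End.mul_apply, ← Prod.mk.eta (p := L.deltaHom x (1, 0)), h]
  rw [show L.deltaHom (ι g a) = L.deltaStep a from lift_ι _ _ a, deltaStep_apply]
  rfl

theorem bracket_ι (a : g) (y : CE g) : L.bracket (ι g a) y = L.ad a y := by
  have h : L.bracket (ι g a) y = ∑ q : ZMod 2, L.ad a (proj (CE g) q y) := by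
    simp [bracket, cder_ι]
  rw [h, show (Finset.univ : Finset (ZMod 2)) = {0, 1} from rfl,
    Finset.sum_pair (by decide), ← map_add, proj_add_proj]

end OddBracket

namespace OddCobracket
open CE
variable (C : OddCobracket g)

/-- The map `g ⊗ g → S²(g) ⊂ S(g)`. -/
def mulS : g ⊗[ℚ] g →ₗ[ℚ] CE g :=
  LinearMap.mul' ℚ (CE g) ∘ₗ TensorProduct.map (ι g) (ι g)

theorem par_mulS (x : g ⊗[ℚ] g) : par (mulS x) = mulS (par x) := by
  induction x with
  | zero => simp
  | tmul x y =>
    change par (ι g x * ι g y) = ι g (par x) * ι g (par y)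
    rw [par_mul, CE.par_ι, CE.par_ι]
  | add x y hx hy => simp only [map_add, hx, hy]

theorem mulS_mem {p : ZMod 2} {a : g} (ha : a ∈ hom g p) :
    mulS (C.cobr a) ∈ hom (CE g) (p + 1) := by
  rw [mem_hom, par_mulS, mem_hom.1 (C.mem ha), map_smul]

theorem compat : Compat (parAlg (CE g)) (AlgHom.id ℚ _) (mulS ∘ₗ C.cobr) := by
  intro p q a ha b hb
  have e1 : ∀ p q : ZMod 2, (p + 1) * q = p * q + q := by decide
  have e2 : ∀ p q : ZMod 2, p * q + (q * p + p) = p := by decide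
  simp only [LinearMap.comp_apply, parAlg_apply, AlgHom.id_apply, mem_hom.1 (ι_mem ha),
    mem_hom.1 (ι_mem hb), smul_mul_assoc, mul_ι_of_mem (C.mulS_mem ha) hb,
    mul_ι_of_mem (C.mulS_mem hb) ha, smul_add, smul_smul, ← sgn_add, e1, e2]
  rw [add_comm]

/-- The extension of the cobracket to an odd superderivation of `S(g)` by the Leibniz rule. -/
def Delta : CE g →ₗ[ℚ] CE g := cder _ _ _ C.compat

theorem Delta_ι (a : g) : C.Delta (ι g a) = mulS (C.cobr a) := cder_ι _ _ _ _ a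

theorem Delta_mul (x y : CE g) : C.Delta (x * y) = C.Delta x * y + par x * C.Delta y := by
  rw [Delta, cder_mul, add_comm]; rfl

end OddCobracket
end CE

section Divergence
variable {V : Type*} [AddCommGroup V] [Module ℚ V] [SuperSpace V]

/-- For homogeneous `v`, the map
`f₁⋯f_k ↦ ∑ᵢ (-1)^{|v|(|fᵢ| + ⋯ + |f_k|)} fᵢ(v) (f₁⋯fᵢ₋₁) ⊗ (fᵢ₊₁⋯f_k)`, extended by linearity in `v`.
If `v` is the basis vector dual to a coordinate `x`, then `fᵢ(v) = ∂ₓ(fᵢ)`. On a generator `f` the value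
is `(-1)^{|v|} f(v)`, as only the part of `f` of parity `|v|` contributes. -/
def partialTensor : V →ₗ[ℚ] Fun V →ₗ[ℚ] Fun V ⊗[ℚ] Fun V where
  toFun v := ∑ p : ZMod 2, tder Algebra.TensorProduct.includeLeft
    (Algebra.TensorProduct.includeRight.comp (twAlg (Fun V) p))
    ((LinearMap.toSpanSingleton ℚ (Fun V ⊗[ℚ] Fun V) 1) ∘ₗ
      (sgn p • LinearMap.applyₗ (proj V p v)))
  map_add' v w := by
    rw [← Finset.sum_add_distrib]
    refine Finset.sum_congr rfl fun p _ => ?_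
    rw [← tder_add, map_add, map_add, smul_add, LinearMap.comp_add]
  map_smul' c v := by
    rw [RingHom.id_apply, Finset.smul_sum]
    refine Finset.sum_congr rfl fun p _ => ?_
    rw [← tder_smul, map_smul, map_smul, smul_comm (sgn p) c, LinearMap.comp_smul]

theorem par_partialTensor (v : V) (a : Fun V) :
    par (partialTensor v a) = partialTensor (par v) (par a) := by
  let P : Fun V ⊗[ℚ] Fun V →ₐ[ℚ] Fun V ⊗[ℚ] Fun V :=
    Algebra.TensorProduct.map (parAlg (Fun V)) (parAlg (Fun V))
  have hP : ∀ x, par x = P x := by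
    intro x
    induction x with
    | zero => simp
    | tmul x y => rfl
    | add x y hx hy => rw [map_add, map_add, hx, hy]
  have hproj : ∀ p, proj V p (par v) = par (proj V p v) := by
    intro p; simp only [proj_apply, map_smul, map_add]
  simp only [partialTensor, LinearMap.coe_mk, AddHom.coe_mk, LinearMap.sum_apply, hP, map_sum]
  refine Finset.sum_congr rfl fun p _ => ?_
  set f : Module.Dual ℚ V →ₗ[ℚ] Fun V ⊗[ℚ] Fun V := _ ∘ₗ (sgn p • LinearMap.applyₗ (proj V p v))
  set g : Module.Dual ℚ V →ₗ[ℚ] Fun V ⊗[ℚ] Fun V :=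
    _ ∘ₗ (sgn p • LinearMap.applyₗ (proj V p (par v)))
  have hfg : ∀ x, P (f x) = g (par x) := by
    intro x
    have : (par x : Module.Dual ℚ V) (par (proj V p v)) = x (proj V p v) := by
      change x (par (par _)) = _
      rw [par_par]
    simp only [f, g, LinearMap.comp_apply, LinearMap.smul_apply, LinearMap.applyₗ_apply_apply,
      LinearMap.toSpanSingleton_apply, map_smul, map_one, hproj, this]
  have key : P.toLinearMap ∘ₗ tder Algebra.TensorProduct.includeLeft
      (Algebra.TensorProduct.includeRight.comp (twAlg (Fun V) p)) f =
      tder Algebra.TensorProduct.includeLeft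
      (Algebra.TensorProduct.includeRight.comp (twAlg (Fun V) p)) g ∘ₗ (parAlg _).toLinearMap := by
    refine leibniz_ext (φ := (Algebra.TensorProduct.includeLeft : Fun V →ₐ[ℚ] _).comp (parAlg _))
      (ψ := (Algebra.TensorProduct.includeRight : Fun V →ₐ[ℚ] Fun V ⊗[ℚ] Fun V).comp
        ((twAlg (Fun V) p).comp (parAlg _)))
      (fun a b => ?_) (fun a b => ?_) (fun w => ?_)
    · have h1 : P (1 ⊗ₜ twAlg (Fun V) p b) = 1 ⊗ₜ twAlg (Fun V) p (parAlg _ b) := by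
        rcases zmod_two_cases p with rfl | rfl <;> simp [P, twAlg]
      have h2 : P (a ⊗ₜ 1) = parAlg _ a ⊗ₜ 1 := by simp [P]
      simp only [LinearMap.comp_apply, AlgHom.toLinearMap_apply, tder_mul, map_add, map_mul,
        AlgHom.comp_apply, Algebra.TensorProduct.includeLeft_apply,
        Algebra.TensorProduct.includeRight_apply, h1, h2]
    · simp only [LinearMap.comp_apply, AlgHom.toLinearMap_apply, tder_mul, map_mul,
        AlgHom.comp_apply]
    · simp only [LinearMap.comp_apply, AlgHom.toLinearMap_apply, tder_ι, hfg, parAlg_apply, par_ι]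
  exact DFunLike.congr_fun key a

variable [FiniteDimensional ℚ V]

variable (V) in
/-- The divergence `∇ : Der[T(V*)] → 𝔥[V] ⊗ 𝔥[V]`,
`∇(f₁⋯f_k ∂ₓ) = ∑ᵢ (-1)^{|x|(|fᵢ| + ⋯ + |f_k|)} ∂ₓ(fᵢ) (f₁⋯fᵢ₋₁) ⊗ (fᵢ₊₁⋯f_k)`, summed over the
coordinates `x` with `ξ = ∑ₓ ξ(x) ∂ₓ`. The sum is a contraction of `V` against `V*`, so it does not
depend on the basis, which need not be homogeneous. -/
def divergence : Der (Fun V) →ₗ[ℚ] Ham V ⊗[ℚ] Ham V :=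
  ∑ i, TensorProduct.map (Cyc.mk _) (Cyc.mk _) ∘ₗ
    partialTensor (Module.finBasis ℚ V i) ∘ₗ
    LinearMap.applyₗ (TensorAlgebra.ι ℚ ((Module.finBasis ℚ V).coord i)) ∘ₗ
    (Der (Fun V)).subtype

theorem divergence_apply (ξ : Der (Fun V)) : divergence V ξ =
    ∑ i, TensorProduct.map (Cyc.mk _) (Cyc.mk _) (partialTensor (Module.finBasis ℚ V i)
      (ξ.1 (TensorAlgebra.ι ℚ ((Module.finBasis ℚ V).coord i)))) := by
  simp [divergence]

theorem sum_coord_par {N : Type*} [AddCommGroup N] [Module ℚ N]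
    (F : V →ₗ[ℚ] Module.Dual ℚ V →ₗ[ℚ] N) :
    ∑ i, F (par (Module.finBasis ℚ V i)) (par ((Module.finBasis ℚ V).coord i)) =
      ∑ i, F (Module.finBasis ℚ V i) ((Module.finBasis ℚ V).coord i) := by
  set b := Module.finBasis ℚ V
  have h1 : ∀ i, par (b i) = ∑ j, b.coord j (par (b i)) • b j := fun i => (b.sum_repr _).symm
  have h2 : ∀ j, ∑ i, b.coord j (par (b i)) • par (b.coord i) = b.coord j := by
    intro j
    ext v
    have h3 : ∀ i, (par (b.coord i) : Module.Dual ℚ V) v = b.coord i (par v) := fun _ => rfl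
    simp only [LinearMap.sum_apply, LinearMap.smul_apply, h3, smul_eq_mul]
    have h4 := b.sum_repr (par v)
    calc ∑ i, b.coord j (par (b i)) * b.coord i (par v)
        = b.coord j (par (∑ i, b.repr (par v) i • b i)) := by
          rw [map_sum, map_sum]
          refine Finset.sum_congr rfl fun i _ => ?_
          rw [map_smul, map_smul, smul_eq_mul, mul_comm, Module.Basis.coord_apply b i]
      _ = b.coord j v := by rw [h4, par_par]
  calc ∑ i, F (par (b i)) (par (b.coord i))
      = ∑ i, ∑ j, F (b j) (b.coord j (par (b i)) • par (b.coord i)) := by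
        refine Finset.sum_congr rfl fun i _ => ?_
        conv_lhs => rw [h1 i, map_sum, LinearMap.sum_apply]
        refine Finset.sum_congr rfl fun j _ => ?_
        rw [map_smul, LinearMap.smul_apply, map_smul]
    _ = ∑ j, F (b j) (∑ i, b.coord j (par (b i)) • par (b.coord i)) := by
        rw [Finset.sum_comm]; simp only [map_sum]
    _ = _ := by simp only [h2]

theorem par_divergence {p : ZMod 2} {ξ : Der (Fun V)} (hξ : ξ.1 ∈ derOf (Fun V) p) :
    par (divergence V ξ) = sgn p • divergence V ξ := by
  have hmap : ∀ x : Fun V ⊗[ℚ] Fun V,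
      par (TensorProduct.map (Cyc.mk (Fun V)) (Cyc.mk (Fun V)) x) =
        TensorProduct.map (Cyc.mk (Fun V)) (Cyc.mk (Fun V)) (par x) := by
    intro x
    induction x with
    | zero => simp
    | tmul x y => rfl
    | add x y hx hy => simp only [map_add, hx, hy]
  have h := sum_coord_par (V := V) (((LinearMap.compRight ℚ
    (TensorProduct.map (Cyc.mk (Fun V)) (Cyc.mk (Fun V)))) ∘ₗ
      (LinearMap.lcomp ℚ _ (ξ.1 ∘ₗ TensorAlgebra.ι ℚ)) ∘ₗ partialTensor))
  simp only [LinearMap.comp_apply, LinearMap.lcomp_apply, LinearMap.compRight_apply] at h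
  rw [divergence_apply]
  conv_rhs => rw [← h]
  rw [map_sum, Finset.smul_sum]
  refine Finset.sum_congr rfl fun i _ => ?_
  rw [hmap, par_partialTensor, hξ.1, par_ι]
  simp only [map_smul]

namespace OddSymplecticForm
variable (ω : OddSymplecticForm V)

/-- The odd cobracket `Δ(a) = ½ ∇(α)` on `𝔥[V]`. -/
def cobracket : Ham V →ₗ[ℚ] Ham V ⊗[ℚ] Ham V := (1 / 2 : ℚ) • divergence V ∘ₗ ω.hamVec

theorem cobracket_mem {p : ZMod 2} {a : Ham V} (ha : a ∈ hom (Ham V) p) :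
    ω.cobracket a ∈ hom (Ham V ⊗[ℚ] Ham V) (p + 1) := by
  rw [mem_hom]
  simp only [cobracket, LinearMap.smul_apply, LinearMap.comp_apply, map_smul]
  rw [par_divergence (ω.hamVec_mem ha), smul_comm]

end OddSymplecticForm

end Divergence

section Family
variable (V : Type*) [AddCommGroup V] [Module ℚ V] [SuperSpace V]

/-- Polynomials in the parameter `γ` have even degree. -/
instance : SuperSpace (Polynomial ℚ) where
  par := LinearMap.id
  par_par _ := rfl

/-- The space `𝔩 = ℚ[γ] ⊗ S(𝔥[V])`. -/
abbrev FullDGLA : Type _ := Polynomial ℚ ⊗[ℚ] CE (Ham V)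

namespace OddSymplecticForm
variable {V} (ω : OddSymplecticForm V)

/-- The bracket of `𝔥[V]` with its degree and symmetry. -/
def oddBracket : OddBracket (Ham V) where
  br := ω.bracket
  mem := ω.bracket_mem
  symm := ω.bracket_symm

/-- The cobracket of `𝔥[V]` with its degree. -/
def oddCobracket [FiniteDimensional ℚ V] : OddCobracket (Ham V) where
  cobr := ω.cobracket
  mem := ω.cobracket_mem

/-- The bracket of `𝔩`: the `ℚ[γ]`-bilinear extension of the bracket of `S(𝔥[V])`. -/
def fullBracket : FullDGLA V →ₗ[ℚ] FullDGLA V →ₗ[ℚ] FullDGLA V :=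
  TensorProduct.map₂ (LinearMap.mul ℚ (Polynomial ℚ)) ω.oddBracket.bracket

/-- The deformed differential `d = γ δ + Δ` of `𝔩`. -/
def fullD [FiniteDimensional ℚ V] : FullDGLA V →ₗ[ℚ] FullDGLA V :=
  TensorProduct.map (LinearMap.mulLeft ℚ Polynomial.X) ω.oddBracket.delta +
    TensorProduct.map LinearMap.id ω.oddCobracket.Delta

end OddSymplecticForm

/-- The parameter `ν`: the generator of `S(𝔥[V])` given by the 0-form `1 ∈ ℚ ⊂ 𝔥[V]`. -/
def nu : CE (Ham V) := CE.ι _ (Cyc.mk _ 1)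

/-- The subspace of `𝔩` spanned by the products `γ^i ν^j n` with `(i, j) ∈ I` and `n ∈ N`. It is
`ℚ[γ, ν] ⊗ N` if `I` is everything, and `ℚ₊[γ, ν] ⊗ N` (polynomials that vanish at the origin) if `I`
is everything but `(0, 0)`. -/
def monomialSpan (I : Set (ℕ × ℕ)) (N : Submodule ℚ (CE (Ham V))) :
    Submodule ℚ (FullDGLA V) := Submodule.span ℚ
  {z | ∃ m ∈ I, ∃ n ∈ N, z = (Polynomial.X ^ m.1 : Polynomial ℚ) ⊗ₜ[ℚ] (nu V ^ m.2 * n)}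

/-- The subspace `((V*)^{⊗ n})_{ℤ/n}` of 0-forms of order `n`; it is `V*` for `n = 1`. -/
def hamOrder (n : ℕ) : Submodule ℚ (Ham V) :=
  (LinearMap.range (TensorAlgebra.ι ℚ : Module.Dual ℚ V →ₗ[ℚ] Fun V) ^ n).map (Cyc.mk (Fun V))

/-- The subspace `𝔥_{≥ n}` of 0-forms of order at least `n`. -/
def hamGE (n : ℕ) : Submodule ℚ (Ham V) := ⨆ i ≥ n, hamOrder V i

/-- The subspace `[(𝔥_{≥ 1})^{⊗ k}]_{S_k}` of `S(𝔥[V])`. -/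
def symPower (k : ℕ) : Submodule ℚ (CE (Ham V)) := ((hamGE V 1).map (CE.ι (Ham V))) ^ k

/-- The constants `ℚ[γ, ν] ⊂ 𝔩`. -/
def constants : Submodule ℚ (FullDGLA V) := monomialSpan V Set.univ (symPower V 0)

/-- The quotient `𝔩' = 𝔩 / ℚ[γ, ν]`. -/
abbrev ReducedDGLA : Type _ := FullDGLA V ⧸ constants V

/-- The subspace `Λ_{γ,ν}[V]` of `𝔩'`: the sum of `ℚ₊[γ, ν] ⊗ V*`, of `ℚ[γ, ν] ⊗ 𝔥_{≥ 2}` and of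
`ℚ[γ, ν] ⊗ [(𝔥_{≥ 1})^{⊗ k}]_{S_k}` for `k ≥ 2`. -/
def Lambda : Submodule ℚ (ReducedDGLA V) :=
  (monomialSpan V {(0, 0)}ᶜ ((hamOrder V 1).map (CE.ι (Ham V))) ⊔
    monomialSpan V Set.univ ((hamGE V 2).map (CE.ι (Ham V))) ⊔
    ⨆ k ≥ 2, monomialSpan V Set.univ (symPower V k)).map (constants V).mkQ

/-- The elements of parity `p` of `Λ_{γ,ν}[V]`: the classes of elements of parity `p` of `𝔩`. -/
def lambdaHom (p : ZMod 2) : Submodule ℚ (Lambda V) :=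
  ((hom (FullDGLA V) p).map (constants V).mkQ).comap (Lambda V).subtype

end Family

/-- A differential graded Lie algebra with odd bracket on a `ℤ/2`-graded space `L = L₀ ⊕ L₁`; this is
the structure that makes the parity reversion `ΠL` an ordinary differential graded Lie superalgebra
with `[Πa, Πb] = (-1)^{|a| + 1} Π{a, b}` and `d(Πa) = -Π(da)`. -/
structure OddDGLie (L : Type*) [AddCommGroup L] [Module ℚ L] (gr : ZMod 2 → Submodule ℚ L) where
  bracket : L →ₗ[ℚ] L →ₗ[ℚ] L
  d : L →ₗ[ℚ] L
  grading : DirectSum.IsInternal gr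
  bracket_mem : ∀ (p q : ZMod 2), ∀ a ∈ gr p, ∀ b ∈ gr q, bracket a b ∈ gr (p + q + 1)
  d_mem : ∀ (p : ZMod 2), ∀ a ∈ gr p, d a ∈ gr (p + 1)
  symm : ∀ (p q : ZMod 2), ∀ a ∈ gr p, ∀ b ∈ gr q, bracket a b = sgn (p * q) • bracket b a
  jacobi : ∀ (p q : ZMod 2), ∀ a ∈ gr p, ∀ b ∈ gr q, ∀ c, bracket a (bracket b c) =
    sgn (p + 1) • bracket (bracket a b) c +
      sgn ((p + 1) * (q + 1)) • bracket b (bracket a c)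
  d_d : ∀ a, d (d a) = 0
  d_bracket : ∀ (p : ZMod 2), ∀ a ∈ gr p, ∀ b,
    d (bracket a b) + bracket (d a) b + sgn p • bracket a (d b) = 0

end NCSymp

end

/-!
The structure on `Λ_{γ,ν}[V]` is unique because each of its elements is the class of an element of
`𝔩 = ℚ[γ] ⊗ S(𝔥)`. Existence has three ingredients.

*The symmetric algebra.* For an odd bracket and an odd cobracket on a super vector space `g`, the
identities on `S(g)` follow from identities on generators. The differential `δ` is an operator of
order two whose deviation from the Leibniz rule is the bracket (`OddBracket.delta_mul`). So the Jacobi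
identity on `g` gives `δ² = 0`, this makes `δ` a derivation of the bracket
(`OddBracket.Jacobi.delta_bracket`), and evaluating that on a product gives the Jacobi identity on
`S(g)` (`OddBracket.Jacobi.bracket`). As `Δ` is a derivation of the product, `Δ² = 0` and the
derivation property of `Δ` for the bracket need only be checked on generators, and `δΔ + Δδ = 0`
follows from the latter together with `δΔ = 0` on generators (`OddCobracket.Compatible.delta_Delta`).

*The identities on `𝔥`.* The Jacobi identity comes from Cartan calculus: the Hamiltonian vector field
of `{a, b}` is up to sign the supercommutator of those of `a` and `b`
(`OddSymplecticForm.hamVec_bracket`). For the identities with the cobracket, everything is written in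
terms of words. As `ω` is constant, the Hamiltonian vector field of a letter is constant
(`OddSymplecticForm.hamVec_mk_ι`), so that letters have a symmetric pairing with rational values. The
bracket of two cyclic words is then the sum over all ways to join them along a pair of letters, one
from each, weighted by their pairing (`OddSymplecticForm.bracket_cword`), and the cobracket is the sum
over all ways to cut a cyclic word in two along a pair of its letters
(`OddSymplecticForm.Delta_cycGen`). A composite of two such operations is a sum over two pairs, called
chords. In each of the three identities needed, the terms cancel in pairs: performing the two
operations along the same chords in the other order gives the opposite sign
(`OddSymplecticForm.chord_pair_add`). These identities are co-Jacobi
(`OddSymplecticForm.Delta_Delta_cycGen`), involutivity (`OddSymplecticForm.delta_Delta_cycGen`) and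
the compatibility of bracket and cobracket (`OddSymplecticForm.compatible_cword`). Their
combinatorial part is the bookkeeping of the positions of several letters in a word, which rests on
`cutsum_coassoc` and `cut2_join`.

*Passage to `Λ`.* The element `ν` is central and killed by the differential, as the empty word has no
letters, so bracket and differential descend to `𝔩' = 𝔩 / ℚ[γ, ν]`. The preimage of `Λ` in `𝔩` is
spanned by all monomials in `γ` and cyclic words except for the single letters (`comap_Lambda`).
It is stable under the differential because `γδ` produces multiples of `γ` and `Δ` produces products
of at least two words. It is stable under the bracket because a bracket involving a longer product has
at least two factors. Two words that are joined have at least one letter each, and lose two together,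
so that the result is a single letter only if one of them is
(`OddSymplecticForm.fullBracket_mem_lambdaSpan`).
-/

noncomputable section

namespace NCSymp

open TensorProduct SuperSpace SuperAlgebra

/-! ### Words in homogeneous elements -/

section Signs
variable {M : Type*} [AddCommGroup M] [Module ℚ M]

theorem sgn_smul_smul (p q : ZMod 2) (x : M) : sgn p • sgn q • x = sgn (p + q) • x := by
  rw [smul_smul, sgn_add]

theorem sgn_smul_self (p : ZMod 2) (x : M) : sgn p • sgn p • x = x := by
  rw [smul_smul, sgn_mul_self, one_smul]

theorem sgn_succ (p : ZMod 2) : sgn (p + 1) = - sgn p := by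
  rw [sgn_add, sgn_one, mul_neg_one]

end Signs

section Words
variable (M : Type*) [AddCommGroup M] [Module ℚ M] [SuperSpace M]

/-- A homogeneous element together with its parity (for the zero element, either parity). -/
structure HomEl where
  val : M
  p : ZMod 2
  mem : val ∈ hom M p

variable {M}

theorem par_of_mem {p : ZMod 2} {x : M} (hx : x ∈ hom M p) : par x = sgn p • x := hx

theorem proj_of_mem_other {p q : ZMod 2} {x : M} (hx : x ∈ hom M q) (h : q ≠ p) :
    proj M p x = 0 := by
  have hq : ∀ p q : ZMod 2, q ≠ p → q = p + 1 := by decide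
  have hp : ∀ p : ZMod 2, p + (p + 1) = 1 := by decide
  rw [proj_apply, par_of_mem hx, sgn_smul_smul, hq p q h, hp, sgn_one]
  simp

/-- If homogeneous elements span, then those of parity `p` span the part of parity `p`. -/
theorem hom_induction_of_span {ι : Type*} {S : ι → M} {q : ι → ZMod 2}
    (hS : ∀ i, S i ∈ hom M (q i)) (hspan : Submodule.span ℚ (Set.range S) = ⊤)
    {p : ZMod 2} {C : M → Prop} (zero : C 0) (mem : ∀ i, q i = p → C (S i))
    (add : ∀ x y, C x → C y → C (x + y)) (smul : ∀ (c : ℚ) x, C x → C (c • x))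
    {x : M} (hx : x ∈ hom M p) : C x := by
  suffices h : ∀ y : M, C (proj M p y) by
    simpa [proj_of_mem hx] using h x
  intro y
  have hy : y ∈ Submodule.span ℚ (Set.range S) := hspan ▸ Submodule.mem_top
  induction hy using Submodule.span_induction with
  | mem y h =>
    obtain ⟨i, rfl⟩ := h
    by_cases hi : q i = p
    · rw [proj_of_mem (hi ▸ hS i)]; exact mem i hi
    · rw [proj_of_mem_other (hS i) hi]; exact zero
  | zero => rwa [map_zero]
  | add a b _ _ ha hb => rw [map_add]; exact add _ _ ha hb
  | smul c a _ ha => rw [map_smul]; exact smul _ _ ha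

/-- The parity of a word. -/
def wpar : List (HomEl M) → ZMod 2
  | [] => 0
  | x :: l => x.p + wpar l

theorem wpar_nil : wpar ([] : List (HomEl M)) = 0 := rfl
theorem wpar_cons (x : HomEl M) (l : List (HomEl M)) : wpar (x :: l) = x.p + wpar l := rfl
theorem wpar_append (l m : List (HomEl M)) : wpar (l ++ m) = wpar l + wpar m := by
  induction l with
  | nil => simp [wpar_nil]
  | cons x l ih => rw [List.cons_append, wpar_cons, wpar_cons, ih, add_assoc]

/-- The product of the letters of a word in the tensor algebra. -/
def word : List (HomEl M) → TensorAlgebra ℚ M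
  | [] => 1
  | x :: l => TensorAlgebra.ι ℚ x.val * word l

theorem word_nil : word ([] : List (HomEl M)) = 1 := rfl
theorem word_cons (x : HomEl M) (l : List (HomEl M)) :
    word (x :: l) = TensorAlgebra.ι ℚ x.val * word l := rfl
theorem word_append (l m : List (HomEl M)) : word (l ++ m) = word l * word m := by
  induction l with
  | nil => simp [word_nil]
  | cons x l ih => rw [List.cons_append, word_cons, word_cons, ih, mul_assoc]

theorem one_mem_hom {R : Type*} [Ring R] [Algebra ℚ R] [SuperAlgebra R] : (1 : R) ∈ hom R 0 := by
  rw [mem_hom, par_one, sgn_zero, one_smul]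

theorem word_mem (l : List (HomEl M)) : word l ∈ hom (TensorAlgebra ℚ M) (wpar l) := by
  induction l with
  | nil => exact one_mem_hom
  | cons x l ih => exact mul_mem_hom (ι_mem_hom x.mem) ih

theorem span_word : Submodule.span ℚ (Set.range (word (M := M))) = ⊤ := by
  set S := Submodule.span ℚ (Set.range (word (M := M))) with hS
  have h1 : ∀ x : M, TensorAlgebra.ι ℚ x ∈ S := by
    intro x
    have h : ∀ p, TensorAlgebra.ι ℚ (proj M p x) ∈ S := fun p =>
      Submodule.subset_span ⟨[⟨_, p, proj_mem p x⟩], by simp [word]⟩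
    rw [← proj_add_proj x, map_add]
    exact add_mem (h 0) (h 1)
  have h2 : S * S ≤ S := by
    rw [hS, Submodule.span_mul_span]
    refine Submodule.span_mono ?_
    rintro _ ⟨_, ⟨l, rfl⟩, _, ⟨m, rfl⟩, rfl⟩
    exact ⟨l ++ m, word_append l m⟩
  refine eq_top_iff.2 fun x _ => ?_
  induction x using TensorAlgebra.induction with
  | algebraMap r =>
    rw [Algebra.algebraMap_eq_smul_one]
    exact S.smul_mem r (Submodule.subset_span ⟨[], rfl⟩)
  | ι x => exact h1 x
  | mul a b ha hb => exact h2 (Submodule.mul_mem_mul (ha trivial) (hb trivial))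
  | add a b ha hb => exact add_mem (ha trivial) (hb trivial)

theorem span_map_word {N : Type*} [AddCommGroup N] [Module ℚ N] {f : TensorAlgebra ℚ M →ₗ[ℚ] N}
    (hf : Function.Surjective f) :
    Submodule.span ℚ (Set.range fun l : List (HomEl M) => f (word l)) = ⊤ := by
  have := congrArg (Submodule.map f) (span_word (M := M))
  rw [Submodule.map_span, Submodule.map_top, LinearMap.range_eq_top.2 hf, ← Set.range_comp] at this
  exact this

/-- The class of a word in `T(M) / [T(M), T(M)]`. -/
def cword (l : List (HomEl M)) : Cyc (TensorAlgebra ℚ M) := Cyc.mk _ (word l)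

theorem cword_mem (l : List (HomEl M)) : cword l ∈ hom (Cyc (TensorAlgebra ℚ M)) (wpar l) := by
  rw [mem_hom, cword, Cyc.par_mk, par_of_mem (word_mem l), map_smul]

theorem Cyc.mk_mul_comm {R : Type*} [Ring R] [Algebra ℚ R] [SuperAlgebra R] {p q : ZMod 2}
    {a b : R} (ha : a ∈ hom R p) (hb : b ∈ hom R q) :
    Cyc.mk R (a * b) = sgn (p * q) • Cyc.mk R (b * a) := by
  rw [← sub_eq_zero, ← map_smul, ← map_sub]
  exact (Submodule.Quotient.mk_eq_zero _).2 (comm_mem ha hb)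

/-- A word may be rotated cyclically, at the cost of the Koszul sign. -/
theorem cword_append_comm (l m : List (HomEl M)) :
    cword (l ++ m) = sgn (wpar l * wpar m) • cword (m ++ l) := by
  rw [cword, cword, word_append, word_append, Cyc.mk_mul_comm (word_mem l) (word_mem m)]

theorem cyc_hom_induction {p : ZMod 2} {C : Cyc (TensorAlgebra ℚ M) → Prop} (zero : C 0)
    (mem : ∀ l, wpar l = p → C (cword l)) (add : ∀ x y, C x → C y → C (x + y))
    (smul : ∀ (c : ℚ) x, C x → C (c • x)) {x : Cyc (TensorAlgebra ℚ M)}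
    (hx : x ∈ hom (Cyc (TensorAlgebra ℚ M)) p) : C x :=
  hom_induction_of_span (S := cword) cword_mem (span_map_word Cyc.mk_surjective) zero mem add
    smul hx

namespace CE

/-- The product of the letters of a word in the symmetric superalgebra. -/
def sprod : List (HomEl M) → CE M
  | [] => 1
  | x :: l => ι M x.val * sprod l

theorem sprod_nil : sprod ([] : List (HomEl M)) = 1 := rfl
theorem sprod_cons (x : HomEl M) (l : List (HomEl M)) : sprod (x :: l) = ι M x.val * sprod l := rfl

theorem sprod_eq (l : List (HomEl M)) : sprod l = mk M (word l) := by
  induction l with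
  | nil => exact (map_one _).symm
  | cons x l ih => rw [sprod_cons, word_cons, map_mul, ih]; rfl

theorem sprod_mem (l : List (HomEl M)) : sprod l ∈ hom (CE M) (wpar l) := by
  induction l with
  | nil => exact one_mem_hom
  | cons x l ih => exact mul_mem_hom (ι_mem x.mem) ih

/-- Induction over the elements of parity `p` of `S(g)`, which are spanned by products of
homogeneous generators. -/
theorem hom_induction {p : ZMod 2} {C : CE M → Prop} (zero : C 0)
    (mem : ∀ l, wpar l = p → C (sprod l)) (add : ∀ x y, C x → C y → C (x + y))
    (smul : ∀ (c : ℚ) x, C x → C (c • x)) {x : CE M} (hx : x ∈ hom (CE M) p) : C x := by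
  refine hom_induction_of_span (S := sprod) sprod_mem ?_ zero mem add smul hx
  rw [funext sprod_eq]
  exact span_map_word (f := (mk M).toLinearMap) mk_surjective

/-- A linear map on `S(g)` that vanishes on products of homogeneous generators is zero. -/
theorem eq_zero_of_sprod {N : Type*} [AddCommGroup N] [Module ℚ N] {f : CE M →ₗ[ℚ] N}
    (h : ∀ l, f (sprod l) = 0) (x : CE M) : f x = 0 := by
  have : f = 0 := ext_hom fun p x hx => by
    refine hom_induction (C := fun x => f x = (0 : CE M →ₗ[ℚ] N) x) ?_ ?_ ?_ ?_ hx
    · simp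
    · intro l _; simpa using h l
    · intro x y hx hy; rw [map_add, hx, hy, map_add]
    · intro c x hx; rw [map_smul, hx, map_smul]
  rw [this]; rfl

/-- The algebra `S(g)` is supercommutative. -/
theorem mul_comm_of_mem {p q : ZMod 2} {x y : CE M} (hx : x ∈ hom (CE M) p)
    (hy : y ∈ hom (CE M) q) : x * y = sgn (p * q) • (y * x) := by
  refine hom_induction (C := fun y => x * y = sgn (p * q) • (y * x)) (by simp) ?_ ?_ ?_ hy
  · clear hy
    rintro l rfl
    induction l with
    | nil => simp [sprod_nil, wpar_nil, sgn_zero]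
    | cons b l ih =>
      rw [sprod_cons, wpar_cons, ← mul_assoc, mul_ι_of_mem hx b.mem, smul_mul_assoc, mul_assoc,
        ih, mul_smul_comm, sgn_smul_smul, mul_add, mul_assoc]
  · intro a b ha hb; rw [mul_add, ha, hb, add_mul, smul_add]
  · intro c a ha; rw [mul_smul_comm, ha, smul_mul_assoc, smul_comm]

end CE

end Words

/-! ### Sums over the letters of a word -/

section Cut
variable {X N : Type*} [AddCommMonoid N]

/-- The sum of `f u x v` over all ways to write a word as `u x v` with a letter `x`. -/
def cutsum : List X → (List X → X → List X → N) → N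
  | [], _ => 0
  | x :: l, f => f [] x l + cutsum l fun u y v => f (x :: u) y v

theorem cutsum_nil (f : List X → X → List X → N) : cutsum [] f = 0 := rfl
theorem cutsum_cons (x : X) (l : List X) (f : List X → X → List X → N) :
    cutsum (x :: l) f = f [] x l + cutsum l fun u y v => f (x :: u) y v := rfl

theorem cutsum_append (l m : List X) (f : List X → X → List X → N) :
    cutsum (l ++ m) f =
      cutsum l (fun u x v => f u x (v ++ m)) + cutsum m (fun u x v => f (l ++ u) x v) := by
  induction l generalizing f with
  | nil => simp [cutsum_nil]
  | cons x l ih => simp only [List.cons_append, cutsum_cons, ih, add_assoc]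

theorem cutsum_add (l : List X) (f g : List X → X → List X → N) :
    cutsum l (fun u x v => f u x v + g u x v) = cutsum l f + cutsum l g := by
  induction l generalizing f g with
  | nil => simp [cutsum_nil]
  | cons x l ih => simp only [cutsum_cons, ih]; abel

theorem cutsum_zero (l : List X) : cutsum l (fun _ _ _ => (0 : N)) = 0 := by
  induction l with
  | nil => rfl
  | cons x l ih => rw [cutsum_cons, ih, add_zero]

/-- Two sums over the letters of `l` agree if the summands agree for every factorization of `l`. -/
theorem cutsum_congr {l : List X} {f g : List X → X → List X → N}
    (h : ∀ u x v, l = u ++ x :: v → f u x v = g u x v) : cutsum l f = cutsum l g := by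
  induction l generalizing f g with
  | nil => rfl
  | cons x l ih =>
    rw [cutsum_cons, cutsum_cons, h [] x l rfl, ih]
    intro u y v huv
    exact h _ _ _ (by rw [huv, List.cons_append])

theorem map_cutsum {N' F : Type*} [AddCommMonoid N'] [FunLike F N N'] [AddMonoidHomClass F N N']
    (φ : F) (l : List X) (f : List X → X → List X → N) :
    φ (cutsum l f) = cutsum l fun u x v => φ (f u x v) := by
  induction l generalizing f with
  | nil => exact map_zero φ
  | cons x l ih => rw [cutsum_cons, map_add, ih, cutsum_cons]

theorem smul_cutsum {N : Type*} [AddCommGroup N] [Module ℚ N] (c : ℚ) (l : List X)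
    (f : List X → X → List X → N) : c • cutsum l f = cutsum l fun u x v => c • f u x v :=
  map_cutsum (DistribSMul.toAddMonoidHom N c) l f

theorem mul_cutsum {R : Type*} [Ring R] (a : R) (l : List X) (f : List X → X → List X → R) :
    a * cutsum l f = cutsum l fun u x v => a * f u x v :=
  map_cutsum (AddMonoidHom.mulLeft a) l f

theorem cutsum_mul {R : Type*} [Ring R] (a : R) (l : List X) (f : List X → X → List X → R) :
    cutsum l f * a = cutsum l fun u x v => f u x v * a :=
  map_cutsum (AddMonoidHom.mulRight a) l f

theorem cutsum_comm (l m : List X) (f : List X → X → List X → List X → X → List X → N) :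
    cutsum l (fun u x v => cutsum m (f u x v)) =
      cutsum m (fun r y s => cutsum l fun u x v => f u x v r y s) := by
  induction l generalizing f with
  | nil => simp only [cutsum_nil, cutsum_zero]
  | cons x l ih => simp only [cutsum_cons, ih, cutsum_add]

/-- Choosing a letter and then an earlier one is choosing a letter and then a later one. -/
theorem cutsum_coassoc (l : List X) (f : List X → X → List X → X → List X → N) :
    cutsum l (fun w y v => cutsum w fun u x m => f u x m y v) =
      cutsum l (fun u x w => cutsum w fun m y v => f u x m y v) := by
  induction l generalizing f with
  | nil => rfl
  | cons a l ih => simp only [cutsum_cons, cutsum_nil, zero_add, cutsum_add, ih]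

end Cut

/-! ### The Chevalley–Eilenberg algebra of an odd Lie algebra -/

/-- Parities are idempotent. This relation turns the equations between parities, to which all sign
verifications reduce, into consequences of commutative ring axioms in characteristic two. -/
theorem zmod_two_mul_self (p : ZMod 2) : p * p = p := by revert p; decide

theorem sgn_smul_congr {M : Type*} [AddCommGroup M] [Module ℚ M] {p q : ZMod 2} (h : p = q)
    (x : M) : sgn p • x = sgn q • x := by rw [h]

section
variable {g : Type*} [AddCommGroup g] [Module ℚ g] [SuperSpace g]

theorem ι_zero_of_mem {p : ZMod 2} {a : g} (ha : a ∈ hom g p) : proj g (p + 1) a = 0 :=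
  proj_of_mem_other ha ((by decide : ∀ p : ZMod 2, p ≠ p + 1) p)

namespace OddBracket
open CE
variable (L : OddBracket g)

/-- The Leibniz rule in the first argument; the twists carry the Koszul signs of factors whose
parity is not fixed. -/
theorem bracket_mul_left {q : ZMod 2} {y : CE g} (hy : y ∈ hom (CE g) q) (x x' : CE g) :
    L.bracket (x * x') y = par x * L.bracket x' y + L.bracket x y * tw (CE g) q x' := by
  have h0 : proj (CE g) (q + 1) y = 0 := ι_zero_of_mem hy
  have h : cder (parAlg (CE g)) (twAlg (CE g) (q + 1)) _ (L.compat_bracket (q + 1) y) = 0 :=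
    CE.leibniz_ext (cder_mul _ _ _ _) (fun a b => by simp) (fun x => by simp [cder_ι, h0])
  have h1 : ∀ x, L.bracket x y = cder _ _ _ (L.compat_bracket q y) x := by
    intro x
    have h2 : L.bracket x y = (∑ q : ZMod 2, cder _ _ _ (L.compat_bracket q y)) x := rfl
    rw [h2, show (Finset.univ : Finset (ZMod 2)) = {0, 1} from rfl, Finset.sum_pair (by decide)]
    rcases zmod_two_cases q with rfl | rfl
    · exact DFunLike.congr_fun ((congrArg _ h).trans (add_zero _)) x
    · exact DFunLike.congr_fun ((congrArg (· + _) h).trans (zero_add _)) x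
  rw [h1, cder_mul, ← h1, ← h1, parAlg_apply, twAlg_apply]

theorem bracket_one_left (y : CE g) : L.bracket 1 y = 0 := by
  have h : ∀ p, ∀ y ∈ hom (CE g) p, L.bracket 1 y = 0 := by
    intro p y hy
    have := L.bracket_mul_left hy 1 1
    rw [← twAlg_apply, par_one, map_one (twAlg (CE g) p), mul_one, one_mul, mul_one] at this
    simpa using this
  rw [← proj_add_proj y, map_add, h 0 _ (proj_mem 0 y), h 1 _ (proj_mem 1 y), add_zero]

theorem ad_one (a : g) : L.ad a 1 = 0 := by
  have h : ∀ p, ∀ a ∈ hom g p, L.ad a 1 = 0 := by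
    intro p y hy
    have := L.ad_mul hy 1 1
    rw [← twAlg_apply, map_one (twAlg (CE g) (p + 1)), mul_one, one_mul, mul_one] at this
    simpa using this
  rw [← proj_add_proj a, map_add, LinearMap.add_apply, h 0 _ (proj_mem 0 a),
    h 1 _ (proj_mem 1 a), add_zero]

theorem bracket_ι_mul_left {p q r : ZMod 2} {a : g} {x y : CE g} (ha : a ∈ hom g p)
    (hx : x ∈ hom (CE g) q) (hy : y ∈ hom (CE g) r) :
    L.bracket (ι g a * x) y = sgn p • (ι g a * L.bracket x y) + sgn (q * r) • (L.ad a y * x) := by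
  rw [L.bracket_mul_left hy, par_of_mem (ι_mem ha), tw_of_mem hx, bracket_ι, smul_mul_assoc,
    mul_smul_comm, mul_comm r]

theorem bracket_mem {p q : ZMod 2} {x y : CE g} (hx : x ∈ hom (CE g) p) (hy : y ∈ hom (CE g) q) :
    L.bracket x y ∈ hom (CE g) (p + q + 1) := by
  refine CE.hom_induction (C := fun x => L.bracket x y ∈ hom (CE g) (p + q + 1)) ?_ ?_ ?_ ?_ hx
  · simp
  · clear hx
    rintro l rfl
    induction l with
    | nil => rw [sprod_nil, bracket_one_left]; exact zero_mem _
    | cons a l ih =>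
      rw [sprod_cons, L.bracket_ι_mul_left a.mem (sprod_mem l) hy, wpar_cons]
      refine add_mem (Submodule.smul_mem _ _ ?_) (Submodule.smul_mem _ _ ?_)
      · convert mul_mem_hom (ι_mem a.mem) ih using 2; ring
      · convert mul_mem_hom (L.ad_mem a.mem hy) (sprod_mem l) using 2; ring
  · intro a b ha hb; rw [map_add]; exact add_mem ha hb
  · intro c a ha; rw [map_smul]; exact Submodule.smul_mem _ _ ha

theorem ad_mul_of_mem {p q : ZMod 2} {a : g} {x : CE g} (ha : a ∈ hom g p) (hx : x ∈ hom (CE g) q)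
    (y : CE g) :
    L.ad a (x * y) = L.ad a x * y + sgn ((p + 1) * q) • (x * L.ad a y) := by
  rw [L.ad_mul ha, tw_of_mem hx, smul_mul_assoc]

theorem ad_ι_mul {p q : ZMod 2} {a b : g} (ha : a ∈ hom g p) (hb : b ∈ hom g q) (x : CE g) :
    L.ad a (ι g b * x) = ι g (L.br a b) * x + sgn ((p + 1) * q) • (ι g b * L.ad a x) := by
  rw [L.ad_mul_of_mem ha (ι_mem hb), ad_ι]

theorem bracket_mul_right {p q : ZMod 2} {x y : CE g} (hx : x ∈ hom (CE g) p)
    (hy : y ∈ hom (CE g) q) (z : CE g) :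
    L.bracket x (y * z) = L.bracket x y * z + sgn ((p + 1) * q) • (y * L.bracket x z) := by
  suffices h : ∀ r, ∀ z ∈ hom (CE g) r, L.bracket x (y * z) = L.bracket x y * z +
      sgn ((p + 1) * q) • (y * L.bracket x z) by
    rw [← proj_add_proj z, mul_add, map_add, h 0 _ (proj_mem 0 z), h 1 _ (proj_mem 1 z), map_add]
    simp only [mul_add, smul_add]; abel
  intro r z hz
  refine CE.hom_induction (C := fun x => L.bracket x (y * z) = L.bracket x y * z +
      sgn ((p + 1) * q) • (y * L.bracket x z)) (by simp) ?_ ?_ ?_ hx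
  · clear hx
    rintro l rfl
    induction l with
    | nil => simp [sprod_nil, bracket_one_left]
    | cons a l ih =>
      have hl := sprod_mem l
      rw [sprod_cons, L.bracket_ι_mul_left a.mem hl (mul_mem_hom hy hz),
        L.bracket_ι_mul_left a.mem hl hy, L.bracket_ι_mul_left a.mem hl hz, ih,
        L.ad_mul_of_mem a.mem hy, wpar_cons]
      simp only [add_mul, mul_add, smul_add, smul_mul_assoc, mul_smul_comm, sgn_smul_smul,
        ← mul_assoc]
      rw [mul_assoc (L.ad a.val y) z, mul_comm_of_mem hz hl, mul_comm_of_mem hy (ι_mem a.mem)]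
      simp only [smul_mul_assoc, mul_smul_comm, sgn_smul_smul, ← mul_assoc]
      have := zmod_two_mul_self q
      match_scalars <;> simp only [mul_one] <;> congr 1 <;> grind
  · intro a b ha hb; simp only [map_add, LinearMap.add_apply, ha, hb, add_mul, mul_add, smul_add]
    abel
  · intro c a ha
    simp only [map_smul, LinearMap.smul_apply, ha, smul_add, smul_mul_assoc, mul_smul_comm]
    rw [smul_comm c]

theorem bracket_one_right (x : CE g) : L.bracket x 1 = 0 := by
  have h : ∀ p, ∀ x ∈ hom (CE g) p, L.bracket x 1 = 0 := by
    intro p x hx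
    have := L.bracket_mul_right hx one_mem_hom 1
    rw [mul_one, mul_one, mul_zero, sgn_zero, one_smul, one_mul] at this
    simpa using this
  rw [← proj_add_proj x, map_add, LinearMap.add_apply, h 0 _ (proj_mem 0 x),
    h 1 _ (proj_mem 1 x), add_zero]

theorem bracket_comm_ι {p q : ZMod 2} {x : CE g} {b : g} (hx : x ∈ hom (CE g) p)
    (hb : b ∈ hom g q) : L.bracket x (ι g b) = sgn (p * q) • L.ad b x := by
  refine CE.hom_induction (C := fun x => L.bracket x (ι g b) = sgn (p * q) • L.ad b x)
    (by simp) ?_ ?_ ?_ hx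
  · clear hx
    rintro l rfl
    induction l with
    | nil => simp [sprod_nil, bracket_one_left, ad_one]
    | cons a l ih =>
      have hl := sprod_mem l
      rw [sprod_cons, L.bracket_ι_mul_left a.mem hl (ι_mem hb), ih, L.ad_ι, L.ad_ι_mul hb a.mem,
        L.symm a.mem hb, wpar_cons]
      simp only [map_smul, smul_add, smul_mul_assoc, mul_smul_comm, sgn_smul_smul]
      have e : ∀ p q l : ZMod 2, (p + l) * q + (q + 1) * p = p + l * q ∧
        l * q + p * q = (p + l) * q := by decide
      rw [(e _ _ _).1, (e _ _ _).2, add_comm]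
  · intro a b ha hb; rw [map_add, LinearMap.add_apply, ha, hb, map_add, smul_add]
  · intro c a ha; rw [map_smul, LinearMap.smul_apply, ha, map_smul, smul_comm]

/-- The symmetry of the bracket spreads from generators to `S(g)` by the two Leibniz rules. -/
theorem bracket_comm {p q : ZMod 2} {x y : CE g} (hx : x ∈ hom (CE g) p)
    (hy : y ∈ hom (CE g) q) : L.bracket x y = sgn (p * q) • L.bracket y x := by
  refine CE.hom_induction (C := fun y => L.bracket x y = sgn (p * q) • L.bracket y x)
    (by simp) ?_ ?_ ?_ hy
  · clear hy
    rintro l rfl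
    induction l with
    | nil => simp [sprod_nil, bracket_one_left, bracket_one_right]
    | cons b l ih =>
      have hl := sprod_mem l
      rw [sprod_cons, L.bracket_mul_right hx (ι_mem b.mem), L.bracket_ι_mul_left b.mem hl hx, ih,
        L.bracket_comm_ι hx b.mem, wpar_cons]
      simp only [smul_add, smul_mul_assoc, mul_smul_comm, sgn_smul_smul]
      have e : ∀ p q l : ZMod 2, p * (q + l) + q = (p + 1) * q + p * l ∧
        p * (q + l) + l * p = p * q := by decide
      rw [(e _ _ _).1, (e _ _ _).2, add_comm]
  · intro a b ha hb; simp only [map_add, LinearMap.add_apply, ha, hb, smul_add]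
  · intro c a ha; simp only [map_smul, LinearMap.smul_apply, ha]; rw [smul_comm]

theorem delta_ι_mul_of_mem {p : ZMod 2} {a : g} (ha : a ∈ hom g p) (x : CE g) :
    L.delta (ι g a * x) = L.ad a x + sgn p • (ι g a * L.delta x) := by
  rw [delta_ι_mul, par_of_mem (ι_mem ha), smul_mul_assoc]

theorem delta_ι (a : g) : L.delta (ι g a) = 0 := by
  have := L.delta_ι_mul a 1
  rwa [delta_one, mul_zero, mul_one, ad_one, add_zero] at this

theorem delta_mem {p : ZMod 2} {x : CE g} (hx : x ∈ hom (CE g) p) :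
    L.delta x ∈ hom (CE g) (p + 1) := by
  refine CE.hom_induction (C := fun x => L.delta x ∈ hom (CE g) (p + 1)) (by simp) ?_ ?_ ?_ hx
  · clear hx
    rintro l rfl
    induction l with
    | nil => rw [sprod_nil, delta_one]; exact zero_mem _
    | cons a l ih =>
      rw [sprod_cons, L.delta_ι_mul_of_mem a.mem, wpar_cons]
      refine add_mem (L.ad_mem a.mem (sprod_mem l)) (Submodule.smul_mem _ _ ?_)
      rw [add_assoc]
      exact mul_mem_hom (ι_mem a.mem) ih
  · intro a b ha hb; rw [map_add]; exact add_mem ha hb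
  · intro c a ha; rw [map_smul]; exact Submodule.smul_mem _ _ ha

/-- The differential `δ` is an operator of order two whose deviation from the Leibniz rule is the
bracket. -/
theorem delta_mul {p : ZMod 2} {x : CE g} (hx : x ∈ hom (CE g) p) (y : CE g) :
    L.delta (x * y) = L.delta x * y + sgn p • (x * L.delta y) + L.bracket x y := by
  suffices h : ∀ r, ∀ y ∈ hom (CE g) r, L.delta (x * y) =
      L.delta x * y + sgn p • (x * L.delta y) + L.bracket x y by
    rw [← proj_add_proj y, mul_add, map_add, h 0 _ (proj_mem 0 y), h 1 _ (proj_mem 1 y), map_add,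
      map_add]
    simp only [mul_add, smul_add]; abel
  intro r y hy
  refine CE.hom_induction (C := fun x => L.delta (x * y) =
      L.delta x * y + sgn p • (x * L.delta y) + L.bracket x y) (by simp) ?_ ?_ ?_ hx
  · clear hx
    rintro l rfl
    induction l with
    | nil => simp [sprod_nil, bracket_one_left, wpar_nil, sgn_zero, delta_one]
    | cons a l ih =>
      have hl := sprod_mem l
      rw [sprod_cons, mul_assoc, L.delta_ι_mul_of_mem a.mem, ih, L.ad_mul_of_mem a.mem hl,
        L.delta_ι_mul_of_mem a.mem, L.bracket_ι_mul_left a.mem hl hy, wpar_cons,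
        mul_comm_of_mem hl (L.ad_mem a.mem hy)]
      simp only [add_mul, mul_add, smul_add, smul_mul_assoc, mul_smul_comm, sgn_smul_smul,
        mul_assoc]
      have := zmod_two_mul_self (wpar l)
      match_scalars <;> simp only [mul_one] <;> congr 1 <;> grind
  · intro a b ha hb
    simp only [map_add, LinearMap.add_apply, ha, hb, add_mul, smul_add]; abel
  · intro c a ha
    simp only [map_smul, LinearMap.smul_apply, ha, smul_add, smul_mul_assoc]
    rw [smul_comm c]

end OddBracket
end

/-! ### The bracket and the cobracket on the symmetric algebra -/

theorem sgn_add_cancel {p q : ZMod 2} (h : p = q + 1) : sgn p + sgn q = 0 := by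
  rw [h, sgn_succ, neg_add_cancel]

theorem neg_sgn_add {p q : ZMod 2} (h : p = q) : -sgn p + sgn q = 0 := by
  rw [h, neg_add_cancel]

theorem neg_sgn {p q : ZMod 2} (h : p = q + 1) : -sgn p = sgn q := by
  rw [h, sgn_succ, neg_neg]

theorem one_eq_sgn {p : ZMod 2} (h : p = 0) : 1 = sgn p := by
  rw [h, sgn_zero]

theorem one_add_sgn {p : ZMod 2} (h : p = 1) : 1 + sgn p = 0 := by
  rw [h, sgn_one, add_neg_cancel]

section
variable {g : Type*} [AddCommGroup g] [Module ℚ g] [SuperSpace g]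

namespace OddBracket
open CE
variable (L : OddBracket g)

/-- The Jacobi identity of an odd bracket. -/
def Jacobi : Prop := ∀ p q : ZMod 2, ∀ a ∈ hom g p, ∀ b ∈ hom g q, ∀ c, L.br a (L.br b c) =
  sgn (p + 1) • L.br (L.br a b) c + sgn ((p + 1) * (q + 1)) • L.br b (L.br a c)

variable {L}

/-- Both sides are derivations in `x` that agree on generators by the Jacobi identity. -/
theorem Jacobi.ad_ad (hL : L.Jacobi) {p q : ZMod 2} {a b : g} (ha : a ∈ hom g p)
    (hb : b ∈ hom g q) (x : CE g) :
    L.ad a (L.ad b x) =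
      sgn (p + 1) • L.ad (L.br a b) x + sgn ((p + 1) * (q + 1)) • L.ad b (L.ad a x) := by
  rw [← sub_eq_zero]
  refine CE.eq_zero_of_sprod (f := L.ad a ∘ₗ L.ad b - (sgn (p + 1) • L.ad (L.br a b) +
    sgn ((p + 1) * (q + 1)) • L.ad b ∘ₗ L.ad a)) (fun l => ?_) x
  rw [LinearMap.sub_apply, sub_eq_zero]
  simp only [LinearMap.comp_apply, LinearMap.add_apply, LinearMap.smul_apply]
  induction l with
  | nil => simp [sprod_nil, ad_one]
  | cons c l ih =>
    rw [sprod_cons, L.ad_ι_mul hb c.mem, L.ad_ι_mul ha c.mem, L.ad_ι_mul (L.mem ha hb) c.mem]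
    simp only [map_add, map_smul]
    rw [L.ad_ι_mul ha (L.mem hb c.mem), L.ad_ι_mul ha c.mem, L.ad_ι_mul hb (L.mem ha c.mem),
      L.ad_ι_mul hb c.mem, ih, hL p q a ha b hb]
    simp only [map_add, map_smul, add_mul, smul_add, mul_add, smul_mul_assoc, mul_smul_comm,
      sgn_smul_smul]
    have := zmod_two_mul_self p
    have := zmod_two_mul_self q
    have := zmod_two_mul_self c.p
    match_scalars <;> simp only [mul_one] <;> congr 1 <;> grind

/-- The differential anticommutes, in the graded sense, with the adjoint action of `g`. -/
theorem Jacobi.delta_ad (hL : L.Jacobi) {p : ZMod 2} {a : g} (ha : a ∈ hom g p) (x : CE g) :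
    L.delta (L.ad a x) + sgn p • L.ad a (L.delta x) = 0 := by
  refine CE.eq_zero_of_sprod (f := L.delta ∘ₗ L.ad a + sgn p • L.ad a ∘ₗ L.delta) (fun l => ?_) x
  simp only [LinearMap.comp_apply, LinearMap.add_apply, LinearMap.smul_apply]
  induction l with
  | nil => simp [sprod_nil, ad_one, delta_one]
  | cons b l ih =>
    rw [sprod_cons, L.ad_ι_mul ha b.mem, L.delta_ι_mul_of_mem b.mem]
    simp only [map_add, map_smul]
    rw [L.delta_ι_mul_of_mem (L.mem ha b.mem), L.delta_ι_mul_of_mem b.mem, L.ad_ι_mul ha b.mem,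
      hL.ad_ad ha b.mem, eq_neg_of_add_eq_zero_left ih]
    simp only [smul_add, mul_add, mul_neg, smul_neg, mul_smul_comm, sgn_smul_smul]
    have := zmod_two_mul_self p
    have := zmod_two_mul_self b.p
    match_scalars <;> simp only [mul_one]
    all_goals first | exact neg_sgn_add (by grind) | exact sgn_add_cancel (by grind) |
      exact one_add_sgn (by grind)

/-- The Chevalley–Eilenberg differential squares to zero. -/
theorem Jacobi.delta_delta (hL : L.Jacobi) (x : CE g) : L.delta (L.delta x) = 0 := by
  refine CE.eq_zero_of_sprod (f := L.delta ∘ₗ L.delta) (fun l => ?_) x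
  rw [LinearMap.comp_apply]
  induction l with
  | nil => simp [sprod_nil, delta_one]
  | cons b l ih =>
    rw [sprod_cons, L.delta_ι_mul_of_mem b.mem, map_add, map_smul, L.delta_ι_mul_of_mem b.mem, ih,
      mul_zero, smul_zero, add_zero, hL.delta_ad b.mem]

/-- Since `δ` has order two, `δ² = 0` makes `δ` a derivation of the bracket. -/
theorem Jacobi.delta_bracket (hL : L.Jacobi) {p : ZMod 2} {x : CE g} (hx : x ∈ hom (CE g) p)
    (y : CE g) :
    L.delta (L.bracket x y) + L.bracket (L.delta x) y + sgn p • L.bracket x (L.delta y) = 0 := by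
  have h := hL.delta_delta (x * y)
  rw [L.delta_mul hx, map_add, map_add, map_smul, L.delta_mul (L.delta_mem hx), L.delta_mul hx,
    hL.delta_delta, hL.delta_delta, sgn_succ] at h
  rw [← h]
  simp only [zero_mul, mul_zero, smul_zero, smul_add, neg_smul]
  abel

/-- Evaluating the derivation property of `δ` on a product gives the Jacobi identity of the bracket
of `S(g)`. -/
theorem Jacobi.bracket (hL : L.Jacobi) {p q : ZMod 2} {x y : CE g} (hx : x ∈ hom (CE g) p)
    (hy : y ∈ hom (CE g) q) (z : CE g) :
    L.bracket x (L.bracket y z) = sgn (p + 1) • L.bracket (L.bracket x y) z +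
      sgn ((p + 1) * (q + 1)) • L.bracket y (L.bracket x z) := by
  have h := hL.delta_bracket hx (y * z)
  have h1 := hL.delta_bracket hx y
  have h2 := hL.delta_bracket hx z
  rw [L.bracket_mul_right hx hy, L.delta_mul hy, map_add, map_smul, map_add, map_add, map_smul,
    L.delta_mul (L.bracket_mem hx hy), L.delta_mul hy, L.bracket_mul_right (L.delta_mem hx) hy,
    L.bracket_mul_right hx (L.delta_mem hy), L.bracket_mul_right hx hy,
    eq_neg_of_add_eq_zero_left ((add_assoc _ _ _).symm.trans h1),
    eq_neg_of_add_eq_zero_left ((add_assoc _ _ _).symm.trans h2)] at h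
  rw [← sub_eq_zero, ← smul_zero (sgn p), ← h]
  simp only [smul_add, mul_add, add_mul, neg_add, neg_mul, mul_neg, smul_neg, mul_smul_comm,
      smul_mul_assoc, sgn_smul_smul]
  have := zmod_two_mul_self p
  have := zmod_two_mul_self q
  match_scalars <;> simp only [mul_one]
  all_goals first | exact one_eq_sgn (by grind) | exact neg_sgn (by grind) |
    exact (neg_sgn_add (by grind)).symm | exact (sgn_add_cancel (by grind)).symm

end OddBracket

namespace OddCobracket
open CE
variable (C : OddCobracket g)

theorem Delta_one : C.Delta 1 = 0 := by
  have := C.Delta_mul 1 1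
  rw [par_one] at this
  simpa using this

theorem Delta_mul_of_mem {p : ZMod 2} {x : CE g} (hx : x ∈ hom (CE g) p) (y : CE g) :
    C.Delta (x * y) = C.Delta x * y + sgn p • (x * C.Delta y) := by
  rw [C.Delta_mul, par_of_mem hx, smul_mul_assoc]

theorem Delta_ι_mem {p : ZMod 2} {a : g} (ha : a ∈ hom g p) :
    C.Delta (ι g a) ∈ hom (CE g) (p + 1) := by
  rw [Delta_ι]; exact C.mulS_mem ha

theorem Delta_mem {p : ZMod 2} {x : CE g} (hx : x ∈ hom (CE g) p) :
    C.Delta x ∈ hom (CE g) (p + 1) := by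
  refine CE.hom_induction (C := fun x => C.Delta x ∈ hom (CE g) (p + 1)) (by simp) ?_ ?_ ?_ hx
  · clear hx
    rintro l rfl
    induction l with
    | nil => rw [sprod_nil, Delta_one]; exact zero_mem _
    | cons a l ih =>
      rw [sprod_cons, C.Delta_mul_of_mem (ι_mem a.mem), wpar_cons]
      refine add_mem ?_ (Submodule.smul_mem _ _ ?_)
      · convert mul_mem_hom (C.Delta_ι_mem a.mem) (sprod_mem l) using 2; ring
      · rw [add_assoc]
        exact mul_mem_hom (ι_mem a.mem) ih
  · intro a b ha hb; rw [map_add]; exact add_mem ha hb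
  · intro c a ha; rw [map_smul]; exact Submodule.smul_mem _ _ ha

/-- The square of the odd derivation `Δ` is an even derivation. -/
theorem Delta_Delta (h : ∀ p, ∀ a ∈ hom g p, C.Delta (C.Delta (ι g a)) = 0) (x : CE g) :
    C.Delta (C.Delta x) = 0 := by
  refine CE.eq_zero_of_sprod (f := C.Delta ∘ₗ C.Delta) (fun l => ?_) x
  rw [LinearMap.comp_apply]
  induction l with
  | nil => simp [sprod_nil, Delta_one]
  | cons b l ih =>
    have hb := ι_mem b.mem
    rw [sprod_cons, C.Delta_mul_of_mem hb, map_add, map_smul, C.Delta_mul_of_mem hb, ih,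
      C.Delta_mul_of_mem (C.Delta_mem hb), h _ _ b.mem, sgn_succ]
    simp

/-- The compatibility of a bracket and a cobracket on generators: `Δ` is a derivation of the
bracket. -/
def Compatible (L : OddBracket g) : Prop := ∀ p q : ZMod 2, ∀ a ∈ hom g p, ∀ b ∈ hom g q,
  C.Delta (ι g (L.br a b)) + L.bracket (C.Delta (ι g a)) (ι g b) +
    sgn p • L.ad a (C.Delta (ι g b)) = 0

variable {C} {L : OddBracket g}

/-- The derivation property of `Δ`, extended to `S(g)` in the first argument of the bracket. -/
theorem Compatible.Delta_bracket_ι (hC : C.Compatible L) {p q : ZMod 2} {x : CE g} {b : g}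
    (hx : x ∈ hom (CE g) p) (hb : b ∈ hom g q) :
    C.Delta (L.bracket x (ι g b)) + L.bracket (C.Delta x) (ι g b) +
      sgn p • L.bracket x (C.Delta (ι g b)) = 0 := by
  refine CE.hom_induction (C := fun x => C.Delta (L.bracket x (ι g b)) +
      L.bracket (C.Delta x) (ι g b) + sgn p • L.bracket x (C.Delta (ι g b)) = 0) (by simp)
      ?_ ?_ ?_ hx
  · clear hx
    rintro l rfl
    induction l with
    | nil => simp [sprod_nil, Delta_one, L.bracket_one_left]
    | cons a l ih =>
      have hl := sprod_mem l
      have hb' := ι_mem hb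
      have ha := ι_mem a.mem
      rw [sprod_cons, L.bracket_ι_mul_left a.mem hl hb', C.Delta_mul_of_mem ha,
        L.bracket_ι_mul_left a.mem hl (C.Delta_mem hb'), L.ad_ι]
      simp only [map_add, map_smul, LinearMap.add_apply, LinearMap.smul_apply]
      rw [C.Delta_mul_of_mem ha, C.Delta_mul_of_mem (ι_mem (L.mem a.mem hb)),
        L.bracket_ι_mul_left a.mem (C.Delta_mem hl) hb', L.bracket_mul_left hb',
        eq_neg_of_add_eq_zero_left ((add_assoc _ _ _).symm.trans ih),
        eq_neg_of_add_eq_zero_left ((add_assoc _ _ _).symm.trans (hC _ _ _ a.mem _ hb)),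
        par_of_mem (C.Delta_mem ha), tw_of_mem hl, L.ad_ι, wpar_cons]
      simp only [smul_add, mul_add, add_mul, neg_add, neg_mul, mul_neg, smul_neg, mul_smul_comm,
        smul_mul_assoc, sgn_smul_smul]
      have := zmod_two_mul_self q
      match_scalars <;> simp only [mul_one]
      all_goals first | exact neg_sgn_add (by grind) | exact sgn_add_cancel (by grind)
  · intro a b ha hb
    rw [← add_zero (0 : CE g)]
    nth_rewrite 1 [← ha]
    rw [← hb]
    simp only [map_add, LinearMap.add_apply, smul_add]
    abel
  · intro c a ha
    rw [← smul_zero c, ← ha]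
    simp only [map_smul, LinearMap.smul_apply, smul_add]
    rw [smul_comm c]

/-- A compatible cobracket extends to a derivation of the bracket of `S(g)`. -/
theorem Compatible.Delta_bracket (hC : C.Compatible L) {p : ZMod 2} {x : CE g}
    (hx : x ∈ hom (CE g) p) (y : CE g) :
    C.Delta (L.bracket x y) + L.bracket (C.Delta x) y + sgn p • L.bracket x (C.Delta y) = 0 := by
  refine CE.eq_zero_of_sprod (f := C.Delta ∘ₗ L.bracket x + L.bracket (C.Delta x) +
    sgn p • L.bracket x ∘ₗ C.Delta) (fun l => ?_) y
  simp only [LinearMap.comp_apply, LinearMap.add_apply, LinearMap.smul_apply]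
  induction l with
  | nil => simp [sprod_nil, L.bracket_one_right, Delta_one]
  | cons b l ih =>
    have hb := ι_mem b.mem
    rw [sprod_cons, L.bracket_mul_right hx hb, L.bracket_mul_right (C.Delta_mem hx) hb,
      C.Delta_mul_of_mem hb]
    simp only [map_add, map_smul]
    rw [C.Delta_mul_of_mem hb, C.Delta_mul_of_mem (L.bracket_mem hx hb), L.bracket_mul_right hx hb,
      L.bracket_mul_right hx (C.Delta_mem hb),
      eq_neg_of_add_eq_zero_left ((add_assoc _ _ _).symm.trans ih),
      eq_neg_of_add_eq_zero_left ((add_assoc _ _ _).symm.trans (hC.Delta_bracket_ι hx b.mem))]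
    simp only [smul_add, mul_add, add_mul, neg_add, neg_mul, mul_neg, smul_neg, mul_smul_comm,
      smul_mul_assoc, sgn_smul_smul]
    match_scalars
    all_goals try simp only [mul_one]
    all_goals first | exact neg_add_cancel _ | exact neg_sgn_add (by grind) |
      exact sgn_add_cancel (by grind)

/-- The anticommutator of `δ` and `Δ` vanishes as soon as it vanishes on generators, where it is
the composite of the cobracket and the bracket. -/
theorem Compatible.delta_Delta (hC : C.Compatible L)
    (h : ∀ p, ∀ a ∈ hom g p, L.delta (C.Delta (ι g a)) = 0) (x : CE g) :
    L.delta (C.Delta x) + C.Delta (L.delta x) = 0 := by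
  refine CE.eq_zero_of_sprod (f := L.delta ∘ₗ C.Delta + C.Delta ∘ₗ L.delta) (fun l => ?_) x
  rw [LinearMap.add_apply, LinearMap.comp_apply, LinearMap.comp_apply]
  induction l with
  | nil => simp [sprod_nil, Delta_one, L.delta_one]
  | cons b l ih =>
    have hb := ι_mem b.mem
    have h1 := hC.Delta_bracket hb (sprod l)
    rw [L.bracket_ι, L.bracket_ι] at h1
    rw [sprod_cons, C.Delta_mul_of_mem hb, L.delta_ι_mul_of_mem b.mem]
    simp only [map_add, map_smul]
    rw [L.delta_mul (C.Delta_mem hb), h _ _ b.mem, L.delta_ι_mul_of_mem b.mem,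
      C.Delta_mul_of_mem hb, eq_neg_of_add_eq_zero_left ih,
      eq_neg_of_add_eq_zero_left ((add_assoc _ _ _).symm.trans h1)]
    simp only [smul_add, zero_mul, mul_neg, smul_neg, sgn_smul_smul, neg_add]
    match_scalars
    all_goals try simp only [mul_one]
    all_goals first | exact neg_add_cancel _ | exact neg_sgn_add (by grind) |
      exact sgn_add_cancel (by grind) | exact one_add_sgn (by grind) | exact add_neg_cancel _

end OddCobracket
end

/-! ### Hamiltonian vector fields of cyclic words -/

section
variable {W : Type*} [AddCommGroup W] [Module ℚ W] [SuperSpace W]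

theorem algebraMapInv_ι (x : W) :
    TensorAlgebra.algebraMapInv (TensorAlgebra.ι ℚ x : TensorAlgebra ℚ W) = 0 := by
  simp [TensorAlgebra.algebraMapInv]

theorem algebraMapInv_par (a : TensorAlgebra ℚ W) :
    TensorAlgebra.algebraMapInv (par a) = TensorAlgebra.algebraMapInv a := by
  have : (TensorAlgebra.algebraMapInv (R := ℚ)).comp (parT W) = TensorAlgebra.algebraMapInv := by
    ext x
    simp [parT_ι, algebraMapInv_ι]
  exact DFunLike.congr_fun this a

theorem algebraMapInv_odd {a : TensorAlgebra ℚ W} (ha : a ∈ hom (TensorAlgebra ℚ W) 1) :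
    TensorAlgebra.algebraMapInv a = 0 := by
  have := algebraMapInv_par a
  rw [par_of_mem ha, sgn_one, map_smul] at this
  simp only [smul_eq_mul, neg_mul, one_mul] at this
  linarith

/-- The constant term is well defined on `T(W) / [T(W), T(W)]`: since it vanishes on odd elements,
it is a supertrace. -/
theorem algebraMapInv_comm {a : TensorAlgebra ℚ W} (ha : a ∈ comm (TensorAlgebra ℚ W)) :
    TensorAlgebra.algebraMapInv a = 0 := by
  suffices h : comm (TensorAlgebra ℚ W) ≤
      LinearMap.ker (TensorAlgebra.algebraMapInv (R := ℚ) (M := W)).toLinearMap from h ha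
  refine Submodule.span_le.2 ?_
  rintro _ ⟨p, q, a, ha, b, hb, rfl⟩
  change TensorAlgebra.algebraMapInv _ = _
  simp only [map_sub, map_mul, map_smul, smul_eq_mul]
  rcases zmod_two_cases p with rfl | rfl
  · rw [zero_mul, sgn_zero]; ring
  · rw [algebraMapInv_odd ha]; ring

theorem Cyc.mk_one_ne_zero : Cyc.mk (TensorAlgebra ℚ W) 1 ≠ 0 := by
  intro h
  have := algebraMapInv_comm ((Submodule.Quotient.mk_eq_zero _).1 h)
  simp at this

/-- The linear terms survive in `T(W) / [T(W), T(W)]`. -/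
theorem Cyc.mk_ι_injective :
    Function.Injective fun x : W => Cyc.mk (TensorAlgebra ℚ W) (TensorAlgebra.ι ℚ x) := by
  suffices h : ∀ x : W, Cyc.mk (TensorAlgebra ℚ W) (TensorAlgebra.ι ℚ x) = 0 → x = 0 by
    intro x y hxy
    rw [← sub_eq_zero]
    apply h
    rw [map_sub, map_sub, sub_eq_zero]
    exact hxy
  intro x hx
  rw [← Module.forall_dual_apply_eq_zero_iff ℚ]
  intro φ
  let D := tder (TensorAlgebra.algebraMapInv (R := ℚ) (M := W)) TensorAlgebra.algebraMapInv φ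
  suffices hD : comm (TensorAlgebra ℚ W) ≤ LinearMap.ker D by
    have h1 : D (TensorAlgebra.ι ℚ x) = 0 := hD ((Submodule.Quotient.mk_eq_zero _).1 hx)
    rwa [tder_ι] at h1
  refine Submodule.span_le.2 ?_
  rintro _ ⟨p, q, a, ha, b, hb, rfl⟩
  change D _ = 0
  simp only [D, map_sub, map_smul, tder_mul, smul_eq_mul]
  rcases zmod_two_cases p with rfl | rfl
  · rw [zero_mul, sgn_zero]; ring
  · rcases zmod_two_cases q with rfl | rfl
    · rw [mul_zero, sgn_zero]; ring
    · rw [algebraMapInv_odd ha, algebraMapInv_odd hb]; ring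

/-- The Leibniz rule for a word. -/
theorem derOf_word {r : ZMod 2} {D : TensorAlgebra ℚ W →ₗ[ℚ] TensorAlgebra ℚ W}
    (hD : D ∈ derOf (TensorAlgebra ℚ W) r) (l : List (HomEl W)) :
    D (word l) = cutsum l fun u y v =>
      sgn (r * wpar u) • (word u * D (TensorAlgebra.ι ℚ y.val) * word v) := by
  induction l with
  | nil =>
    have := hD.2 1 1
    rw [tw_of_mem one_mem_hom, mul_zero, sgn_zero, one_smul] at this
    simpa [word_nil, cutsum_nil] using this
  | cons x l ih =>
    rw [word_cons, hD.2, ih, cutsum_cons, tw_of_mem (ι_mem_hom x.mem), mul_cutsum]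
    congr 1
    · simp [wpar_nil, word_nil, sgn_zero]
    · refine cutsum_congr fun u y v _ => ?_
      rw [smul_mul_assoc, mul_smul_comm, sgn_smul_smul, wpar_cons, mul_add,
        word_cons]
      simp only [mul_assoc]

end

section
variable {V : Type*} [AddCommGroup V] [Module ℚ V] [SuperSpace V]

theorem dx_mem {p : ZMod 2} {x : Module.Dual ℚ V} (hx : x ∈ hom (Module.Dual ℚ V) p) :
    dx V x ∈ hom (Forms V) (p + 1) := by
  refine ι_mem_hom ?_
  rw [mem_hom, par_genDX, par_of_mem hx, map_smul, sgn_succ, neg_smul]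

theorem incl_mem {p : ZMod 2} {a : Fun V} (ha : a ∈ hom (Fun V) p) :
    incl V a ∈ hom (Forms V) p := by
  rw [mem_hom, par_incl, par_of_mem ha, map_smul]

theorem contr_dx (ξ : Der (Fun V)) (x : Module.Dual ℚ V) :
    (contr V ξ).1 (dx V x) = incl V (ξ.1 (TensorAlgebra.ι ℚ x)) := by
  simp [contr, superDer_ι, dx, show sndGen V (genDX V x) = x from rfl]

theorem contr_dx_mul_dx {p : ZMod 2} {ξ : Der (Fun V)} (hξ : ξ.1 ∈ derOf (Fun V) p)
    {q : ZMod 2} {y : Module.Dual ℚ V} (hy : y ∈ hom (Module.Dual ℚ V) q)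
    (z : Module.Dual ℚ V) :
    (contr V ξ).1 (dx V y * dx V z) = incl V (ξ.1 (TensorAlgebra.ι ℚ y)) * dx V z +
      sgn ((p + 1) * (q + 1)) • (dx V y * incl V (ξ.1 (TensorAlgebra.ι ℚ z))) := by
  rw [(contr_mem hξ).2, contr_dx, contr_dx, tw_of_mem (dx_mem hy), smul_mul_assoc]

variable (V) in
/-- Representatives of the odd constant 2-forms, spanned by the `dy dz` with `y` and `z` homogeneous
of opposite parities. -/
def oddConst : Submodule ℚ (Forms V) := Submodule.span ℚ
  {t | ∃ q : ZMod 2, ∃ y ∈ hom (Module.Dual ℚ V) q, ∃ z ∈ hom (Module.Dual ℚ V) (q + 1),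
    t = dx V y * dx V z}

theorem proj_mk {R : Type*} [Ring R] [Algebra ℚ R] [SuperAlgebra R] (p : ZMod 2) (a : R) :
    proj (Cyc R) p (Cyc.mk R a) = Cyc.mk R (proj R p a) := by
  simp only [proj_apply, map_smul, map_add, Cyc.par_mk]

/-- An odd constant form has a representative whose terms `dy dz` are themselves odd. -/
theorem OddSymplecticForm.exists_rep (ω : OddSymplecticForm V) :
    ∃ w ∈ oddConst V, Cyc.mk _ w = ω.form := by
  suffices h : ∀ θ ∈ constTwoForms V, ∃ w ∈ oddConst V, Cyc.mk _ w = proj _ 1 θ by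
    obtain ⟨w, hw, h⟩ := h _ ω.const
    exact ⟨w, hw, by rw [h, proj_of_mem ω.odd]⟩
  intro θ hθ
  induction hθ using Submodule.span_induction with
  | mem θ h =>
    obtain ⟨x, y, rfl⟩ := h
    have e : ∀ q, dx V (proj _ q x) * dx V (proj _ (q + 1) y) ∈ oddConst V := fun q =>
      Submodule.subset_span ⟨q, _, proj_mem _ _, _, proj_mem _ _, rfl⟩
    refine ⟨_, add_mem (e 0) (e 1), ?_⟩
    rw [proj_mk]
    congr 1
    conv_rhs => rw [← proj_add_proj x, ← proj_add_proj y]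
    have h : ∀ q r, dx V (proj _ q x) * dx V (proj _ r y) ∈ hom (Forms V) (q + 1 + (r + 1)) :=
      fun q r => mul_mem_hom (dx_mem (proj_mem _ _)) (dx_mem (proj_mem _ _))
    simp only [map_add, mul_add, add_mul]
    rw [proj_of_mem_other (h 0 0) (by decide), proj_of_mem_other (h 1 1) (by decide),
      proj_of_mem (show _ ∈ hom (Forms V) 1 from h 0 1),
      proj_of_mem (show _ ∈ hom (Forms V) 1 from h 1 0)]
    simp only [zero_add, add_zero]
    rw [add_comm]; rfl
  | zero => exact ⟨0, zero_mem _, by simp⟩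
  | add a b _ _ ha hb =>
    obtain ⟨u, hu, h1⟩ := ha
    obtain ⟨v, hv, h2⟩ := hb
    exact ⟨u + v, add_mem hu hv, by rw [map_add, h1, h2, map_add]⟩
  | smul c a _ ha =>
    obtain ⟨u, hu, h1⟩ := ha
    exact ⟨c • u, Submodule.smul_mem _ _ hu, by rw [map_smul, h1, map_smul]⟩

variable (V) in
/-- The endomorphism `x ↦ 0`, `dx ↦ dx` of the algebra of forms. -/
def constPart : Forms V →ₐ[ℚ] Forms V :=
  TensorAlgebra.lift ℚ (TensorAlgebra.ι ℚ ∘ₗ genDX V ∘ₗ sndGen V)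

theorem constPart_dx (x : Module.Dual ℚ V) : constPart V (dx V x) = dx V x := by
  simp [constPart, dx, show sndGen V (genDX V x) = x from rfl]

/-- On 0-forms `constPart` takes the constant term. -/
theorem constPart_incl (a : Fun V) :
    constPart V (incl V a) = algebraMap ℚ _ (TensorAlgebra.algebraMapInv a) := by
  have : (constPart V).comp (incl V) =
      (Algebra.ofId ℚ (Forms V)).comp TensorAlgebra.algebraMapInv := by
    ext x
    simp [constPart, incl_ι, sndGen_genX, algebraMapInv_ι]
  exact DFunLike.congr_fun this a

theorem par_constPart (a : Forms V) : par (constPart V a) = constPart V (par a) := by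
  have : (parT (FormGen V)).comp (constPart V) = (constPart V).comp (parT _) := by
    ext x
    simp [constPart, parT_ι, par_genDX, sndGen_par]
  exact DFunLike.congr_fun this a

theorem dHam_mk (a : Fun V) : dHam V (Cyc.mk _ a) = Cyc.mk _ ((deRham V).1 (incl V a)) := rfl

theorem deRham_incl_ι (x : Module.Dual ℚ V) :
    (deRham V).1 (incl V (TensorAlgebra.ι ℚ x)) = dx V x := by
  simp [incl_ι, deRham, superDer_ι, fstGen_genX]

theorem deRham_word (l : List (HomEl (Module.Dual ℚ V))) :
    (deRham V).1 (incl V (word l)) = cutsum l fun u x v =>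
      sgn (wpar u) • (incl V (word u) * dx V x.val * incl V (word v)) := by
  induction l with
  | nil =>
    have := (deRham_mem V).2 1 1
    rw [tw_of_mem one_mem_hom, mul_zero, sgn_zero, one_smul] at this
    simpa [word_nil, cutsum_nil] using this
  | cons x l ih =>
    rw [word_cons, map_mul, (deRham_mem V).2, ih, cutsum_cons,
      tw_of_mem (incl_mem (ι_mem_hom x.mem)), mul_cutsum, deRham_incl_ι]
    congr 1
    · simp [wpar_nil, word_nil, sgn_zero]
    · refine cutsum_congr fun u y v _ => ?_
      rw [smul_mul_assoc, mul_smul_comm, sgn_smul_smul, wpar_cons, one_mul,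
        word_cons, map_mul]
      simp only [mul_assoc]

/-- The differential of a cyclic word, the letter under the differential being moved to the
front. -/
theorem dHam_cword (l : List (HomEl (Module.Dual ℚ V))) :
    dHam V (cword l) = cutsum l fun u x v =>
      sgn (wpar u * (x.p + wpar v)) • Cyc.mk _ (dx V x.val * incl V (word (v ++ u))) := by
  rw [cword, dHam_mk, deRham_word, map_cutsum]
  refine cutsum_congr fun u x v _ => ?_
  rw [map_smul, mul_assoc, Cyc.mk_mul_comm (incl_mem (word_mem u))
    (mul_mem_hom (dx_mem x.mem) (incl_mem (word_mem v))), sgn_smul_smul, mul_assoc, ← map_mul,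
    ← word_append]
  refine sgn_smul_congr ?_ _
  grind

namespace OddSymplecticForm
variable (ω : OddSymplecticForm V)

/-- The symmetric pairing `{x, y} ∈ ℚ` of linear 0-forms: the constant term of `α(y)` for the
Hamiltonian vector field `α` of `x`. -/
def pairing : Module.Dual ℚ V →ₗ[ℚ] Module.Dual ℚ V →ₗ[ℚ] ℚ :=
  LinearMap.compr₂ (((LinearMap.lcomp ℚ _ (TensorAlgebra.ι ℚ)) ∘ₗ (Der (Fun V)).subtype ∘ₗ
    ω.hamVec ∘ₗ Cyc.mk _ ∘ₗ TensorAlgebra.ι ℚ))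
    (TensorAlgebra.algebraMapInv (R := ℚ) (M := Module.Dual ℚ V)).toLinearMap

theorem pairing_apply (x y : Module.Dual ℚ V) : ω.pairing x y = TensorAlgebra.algebraMapInv
    ((ω.hamVec (Cyc.mk _ (TensorAlgebra.ι ℚ x))).1 (TensorAlgebra.ι ℚ y)) := rfl

theorem mk_ι_mem {p : ZMod 2} {x : Module.Dual ℚ V} (hx : x ∈ hom (Module.Dual ℚ V) p) :
    Cyc.mk _ (TensorAlgebra.ι ℚ x) ∈ hom (Ham V) p := by
  rw [mem_hom, Cyc.par_mk, par_of_mem (ι_mem_hom hx), map_smul]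

theorem pairing_par {p : ZMod 2} {x : Module.Dual ℚ V} (hx : x ∈ hom (Module.Dual ℚ V) p)
    (y : Module.Dual ℚ V) : ω.pairing x (par y) = sgn (p + 1) • ω.pairing x y := by
  have h := (ω.hamVec_mem (mk_ι_mem hx)).1 (TensorAlgebra.ι ℚ y)
  have h2 := congrArg TensorAlgebra.algebraMapInv h
  rw [algebraMapInv_par, map_smul, par_ι, ← pairing_apply, ← pairing_apply] at h2
  rw [h2, sgn_smul_self]

/-- Since `ω` is odd, only letters of opposite parities pair. -/
theorem pairing_eq_zero {p q : ZMod 2} {x y : Module.Dual ℚ V}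
    (hx : x ∈ hom (Module.Dual ℚ V) p) (hy : y ∈ hom (Module.Dual ℚ V) q) (h : q ≠ p + 1) :
    ω.pairing x y = 0 := by
  have h1 := ω.pairing_par hx y
  have h2 : ∀ p q : ZMod 2, q ≠ p + 1 → q = p := by decide
  rw [par_of_mem hy, map_smul, h2 p q h, sgn_succ, smul_eq_mul, smul_eq_mul] at h1
  have h3 : sgn p * (sgn p * ω.pairing x y) = - (sgn p * (sgn p * ω.pairing x y)) := by
    rw [← mul_neg, ← neg_mul, ← h1]
  rw [← mul_assoc, sgn_mul_self, one_mul] at h3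
  linarith

/-- The vector field `u ∂` with `∂(y) = {x, y}`. -/
def pairingDer (x : Module.Dual ℚ V) (u : Fun V) : Der (Fun V) :=
  superDer ((LinearMap.toSpanSingleton ℚ (Fun V) u) ∘ₗ ω.pairing x)

theorem pairingDer_ι (x y : Module.Dual ℚ V) (u : Fun V) :
    (ω.pairingDer x u).1 (TensorAlgebra.ι ℚ y) = ω.pairing x y • u := by
  rw [pairingDer, superDer_ι]; rfl

theorem pairingDer_mem {p q : ZMod 2} {x : Module.Dual ℚ V} {u : Fun V}
    (hx : x ∈ hom (Module.Dual ℚ V) p) (hu : u ∈ hom (Fun V) q) :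
    (ω.pairingDer x u).1 ∈ derOf (Fun V) (p + 1 + q) := by
  refine superDer_mem fun y => ?_
  change par (ω.pairing x y • u) = sgn (p + 1 + q) • (ω.pairing x (par y) • u)
  rw [ω.pairing_par hx, map_smul, par_of_mem hu, smul_smul, smul_smul, sgn_add, smul_eq_mul]
  congr 1
  have := sgn_mul_self (p + 1)
  linear_combination (-sgn q * ω.pairing x y) * this

/-- The Hamiltonian vector field of a letter is constant: since `ω` is constant, the constant part
of a vector field `α` with `i_α(ω) = dx` solves the same equation, and the solution is unique. -/
theorem hamVec_mk_ι {p : ZMod 2} {x : Module.Dual ℚ V} (hx : x ∈ hom (Module.Dual ℚ V) p) :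
    ω.hamVec (Cyc.mk _ (TensorAlgebra.ι ℚ x)) = ω.pairingDer x 1 := by
  set α := ω.hamVec (Cyc.mk _ (TensorAlgebra.ι ℚ x)) with hα
  have hα' := ω.hamVec_mem (mk_ι_mem hx)
  have hη := ω.pairingDer_mem hx one_mem_hom
  rw [add_zero] at hη
  obtain ⟨w, hw, hform⟩ := ω.exists_rep
  -- The constant part of `α` has the same contraction with the constant form `ω`.
  have key : (contr V (ω.pairingDer x 1)).1 w = constPart V ((contr V α).1 w) := by
    clear hform
    induction hw using Submodule.span_induction with
    | mem t h =>
      obtain ⟨q, y, hy, z, hz, rfl⟩ := h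
      rw [contr_dx_mul_dx hη hy, contr_dx_mul_dx hα' hy]
      simp only [map_add, map_mul, map_smul, constPart_dx, constPart_incl, pairingDer_ι,
        pairing_apply, ← hα, map_one]
      simp [Algebra.algebraMap_eq_smul_one]
    | zero => simp
    | add a b _ _ ha hb => simp only [map_add, ha, hb]
    | smul c a _ ha => simp only [map_smul, ha]
  have h1 := ω.hamVec_spec (Cyc.mk _ (TensorAlgebra.ι ℚ x))
  apply ω.injective
  change cycDer _ (contr V α) ω.form = cycDer _ (contr V (ω.pairingDer x 1)) ω.form
  rw [← hform, cycDer_mk (contr V (ω.pairingDer x 1)), key,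
    ← cycMap_mk (constPart V) par_constPart, ← cycDer_mk, hform, h1, dHam_mk, deRham_incl_ι,
    cycMap_mk, constPart_dx]

/-- For a letter the equation `i_α(ω) = dx` holds even before passing to `DR(V)`, because there are
no supercommutators among the linear forms. -/
theorem contr_pairingDer_one {p : ZMod 2} {x : Module.Dual ℚ V}
    (hx : x ∈ hom (Module.Dual ℚ V) p) {w : Forms V} (hw : w ∈ oddConst V)
    (hform : Cyc.mk _ w = ω.form) : (contr V (ω.pairingDer x 1)).1 w = dx V x := by
  have hη := ω.pairingDer_mem hx one_mem_hom
  rw [add_zero] at hη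
  have h1 : (contr V (ω.pairingDer x 1)).1 w ∈ LinearMap.range (dx V) := by
    clear hform
    induction hw using Submodule.span_induction with
    | mem t h =>
      obtain ⟨q, y, hy, z, hz, rfl⟩ := h
      rw [contr_dx_mul_dx hη hy, pairingDer_ι, pairingDer_ι]
      refine ⟨ω.pairing x y • z + (sgn ((p + 1 + 1) * (q + 1)) * ω.pairing x z) • y, ?_⟩
      simp [smul_smul]
    | zero => simp
    | add a b _ _ ha hb => rw [map_add]; exact add_mem ha hb
    | smul c a _ ha => rw [map_smul]; exact Submodule.smul_mem _ _ ha
  obtain ⟨v, hv⟩ := h1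
  have h2 := ω.hamVec_spec (Cyc.mk _ (TensorAlgebra.ι ℚ x))
  rw [ω.hamVec_mk_ι hx, ← hform, cycDer_mk, dHam_mk, deRham_incl_ι, ← hv] at h2
  have h3 : genDX V v = genDX V x := Cyc.mk_ι_injective h2
  rw [← hv, dx, LinearMap.comp_apply, LinearMap.comp_apply, h3]

/-- Multiplying the vector field of the letter `x` by `u` multiplies the contraction `dx` by `u`. -/
theorem contr_pairingDer {p r : ZMod 2} {x : Module.Dual ℚ V} {u : Fun V}
    (hx : x ∈ hom (Module.Dual ℚ V) p) (hu : u ∈ hom (Fun V) r) :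
    contrWith V ω.form (ω.pairingDer x u) =
      sgn (r * (p + 1)) • Cyc.mk _ (dx V x * incl V u) := by
  obtain ⟨w, hw, hform⟩ := ω.exists_rep
  change cycDer _ (contr V (ω.pairingDer x u)) ω.form = _
  rw [← ω.contr_pairingDer_one hx hw hform, ← hform, cycDer_mk]
  clear hform
  have hη := ω.pairingDer_mem hx one_mem_hom
  rw [add_zero] at hη
  have hξ := ω.pairingDer_mem hx hu
  induction hw using Submodule.span_induction with
  | mem t h =>
    obtain ⟨q, y, hy, z, hz, rfl⟩ := h
    rw [contr_dx_mul_dx hη hy, contr_dx_mul_dx hξ hy]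
    simp only [pairingDer_ι, map_smul, map_one, smul_mul_assoc, one_mul, mul_smul_comm, map_add,
      add_mul, mul_one]
    rw [Cyc.mk_mul_comm (incl_mem hu) (dx_mem hz), smul_add]
    -- A nonzero pairing relates the parities of its arguments.
    congr 1
    · by_cases h : q = p + 1
      · subst h
        rw [smul_comm]
        refine sgn_smul_congr ?_ _
        grind
      · rw [ω.pairing_eq_zero hx hy h]; simp
    · by_cases h : q + 1 = p + 1
      · obtain rfl : q = p := add_right_cancel h
        rw [sgn_smul_smul]
        refine sgn_smul_congr ?_ _
        have := zmod_two_mul_self q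
        grind
      · rw [ω.pairing_eq_zero hx hz h]; simp
  | zero => simp
  | add a b _ _ ha hb => simp only [map_add, add_mul, ha, hb, smul_add]
  | smul c a _ ha => simp only [map_smul, smul_mul_assoc, ha]; rw [smul_comm]

/-- The sign of a cyclic word `u x v` in the formula for its Hamiltonian vector field. -/
def cutSign (u : ZMod 2) (x : ZMod 2) (v : ZMod 2) : ZMod 2 := u * (x + v) + (u + v) * (x + 1)

/-- The Hamiltonian vector field of a cyclic word takes `y` to the sum, over its letters `x`, of
`{x, y}` times the word that remains when the cyclic word is cut open at `x`. -/
theorem hamVec_cword (l : List (HomEl (Module.Dual ℚ V))) (y : Module.Dual ℚ V) :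
    (ω.hamVec (cword l)).1 (TensorAlgebra.ι ℚ y) = cutsum l fun u x v =>
      (sgn (cutSign (wpar u) x.p (wpar v)) * ω.pairing x.val y) • word (v ++ u) := by
  have h : ω.hamVec (cword l) = cutsum l fun u x v =>
      sgn (cutSign (wpar u) x.p (wpar v)) • ω.pairingDer x.val (word (v ++ u)) := by
    apply ω.injective
    rw [map_cutsum]
    refine (ω.hamVec_spec _).trans ?_
    rw [dHam_cword]
    refine cutsum_congr fun u x v _ => ?_
    -- The 1-form `dx v u` is the contraction of `v u ∂` with `ω`, where `∂` belongs to the letter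
    -- `x`.
    rw [map_smul, ω.contr_pairingDer x.mem (word_mem _), sgn_smul_smul, wpar_append, cutSign]
    refine sgn_smul_congr ?_ _
    grind
  have h2 := congrArg (LinearMap.applyₗ (TensorAlgebra.ι ℚ y) ∘ₗ (Der (Fun V)).subtype) h
  rw [map_cutsum] at h2
  refine h2.trans (cutsum_congr fun u x v _ => ?_)
  rw [map_smul]
  change _ • (ω.pairingDer _ _).1 _ = _
  rw [pairingDer_ι, smul_smul]

/-- The pairing is symmetric because the bracket of letters is, `1` being nonzero in `𝔥`. Only
letters of opposite parities pair, so the symmetry carries no sign. -/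
theorem pairing_comm (x y : HomEl (Module.Dual ℚ V)) :
    ω.pairing x.val y.val = ω.pairing y.val x.val := by
  by_cases h : y.p = x.p + 1
  · have h1 := ω.bracket_symm (mk_ι_mem x.mem) (mk_ι_mem y.mem)
    have h2 : ∀ x y : HomEl (Module.Dual ℚ V), ω.bracket (Cyc.mk _ (TensorAlgebra.ι ℚ x.val))
        (Cyc.mk _ (TensorAlgebra.ι ℚ y.val)) = ω.pairing x.val y.val • Cyc.mk _ 1 := by
      intro x y
      rw [bracket, LinearMap.comp_apply, cycDer_mk, ω.hamVec_mk_ι x.mem, pairingDer_ι, map_smul]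
    have e : ∀ p : ZMod 2, p * (p + 1) = 0 := by decide
    rw [h2, h2, h, e, sgn_zero, one_smul, ← sub_eq_zero, ← sub_smul, smul_eq_zero] at h1
    exact sub_eq_zero.1 (h1.resolve_right Cyc.mk_one_ne_zero)
  · rw [ω.pairing_eq_zero x.mem y.mem h, ω.pairing_eq_zero y.mem x.mem]
    revert h
    generalize x.p = p
    generalize y.p = q
    revert p q
    decide

end OddSymplecticForm
end

/-! ### Cartan calculus and the Jacobi identity -/

section
variable {R : Type*} [Ring R] [Algebra ℚ R] [SuperAlgebra R]

theorem tw_tw (p q : ZMod 2) (a : R) : tw R p (tw R q a) = tw R (p + q) a := by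
  rcases zmod_two_cases p with rfl | rfl <;> rcases zmod_two_cases q with rfl | rfl <;>
    simp [tw_zero, tw_one, par_par, show (1 + 1 : ZMod 2) = 0 from rfl]

theorem derOf_tw {p : ZMod 2} {D : R →ₗ[ℚ] R} (hD : D ∈ derOf R p) (q : ZMod 2) (a : R) :
    D (tw R q a) = sgn (p * q) • tw R q (D a) := by
  rcases zmod_two_cases q with rfl | rfl
  · simp [tw_zero, sgn_zero]
  · rw [tw_one, tw_one, hD.1, mul_one, sgn_smul_self]

theorem supercommutator_mem {p q : ZMod 2} {D E : R →ₗ[ℚ] R} (hD : D ∈ derOf R p)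
    (hE : E ∈ derOf R q) : D ∘ₗ E - sgn (p * q) • E ∘ₗ D ∈ derOf R (p + q) := by
  refine ⟨fun a => ?_, fun a b => ?_⟩
  · simp only [LinearMap.sub_apply, LinearMap.smul_apply, LinearMap.comp_apply, map_sub, map_smul,
      hD.1, hE.1, smul_sub, sgn_smul_smul]
    rw [add_comm q p, add_comm (p * q)]
  · simp only [LinearMap.sub_apply, LinearMap.smul_apply, LinearMap.comp_apply, hD.2, hE.2, map_add,
      derOf_tw hD, derOf_tw hE, tw_tw, smul_add, smul_mul_assoc, sgn_smul_smul, mul_sub, sub_mul,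
      mul_smul_comm, add_comm q p, mul_comm q p, CharTwo.add_self_eq_zero, sgn_zero, one_smul]
    abel

/-- A derivation of a tensor algebra is determined by its values on generators. -/
theorem derOf_ext {W : Type*} [AddCommGroup W] [Module ℚ W] [SuperSpace W] {p : ZMod 2}
    {D E : TensorAlgebra ℚ W →ₗ[ℚ] TensorAlgebra ℚ W} (hD : D ∈ derOf (TensorAlgebra ℚ W) p)
    (hE : E ∈ derOf (TensorAlgebra ℚ W) p)
    (h : ∀ w, D (TensorAlgebra.ι ℚ w) = E (TensorAlgebra.ι ℚ w)) : D = E := by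
  refine leibniz_ext (φ := twAlg _ p) (ψ := AlgHom.id ℚ _) (fun a b => ?_) (fun a b => ?_) h
  · rw [hD.2, twAlg_apply, AlgHom.id_apply, add_comm]
  · rw [hE.2, twAlg_apply, AlgHom.id_apply, add_comm]

theorem derOf_le_Der (p : ZMod 2) : derOf R p ≤ Der R := by
  rcases zmod_two_cases p with rfl | rfl
  · exact le_sup_left
  · exact le_sup_right

end

section
variable {V : Type*} [AddCommGroup V] [Module ℚ V] [SuperSpace V]

theorem contr_incl {p : ZMod 2} {ξ : Der (Fun V)} (hξ : ξ.1 ∈ derOf (Fun V) p) (a : Fun V) :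
    (contr V ξ).1 (incl V a) = 0 := by
  have h := (contr_mem hξ).2
  have : (contr V ξ).1 ∘ₗ (incl V).toLinearMap = 0 := by
    refine leibniz_ext (φ := (twAlg _ (p + 1)).comp (incl V)) (ψ := incl V)
      (fun a b => ?_) (fun a b => by simp) (fun w => ?_)
    · simp only [LinearMap.comp_apply, AlgHom.toLinearMap_apply, map_mul, h, AlgHom.comp_apply,
        twAlg_apply]
      rw [add_comm]
    · simp [incl_ι, contr_genX]
  exact DFunLike.congr_fun this a

theorem deRham_dx (x : Module.Dual ℚ V) : (deRham V).1 (dx V x) = 0 := by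
  simp [deRham, superDer_ι, dx, show fstGen V (genDX V x) = 0 from rfl]

/-- A generator of the algebra of forms is the sum of a letter and the differential of a letter. -/
theorem ι_formGen (w : FormGen V) :
    TensorAlgebra.ι ℚ w = incl V (TensorAlgebra.ι ℚ (fstGen V w)) + dx V (sndGen V w) := by
  rw [incl_ι, dx, LinearMap.comp_apply, ← map_add]
  congr 1
  exact Prod.ext (add_zero w.1).symm (zero_add w.2).symm

theorem deRham_deRham (x : Forms V) : (deRham V).1 ((deRham V).1 x) = 0 := by
  have h1 := supercommutator_mem (deRham_mem V) (deRham_mem V)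
  have h2 := derOf_ext h1 (zero_mem _) (fun w => by
    have : (deRham V).1 ((deRham V).1 (TensorAlgebra.ι ℚ w)) = 0 := by
      rw [ι_formGen, map_add, deRham_incl_ι, deRham_dx, add_zero, deRham_dx]
    simp [this])
  have h3 := DFunLike.congr_fun h2 x
  rw [mul_one, sgn_one] at h3
  simp only [LinearMap.sub_apply, LinearMap.smul_apply, LinearMap.comp_apply,
    LinearMap.zero_apply] at h3
  rw [neg_one_smul, sub_neg_eq_add, ← two_smul ℚ] at h3
  exact (smul_eq_zero.1 h3).resolve_left two_ne_zero

theorem cycDer_deRham_dHam (a : Ham V) : cycDer _ (deRham V) (dHam V a) = 0 := by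
  obtain ⟨a, rfl⟩ := Cyc.mk_surjective a
  rw [dHam_mk, cycDer_mk, deRham_deRham, map_zero]

/-- The Cartan formula `i_{[ξ,η]} = [L_ξ, i_η]` with `L_ξ = [i_ξ, d]`. -/
theorem contr_supercommutator {p q : ZMod 2} {ξ η ζ : Der (Fun V)} (hξ : ξ.1 ∈ derOf (Fun V) p)
    (hη : η.1 ∈ derOf (Fun V) q) (hζ : ζ.1 = ξ.1 ∘ₗ η.1 - sgn (p * q) • η.1 ∘ₗ ξ.1) :
    (contr V ζ).1 =
      ((contr V ξ).1 ∘ₗ (deRham V).1 - sgn (p + 1) • (deRham V).1 ∘ₗ (contr V ξ).1) ∘ₗ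
        (contr V η).1 - sgn (p * (q + 1)) • (contr V η).1 ∘ₗ
      ((contr V ξ).1 ∘ₗ (deRham V).1 - sgn (p + 1) • (deRham V).1 ∘ₗ (contr V ξ).1) := by
  have hζ' : ζ.1 ∈ derOf (Fun V) (p + q) := hζ ▸ supercommutator_mem hξ hη
  have hL := supercommutator_mem (contr_mem hξ) (deRham_mem V)
  have e : ∀ p q : ZMod 2, p + 1 + 1 = p := by decide
  rw [mul_one, e p p] at hL
  have hR := supercommutator_mem hL (contr_mem hη)
  rw [← add_assoc] at hR
  -- Both sides are derivations of the same parity, so it suffices to compare them on `x` and `dx`.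
  refine derOf_ext (contr_mem hζ') hR fun w => ?_
  rw [ι_formGen]
  simp only [map_add, LinearMap.sub_apply, LinearMap.smul_apply, LinearMap.comp_apply,
    contr_incl hξ, contr_incl hη, contr_incl hζ', map_zero, smul_zero, sub_zero, zero_sub,
    contr_dx, deRham_dx, OddSymplecticForm.contr_deRham, zero_add, hζ, map_neg, map_sub, map_smul,
    smul_neg, sub_neg_eq_add, sgn_smul_smul]
  rw [sub_eq_add_neg]
  congr 1
  rw [show p * (q + 1) + (p + 1) = p * q + 1 by
    have := CharTwo.add_self_eq_zero p; linear_combination this, sgn_succ, neg_smul]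

namespace OddSymplecticForm
variable (ω : OddSymplecticForm V)

/-- The Hamiltonian vector field of a bracket is, up to sign, the supercommutator of the Hamiltonian
vector fields. -/
theorem hamVec_bracket {p q : ZMod 2} {a b : Ham V} (ha : a ∈ hom (Ham V) p)
    (hb : b ∈ hom (Ham V) q) : (ω.hamVec (ω.bracket a b)).1 =
      sgn (p + 1) • ((ω.hamVec a).1 ∘ₗ (ω.hamVec b).1 -
        sgn ((p + 1) * (q + 1)) • (ω.hamVec b).1 ∘ₗ (ω.hamVec a).1) := by
  have hα := ω.hamVec_mem ha
  have hβ := ω.hamVec_mem hb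
  let ζ : Der (Fun V) := ⟨_, derOf_le_Der _ (supercommutator_mem hα hβ)⟩
  have hC := contr_supercommutator hα hβ (ζ := ζ) rfl
  suffices h : ω.hamVec (ω.bracket a b) = sgn (p + 1) • ζ by rw [h]; rfl
  apply ω.injective
  refine (ω.hamVec_spec _).trans ?_
  rw [map_smul]
  -- By Cartan's formula `i_ζ ω` is, up to sign, `d(i_α db)`, as `dω = 0` and `d(i_α ω) = d(da) =
  -- 0`.
  have h1 : contrWith V ω.form ζ = - (sgn (p + 1 + 1) • dHam V (ω.bracket a b)) := by
    obtain ⟨w, -, hw⟩ := ω.exists_rep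
    have hd : Cyc.mk _ ((deRham V).1 w) = 0 := by
      rw [← cycDer_mk, hw, ω.closed]
    have hdα : cycDer _ (deRham V) (cycDer _ (contr V (ω.hamVec a)) ω.form) = 0 := by
      rw [ω.hamVec_spec, cycDer_deRham_dHam]
    have hib : ∀ b, cycDer _ (contr V (ω.hamVec a)) (dHam V b) = inclDR V (ω.bracket a b) := by
      intro b
      obtain ⟨b, rfl⟩ := Cyc.mk_surjective b
      rw [dHam_mk, cycDer_mk, contr_deRham]
      rfl
    change cycDer _ (contr V ζ) ω.form = _
    rw [← hw, cycDer_mk, hC]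
    simp only [LinearMap.sub_apply, LinearMap.smul_apply, LinearMap.comp_apply, map_sub, map_smul,
      ← cycDer_mk, hw, ω.closed, hdα, ω.hamVec_spec b, cycDer_deRham_dHam, map_zero, smul_zero,
      sub_zero, zero_sub, hib]
    rfl
  rw [h1, sgn_succ (p + 1), neg_smul, neg_neg, sgn_smul_self]

/-- The bracket of `𝔥[V]` satisfies the Jacobi identity. -/
theorem jacobi : ω.oddBracket.Jacobi := by
  intro p q a ha b hb c
  have h : ω.bracket (ω.bracket a b) c = sgn (p + 1) • (ω.bracket a (ω.bracket b c) -
      sgn ((p + 1) * (q + 1)) • ω.bracket b (ω.bracket a c)) := by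
    obtain ⟨c, rfl⟩ := Cyc.mk_surjective c
    have hmk : ∀ a c, ω.bracket a (Cyc.mk _ c) = Cyc.mk _ ((ω.hamVec a).1 c) := fun _ _ => rfl
    rw [hmk, hmk, hmk, hmk, hmk, ω.hamVec_bracket ha hb]
    simp only [LinearMap.sub_apply, LinearMap.smul_apply, LinearMap.comp_apply, map_sub, map_smul]
  change ω.bracket a (ω.bracket b c) = sgn (p + 1) • ω.bracket (ω.bracket a b) c +
    sgn ((p + 1) * (q + 1)) • ω.bracket b (ω.bracket a c)
  rw [h, sgn_smul_self, sub_add_cancel]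

end OddSymplecticForm
end

/-! ### Bracket and cobracket of cyclic words -/

theorem cutsum_sum {X N κ : Type*} [AddCommMonoid N] (s : Finset κ) (l : List X)
    (f : κ → List X → X → List X → N) :
    ∑ i ∈ s, cutsum l (f i) = cutsum l fun u x v => ∑ i ∈ s, f i u x v := by
  induction l generalizing f with
  | nil => simp [cutsum_nil]
  | cons x l ih => simp only [cutsum_cons, Finset.sum_add_distrib, ih]

section
variable {V : Type*} [AddCommGroup V] [Module ℚ V] [SuperSpace V]

theorem dual_apply_eq_zero {p q : ZMod 2} {v : V} {x : Module.Dual ℚ V} (hv : v ∈ hom V p)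
    (hx : x ∈ hom (Module.Dual ℚ V) q) (h : q ≠ p) : x v = 0 := by
  have h1 : x (par v) = (par x : Module.Dual ℚ V) v := rfl
  have h2 : ∀ p q : ZMod 2, q ≠ p → q = p + 1 := by decide
  rw [par_of_mem hv, par_of_mem hx, map_smul, LinearMap.smul_apply, h2 p q h, sgn_succ,
    smul_eq_mul, smul_eq_mul] at h1
  have h3 : sgn p * (sgn p * x v) = - (sgn p * (sgn p * x v)) := by
    rw [← mul_neg, ← neg_mul, ← h1]
  rw [← mul_assoc, sgn_mul_self, one_mul] at h3
  linarith

/-- The operator `∂` into `T ⊗ T`, as the derivation along the two inclusions of `T` that takes a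
letter to its value at `v`, with the Koszul sign absorbed into the second inclusion. -/
theorem partialTensor_eq {p : ZMod 2} {v : V} (hv : v ∈ hom V p) : partialTensor v =
    tder Algebra.TensorProduct.includeLeft
      (Algebra.TensorProduct.includeRight.comp (twAlg (Fun V) p))
      ((LinearMap.toSpanSingleton ℚ (Fun V ⊗[ℚ] Fun V) 1) ∘ₗ (sgn p • LinearMap.applyₗ v)) := by
  have h : ∀ q, tder Algebra.TensorProduct.includeLeft
      (Algebra.TensorProduct.includeRight.comp (twAlg (Fun V) q))
      (0 : _ →ₗ[ℚ] Fun V ⊗[ℚ] Fun V) = 0 := fun q => by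
    simpa using tder_smul (W := Module.Dual ℚ V) (B := Fun V ⊗[ℚ] Fun V)
      Algebra.TensorProduct.includeLeft
      (Algebra.TensorProduct.includeRight.comp (twAlg (Fun V) q)) 0 0
  have h1 : proj V (p + 1) v = 0 := ι_zero_of_mem hv
  have h2 : partialTensor v = ∑ p : ZMod 2, tder Algebra.TensorProduct.includeLeft
    (Algebra.TensorProduct.includeRight.comp (twAlg (Fun V) p))
    ((LinearMap.toSpanSingleton ℚ (Fun V ⊗[ℚ] Fun V) 1) ∘ₗ
      (sgn p • LinearMap.applyₗ (proj V p v))) := rfl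
  rw [h2, show (Finset.univ : Finset (ZMod 2)) = {0, 1} from rfl, Finset.sum_pair (by decide)]
  rcases zmod_two_cases p with rfl | rfl
  · rw [zero_add] at h1
    rw [h1, proj_of_mem hv, map_zero, smul_zero, LinearMap.comp_zero, h, add_zero]
  · rw [show (1 + 1 : ZMod 2) = 0 from rfl] at h1
    rw [h1, proj_of_mem hv, map_zero, smul_zero, LinearMap.comp_zero, h, zero_add]

theorem partialTensor_word {p : ZMod 2} {v : V} (hv : v ∈ hom V p)
    (l : List (HomEl (Module.Dual ℚ V))) :
    partialTensor v (word l) = cutsum l fun r y s =>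
      y.val v • sgn (p * (y.p + wpar s)) • (word r ⊗ₜ[ℚ] word s) := by
  rw [partialTensor_eq hv]
  induction l with
  | nil =>
    have := tder_mul (W := Module.Dual ℚ V) (B := Fun V ⊗[ℚ] Fun V)
      Algebra.TensorProduct.includeLeft
      (Algebra.TensorProduct.includeRight.comp (twAlg (Fun V) p))
      ((LinearMap.toSpanSingleton ℚ (Fun V ⊗[ℚ] Fun V) 1) ∘ₗ (sgn p • LinearMap.applyₗ v)) 1 1
    simp only [map_one, one_mul, mul_one] at this
    simpa [word_nil, cutsum_nil] using this
  | cons x l ih =>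
    rw [word_cons, tder_mul, ih, cutsum_cons, tder_ι, add_comm, mul_cutsum]
    congr 1
    · simp only [LinearMap.comp_apply, LinearMap.smul_apply, LinearMap.applyₗ_apply_apply,
        LinearMap.toSpanSingleton_apply, AlgHom.comp_apply, twAlg_apply, tw_of_mem (word_mem l),
        smul_mul_assoc, one_mul, map_smul, Algebra.TensorProduct.includeRight_apply]
      by_cases hx : x.p = p
      · simp only [word_nil, hx, mul_add, zmod_two_mul_self, sgn_add, smul_smul]
        congr 1
        ring
      · rw [dual_apply_eq_zero hv x.mem hx, zero_smul, zero_smul, smul_zero]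
    · refine cutsum_congr fun u y w _ => ?_
      simp only [mul_smul_comm, Algebra.TensorProduct.includeLeft_apply,
        Algebra.TensorProduct.tmul_mul_tmul, one_mul, word_cons]

/-- The generator of `S(𝔥[V])` given by a cyclic word. -/
def cycGen (l : List (HomEl (Module.Dual ℚ V))) : CE (Ham V) := CE.ι (Ham V) (cword l)

theorem cycGen_mem (l : List (HomEl (Module.Dual ℚ V))) :
    cycGen l ∈ hom (CE (Ham V)) (wpar l) := CE.ι_mem (cword_mem l)

theorem cycGen_append_comm (l m : List (HomEl (Module.Dual ℚ V))) :
    cycGen (l ++ m) = sgn (wpar l * wpar m) • cycGen (m ++ l) := by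
  rw [cycGen, cword_append_comm, map_smul]; rfl

theorem cycGen_mul_comm (l m : List (HomEl (Module.Dual ℚ V))) :
    cycGen l * cycGen m = sgn (wpar l * wpar m) • (cycGen m * cycGen l) :=
  CE.mul_comm_of_mem (cycGen_mem l) (cycGen_mem m)

namespace OddSymplecticForm
variable (ω : OddSymplecticForm V)

/-- The pairing of two letters. -/
def chord (x y : HomEl (Module.Dual ℚ V)) : ℚ := ω.pairing x.val y.val

theorem chord_comm (x y : HomEl (Module.Dual ℚ V)) : ω.chord x y = ω.chord y x :=
  ω.pairing_comm x y

/-- In a term with the factor `{x, y}` the parities of `x` and `y` may be assumed to be opposite. -/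
theorem chord_smul_congr {N : Type*} [AddCommGroup N] [Module ℚ N]
    {x y : HomEl (Module.Dual ℚ V)} {a b : N} (h : y.p = x.p + 1 → a = b) :
    ω.chord x y • a = ω.chord x y • b := by
  by_cases hxy : y.p = x.p + 1
  · rw [h hxy]
  · rw [chord, ω.pairing_eq_zero x.mem y.mem hxy, zero_smul, zero_smul]

/-- The bracket of cyclic words joins them along a pair of letters. -/
theorem bracket_cword (l m : List (HomEl (Module.Dual ℚ V))) :
    ω.bracket (cword l) (cword m) = cutsum l fun u x v => cutsum m fun r y s =>
      ω.chord x y • sgn ((wpar u + x.p + wpar v + 1) * wpar r + cutSign (wpar u) x.p (wpar v)) •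
        cword (r ++ v ++ u ++ s) := by
  have h : ω.bracket (cword l) (cword m) = Cyc.mk _ ((ω.hamVec (cword l)).1 (word m)) := rfl
  rw [h, derOf_word (ω.hamVec_mem (cword_mem l)), map_cutsum, cutsum_comm]
  refine cutsum_congr fun r y s _ => ?_
  rw [hamVec_cword, mul_cutsum, cutsum_mul, smul_cutsum, map_cutsum]
  refine cutsum_congr fun u x v hl => ?_
  simp only [map_smul, smul_mul_assoc, mul_smul_comm, smul_smul, cword,
    word_append, ← mul_assoc, chord, hl, wpar_append, wpar_cons, sgn_add]
  congr 1
  ring_nf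

theorem br_cycGen (l m : List (HomEl (Module.Dual ℚ V))) :
    CE.ι (Ham V) (ω.bracket (cword l) (cword m)) = cutsum l fun u x v => cutsum m fun r y s =>
      ω.chord x y • sgn ((wpar u + x.p + wpar v + 1) * wpar r + cutSign (wpar u) x.p (wpar v)) •
        cycGen (r ++ v ++ u ++ s) := by
  rw [bracket_cword, map_cutsum]
  refine cutsum_congr fun u x v _ => ?_
  rw [map_cutsum]
  refine cutsum_congr fun r y s _ => ?_
  rw [map_smul, map_smul]; rfl

variable [FiniteDimensional ℚ V]

/-- The vector `v` of `V` with `y(v) = {x, y}`. -/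
def dualVec (x : Module.Dual ℚ V) : V :=
  ∑ i, ω.pairing x ((Module.finBasis ℚ V).coord i) • Module.finBasis ℚ V i

theorem apply_dualVec (x y : Module.Dual ℚ V) : y (ω.dualVec x) = ω.pairing x y := by
  have h : y = ∑ i, y (Module.finBasis ℚ V i) • (Module.finBasis ℚ V).coord i := by
    refine (Module.finBasis ℚ V).ext fun j => ?_
    simp
  conv_rhs => rw [h]
  rw [dualVec, map_sum, map_sum]
  refine Finset.sum_congr rfl fun i _ => ?_
  rw [map_smul, map_smul, smul_eq_mul, smul_eq_mul, mul_comm]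

theorem dualVec_mem {p : ZMod 2} {x : Module.Dual ℚ V} (hx : x ∈ hom (Module.Dual ℚ V) p) :
    ω.dualVec x ∈ hom V (p + 1) := by
  rw [mem_hom, ← sub_eq_zero, ← Module.forall_dual_apply_eq_zero_iff ℚ]
  intro y
  have h : y (par (ω.dualVec x)) = (par y : Module.Dual ℚ V) (ω.dualVec x) := rfl
  rw [map_sub, h, map_smul, apply_dualVec, apply_dualVec, ω.pairing_par hx, sub_self]

/-- The cobracket cuts a cyclic word open at a letter `x` and then splits the remaining word at a
letter `y` that pairs with `x`. -/
theorem cobracket_cword (l : List (HomEl (Module.Dual ℚ V))) :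
    ω.cobracket (cword l) = (1 / 2 : ℚ) • cutsum l fun u x v => cutsum (v ++ u) fun r y s =>
      ω.chord x y • sgn (cutSign (wpar u) x.p (wpar v) + (x.p + 1) * (y.p + wpar s)) •
        (cword r ⊗ₜ[ℚ] cword s) := by
  change (1 / 2 : ℚ) • divergence V (ω.hamVec (cword l)) = _
  congr 1
  rw [divergence_apply]
  set F := TensorProduct.map (Cyc.mk (Fun V)) (Cyc.mk (Fun V))
  have h : ∀ i, F (partialTensor (Module.finBasis ℚ V i) ((ω.hamVec (cword l)).1
      (TensorAlgebra.ι ℚ ((Module.finBasis ℚ V).coord i)))) = cutsum l fun u x v =>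
      F (partialTensor (ω.pairing x.val ((Module.finBasis ℚ V).coord i) • Module.finBasis ℚ V i)
        (sgn (cutSign (wpar u) x.p (wpar v)) • word (v ++ u))) := by
    intro i
    rw [hamVec_cword, map_cutsum, map_cutsum]
    refine cutsum_congr fun u x v _ => ?_
    simp only [map_smul, LinearMap.smul_apply, smul_smul]
  simp only [h]
  rw [cutsum_sum]
  refine cutsum_congr fun u x v _ => ?_
  rw [← map_sum, ← LinearMap.sum_apply, ← map_sum, ← dualVec, map_smul, map_smul,
    partialTensor_word (ω.dualVec_mem x.mem), map_cutsum, smul_cutsum]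
  refine cutsum_congr fun r y s _ => ?_
  rw [map_smul, map_smul, apply_dualVec, smul_comm,
    sgn_smul_smul]
  rfl

/-- The sign of the term `p x q y r` in the formula for the cobracket of a cyclic word. -/
def cobrSign (p x q y r : ZMod 2) : ZMod 2 := cutSign p x (q + y + r) + (x + 1) * (y + r + p)

/-- The cobracket of a cyclic word cuts it along pairs of letters. In the symmetric square the two
orders of a pair contribute equally, which cancels the factor `1/2`. -/
theorem Delta_cycGen (l : List (HomEl (Module.Dual ℚ V))) :
    ω.oddCobracket.Delta (cycGen l) = cutsum l fun p x w => cutsum w fun q y r =>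
      ω.chord x y • sgn (cobrSign (wpar p) x.p (wpar q) y.p (wpar r)) •
        (cycGen q * cycGen (r ++ p)) := by
  have h : ω.oddCobracket.Delta (cycGen l) = OddCobracket.mulS (ω.cobracket (cword l)) :=
    ω.oddCobracket.Delta_ι _
  have hm : ∀ r s : List (HomEl (Module.Dual ℚ V)),
      OddCobracket.mulS (cword r ⊗ₜ[ℚ] cword s) = cycGen r * cycGen s := fun _ _ => rfl
  have h2 : OddCobracket.mulS (cutsum l fun u x v => cutsum (v ++ u) fun r y s =>
      ω.chord x y • sgn (cutSign (wpar u) x.p (wpar v) + (x.p + 1) * (y.p + wpar s)) •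
        (cword r ⊗ₜ[ℚ] cword s)) = cutsum l fun u x v =>
      (cutsum v fun r y s =>
        ω.chord x y • sgn (cutSign (wpar u) x.p (wpar v) + (x.p + 1) * (y.p + wpar (s ++ u))) •
          (cycGen r * cycGen (s ++ u))) +
      cutsum u fun r y s =>
        ω.chord x y • sgn (cutSign (wpar u) x.p (wpar v) + (x.p + 1) * (y.p + wpar s)) •
          (cycGen (v ++ r) * cycGen s) := by
    rw [map_cutsum]
    refine cutsum_congr fun u x v _ => ?_
    rw [cutsum_append, map_add, map_cutsum, map_cutsum]
    simp only [map_smul, hm]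
  rw [h, cobracket_cword, map_smul, h2, cutsum_add, one_div, inv_smul_eq_iff₀ two_ne_zero, two_smul]
  congr 1
  · refine cutsum_congr fun u x v _ => cutsum_congr fun q y r hv => ?_
    rw [hv, wpar_append, wpar_append, wpar_cons, cobrSign]
    simp only [add_assoc]
  -- The terms in which the second letter precedes the first one are those of the other order.
  · rw [← cutsum_coassoc]
    refine cutsum_congr fun u x v _ => cutsum_congr fun p y q hu => ?_
    rw [chord_comm]
    refine ω.chord_smul_congr fun hxy => ?_
    rw [cycGen_mul_comm, sgn_smul_smul, hu]
    simp only [wpar_append, wpar_cons, hxy, cobrSign, cutSign]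
    refine sgn_smul_congr ?_ _
    have := zmod_two_mul_self y.p
    have := zmod_two_mul_self (wpar p)
    have := zmod_two_mul_self (wpar q)
    have := zmod_two_mul_self (wpar v)
    grind

end OddSymplecticForm
end

/-! ### Sums over several cuts of a word -/

section
variable {X N : Type*} [AddCommMonoid N]

/-- The sum over all ways to write `l = A a B b C`. -/
def cut2 (l : List X) (f : List X → X → List X → X → List X → N) : N :=
  cutsum l fun A a w => cutsum w fun B b C => f A a B b C

/-- The sum over all ways to write `l = A a B b C c D`. -/
def cut3 (l : List X) (f : List X → X → List X → X → List X → X → List X → N) : N :=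
  cutsum l fun A a w => cut2 w fun B b C c D => f A a B b C c D

/-- The sum over all ways to write `l = A a B b C c D d E`. -/
def cut4 (l : List X)
    (f : List X → X → List X → X → List X → X → List X → X → List X → N) : N :=
  cutsum l fun A a w => cut3 w fun B b C c D d E => f A a B b C c D d E

theorem cutsum_eq_zero {l : List X} {f : List X → X → List X → N}
    (h : ∀ u x v, f u x v = 0) : cutsum l f = 0 :=
  (cutsum_congr fun u x v _ => h u x v).trans (cutsum_zero l)

theorem cut2_add (l : List X) (f g : List X → X → List X → X → List X → N) :
    cut2 l f + cut2 l g = cut2 l fun A a B b C => f A a B b C + g A a B b C := by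
  simp only [cut2, cutsum_add]

theorem cut3_add (l : List X) (f g : List X → X → List X → X → List X → X → List X → N) :
    cut3 l f + cut3 l g = cut3 l fun A a B b C c D => f A a B b C c D + g A a B b C c D := by
  simp only [cut3, ← cut2_add, cutsum_add]

theorem cut4_add (l : List X)
    (f g : List X → X → List X → X → List X → X → List X → X → List X → N) :
    cut4 l f + cut4 l g =
      cut4 l fun A a B b C c D d E => f A a B b C c D d E + g A a B b C c D d E := by
  simp only [cut4, ← cut3_add, cutsum_add]

theorem cut2_eq_zero {l : List X} {f : List X → X → List X → X → List X → N}
    (h : ∀ A a B b C, f A a B b C = 0) : cut2 l f = 0 :=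
  cutsum_eq_zero fun _ _ _ => cutsum_eq_zero fun _ _ _ => h _ _ _ _ _

theorem cut3_eq_zero {l : List X} {f : List X → X → List X → X → List X → X → List X → N}
    (h : ∀ A a B b C c D, f A a B b C c D = 0) : cut3 l f = 0 :=
  cutsum_eq_zero fun _ _ _ => cut2_eq_zero fun _ _ _ _ _ => h _ _ _ _ _ _ _

theorem cut4_eq_zero {l : List X}
    {f : List X → X → List X → X → List X → X → List X → X → List X → N}
    (h : ∀ A a B b C c D d E, f A a B b C c D d E = 0) : cut4 l f = 0 :=
  cutsum_eq_zero fun _ _ _ => cut3_eq_zero fun _ _ _ _ _ _ _ => h _ _ _ _ _ _ _ _ _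

theorem cut2_congr {l : List X} {f g : List X → X → List X → X → List X → N}
    (h : ∀ A a B b C, l = A ++ a :: (B ++ b :: C) → f A a B b C = g A a B b C) :
    cut2 l f = cut2 l g :=
  cutsum_congr fun A a w hw => cutsum_congr fun B b C hC => h A a B b C (by rw [hw, hC])

theorem map_cut2 {N' F : Type*} [AddCommMonoid N'] [FunLike F N N'] [AddMonoidHomClass F N N']
    (φ : F) (l : List X) (f : List X → X → List X → X → List X → N) :
    φ (cut2 l f) = cut2 l fun A a B b C => φ (f A a B b C) := by
  simp only [cut2, map_cutsum]

theorem smul_cut2 {N : Type*} [AddCommGroup N] [Module ℚ N] (c : ℚ) (l : List X)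
    (f : List X → X → List X → X → List X → N) :
    c • cut2 l f = cut2 l fun A a B b C => c • f A a B b C := by
  simp only [cut2, smul_cutsum]

theorem mul_cut2 {R : Type*} [Ring R] (s : R) (l : List X)
    (f : List X → X → List X → X → List X → R) :
    s * cut2 l f = cut2 l fun A a B b C => s * f A a B b C := by
  simp only [cut2, mul_cutsum]

theorem cut2_mul {R : Type*} [Ring R] (s : R) (l : List X)
    (f : List X → X → List X → X → List X → R) :
    cut2 l f * s = cut2 l fun A a B b C => f A a B b C * s := by
  simp only [cut2, cutsum_mul]

theorem cut2_append (l m : List X) (f : List X → X → List X → X → List X → N) :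
    cut2 (l ++ m) f = cut2 l (fun A a B b C => f A a B b (C ++ m)) +
      cut2 m (fun A a B b C => f (l ++ A) a B b C) +
      cutsum l (fun A a B => cutsum m fun B' b C => f A a (B ++ B') b C) := by
  simp only [cut2, cutsum_append, cutsum_add]
  abel

theorem cut2_comm (l m : List X)
    (f : List X → X → List X → X → List X → List X → X → List X → N) :
    cut2 l (fun A a B b C => cutsum m (f A a B b C)) =
      cutsum m fun r y s => cut2 l fun A a B b C => f A a B b C r y s := by
  simp only [cut2]
  rw [← cutsum_comm]
  exact cutsum_congr fun A a w _ => cutsum_comm w m fun B b C => f A a B b C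

/-- Cutting the middle part of a two-cut. -/
theorem cut2_cutsum_mid (l : List X) (f : List X → X → List X → X → List X → X → List X → N) :
    cut2 l (fun A a w c D => cutsum w fun B b C => f A a B b C c D) = cut3 l f :=
  cutsum_congr fun A a w _ => cutsum_coassoc w (f A a)

/-- Cutting the left part of a two-cut. -/
theorem cut2_cutsum_left (l : List X) (f : List X → X → List X → X → List X → X → List X → N) :
    cut2 l (fun w b C c D => cutsum w fun A a B => f A a B b C c D) = cut3 l f := by
  refine Eq.trans (cutsum_congr fun w b v _ => ?_)
    (cutsum_coassoc l fun A a B b v => cutsum v fun C c D => f A a B b C c D)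
  exact (cutsum_comm w v fun A a B => f A a B b).symm

/-- Cutting the left part of a cut twice. -/
theorem cutsum_cut2_left (l : List X) (f : List X → X → List X → X → List X → X → List X → N) :
    cutsum l (fun w c D => cut2 w fun A a B b C => f A a B b C c D) = cut3 l f := by
  refine (cutsum_coassoc l fun A a v c D => cutsum v fun B b C => f A a B b C c D).trans ?_
  exact cutsum_congr fun A a v _ => cutsum_coassoc v (f A a)

theorem cutsum_cut2_cross (l : List X)
    (f : List X → X → List X → X → List X → X → List X → N) :
    cutsum l (fun u b v => cutsum v fun C c D => cutsum u fun A a B => f A a B b C c D) =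
      cut3 l f :=
  cut2_cutsum_left l f

theorem cut2_cut2_mid (l : List X)
    (f : List X → X → List X → X → List X → X → List X → X → List X → N) :
    cut2 l (fun A a w d E => cut2 w fun B b C c D => f A a B b C c D d E) = cut4 l f :=
  cutsum_congr fun A a w _ => cutsum_cut2_left w (f A a)

theorem cut2_cut2_right (l : List X)
    (f : List X → X → List X → X → List X → X → List X → X → List X → N) :
    cut2 l (fun A a B b w => cut2 w fun C c D d E => f A a B b C c D d E) = cut4 l f := rfl

theorem cut2_cut2_left (l : List X)
    (f : List X → X → List X → X → List X → X → List X → X → List X → N) :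
    cut2 l (fun w c D d E => cut2 w fun A a B b C => f A a B b C c D d E) = cut4 l f := by
  refine Eq.trans (cutsum_congr fun w c v _ => ?_)
    (cutsum_cut2_left l fun A a B b C c v => cutsum v fun D d E => f A a B b C c D d E)
  exact (cut2_comm w v fun A a B b C => f A a B b C c).symm

theorem cut2_cutsum_outer (l : List X)
    (f : List X → X → List X → X → List X → X → List X → X → List X → N) :
    cut2 l (fun u b C c v => cutsum v fun D d E => cutsum u fun A a B => f A a B b C c D d E) =
      cut4 l f := by
  refine Eq.trans (cutsum_congr fun w b v _ => ?_)
    (cutsum_coassoc l fun A a B b v => cut2 v fun C c D d E => f A a B b C c D d E)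
  exact cut2_comm v w fun C c D d E A a B => f A a B b C c D d E

theorem cut2_cutsum_mid_right (l : List X)
    (f : List X → X → List X → X → List X → X → List X → X → List X → N) :
    cut2 l (fun A a u c v => cutsum u fun B b C => cutsum v fun D d E => f A a B b C c D d E) =
      cut4 l f :=
  cut2_cutsum_mid l fun A a B b C c v => cutsum v fun D d E => f A a B b C c D d E

theorem cut2_cutsum_mid_left (l : List X)
    (f : List X → X → List X → X → List X → X → List X → X → List X → N) :
    cut2 l (fun u b v d E => cutsum v fun C c D => cutsum u fun A a B => f A a B b C c D d E) =
      cut4 l f := by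
  refine (cut2_cutsum_mid l fun u b C c D d E => cutsum u fun A a B => f A a B b C c D d E).trans ?_
  refine Eq.trans (cutsum_congr fun w b v _ => ?_)
    (cutsum_coassoc l fun A a B b v => cut2 v fun C c D d E => f A a B b C c D d E)
  exact cut2_comm v w fun C c D d E A a B => f A a B b C c D d E

end

section
variable {V : Type*} [AddCommGroup V] [Module ℚ V] [SuperSpace V]

namespace OddSymplecticForm
variable (ω : OddSymplecticForm V)

/-- Two terms with the same pair of chords cancel if their signs differ by `-1`. The parities need
only be compared when the letters of each chord have opposite parities, as the terms vanish
otherwise. -/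
theorem chord_pair_add {N : Type*} [AddCommGroup N] [Module ℚ N]
    {x y z w : HomEl (Module.Dual ℚ V)} {i j i' j' : ZMod 2} {a b : N} (k : ZMod 2)
    (hab : a = sgn k • b)
    (h : y.p = x.p + 1 → w.p = z.p + 1 → i + j + k + 1 = i' + j') :
    ω.chord x y • sgn i • ω.chord z w • sgn j • a +
      ω.chord z w • sgn i' • ω.chord x y • sgn j' • b = 0 := by
  by_cases hxy : y.p = x.p + 1
  · by_cases hzw : w.p = z.p + 1
    · have h2 : sgn i' * sgn j' = - (sgn i * sgn j * sgn k) := by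
        rw [← sgn_add, ← h hxy hzw, sgn_add, sgn_one, sgn_add, sgn_add, mul_neg_one]
      have h3 : ω.chord z w • sgn i' • ω.chord x y • sgn j' • b =
          (ω.chord z w * ω.chord x y * (sgn i' * sgn j')) • b := by
        simp only [smul_smul]; congr 1; ring
      rw [h3, h2, hab]
      simp only [smul_smul, ← add_smul]
      convert zero_smul ℚ b using 2
      ring
    · simp only [chord, ω.pairing_eq_zero z.mem w.mem hzw, zero_smul, smul_zero, add_zero]
  · simp only [chord, ω.pairing_eq_zero x.mem y.mem hxy, zero_smul, smul_zero, add_zero]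

variable [FiniteDimensional ℚ V]

/-- The term of the cut `p x q y r` in the cobracket of a cyclic word. -/
def cobrTerm (p : List (HomEl (Module.Dual ℚ V))) (x : HomEl (Module.Dual ℚ V))
    (q : List (HomEl (Module.Dual ℚ V))) (y : HomEl (Module.Dual ℚ V))
    (r : List (HomEl (Module.Dual ℚ V))) : CE (Ham V) :=
  ω.chord x y • sgn (cobrSign (wpar p) x.p (wpar q) y.p (wpar r)) • (cycGen q * cycGen (r ++ p))

theorem Delta_cycGen_cut2 (l : List (HomEl (Module.Dual ℚ V))) :
    ω.oddCobracket.Delta (cycGen l) = cut2 l ω.cobrTerm := ω.Delta_cycGen l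

/-- The co-Jacobi identity on cyclic words: the terms with two given chords cancel in pairs. -/
theorem Delta_Delta_cycGen (l : List (HomEl (Module.Dual ℚ V))) :
    ω.oddCobracket.Delta (ω.oddCobracket.Delta (cycGen l)) = 0 := by
  -- The second chord lies in `B` or in `C A`, in the latter case in `C`, in `A`, or across both.
  have h : ∀ A a B b C, ω.oddCobracket.Delta (ω.cobrTerm A a B b C) =
      cut2 B (fun p x q y r =>
        ω.chord a b • sgn (cobrSign (wpar A) a.p (wpar (p ++ x :: (q ++ y :: r))) b.p (wpar C)) •
          (ω.cobrTerm p x q y r * cycGen (C ++ A))) +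
      (cut2 C (fun p x q y r =>
        ω.chord a b • sgn (cobrSign (wpar A) a.p (wpar B) b.p (wpar (p ++ x :: (q ++ y :: r))) +
            wpar B) •
          (cycGen B * ω.cobrTerm p x q y (r ++ A))) +
      cut2 A (fun p x q y r =>
        ω.chord a b • sgn (cobrSign (wpar (p ++ x :: (q ++ y :: r))) a.p (wpar B) b.p (wpar C) +
            wpar B) •
          (cycGen B * ω.cobrTerm (C ++ p) x q y r)) +
      cutsum C (fun p x q => cutsum A fun q' y r =>
        ω.chord a b • sgn (cobrSign (wpar (q' ++ y :: r)) a.p (wpar B) b.p (wpar (p ++ x :: q)) +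
            wpar B) •
          (cycGen B * ω.cobrTerm p x (q ++ q') y r))) := by
    intro A a B b C
    rw [cobrTerm, map_smul, map_smul, OddCobracket.Delta_mul, Delta_cycGen_cut2,
      Delta_cycGen_cut2, par_of_mem (cycGen_mem B), smul_mul_assoc, smul_add, smul_add, cut2_append,
      mul_add, mul_add, smul_add, smul_add, smul_add, smul_add, smul_add, smul_add]
    congr 1
    · rw [cut2_mul, smul_cut2, smul_cut2]
      exact cut2_congr fun p x q y r hB => by rw [hB]
    congr 1
    · congr 1
      · rw [mul_cut2, smul_cut2, smul_cut2, smul_cut2]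
        exact cut2_congr fun p x q y r hB => by rw [hB, sgn_smul_smul]
      · rw [mul_cut2, smul_cut2, smul_cut2, smul_cut2]
        exact cut2_congr fun p x q y r hB => by rw [hB, sgn_smul_smul]
    · rw [mul_cutsum, smul_cutsum, smul_cutsum, smul_cutsum]
      refine cutsum_congr fun p x q hC => ?_
      rw [mul_cutsum, smul_cutsum, smul_cutsum, smul_cutsum]
      exact cutsum_congr fun q' y r hA => by rw [hA, hC, sgn_smul_smul]
  -- A pair of chords that do not cross is nested (`a d` around `b c`) or disjoint (`a b` and `c
  -- d`). Each such pair occurs twice, once for each order of the two chords.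
  have h2 : ω.oddCobracket.Delta (ω.oddCobracket.Delta (cycGen l)) =
      cut4 l (fun A a B b C c D d E =>
        ω.chord a d • sgn (cobrSign (wpar A) a.p (wpar (B ++ b :: (C ++ c :: D))) d.p (wpar E)) •
          (ω.cobrTerm B b C c D * cycGen (E ++ A)) +
        ω.chord b c • sgn (cobrSign (wpar (A ++ a :: B)) b.p (wpar C) c.p (wpar (D ++ d :: E)) +
            wpar C) •
          (cycGen C * ω.cobrTerm D d (E ++ A) a B)) +
      cut4 l (fun A a B b C c D d E =>
        ω.chord a b • sgn (cobrSign (wpar A) a.p (wpar B) b.p (wpar (C ++ c :: (D ++ d :: E))) +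
            wpar B) •
          (cycGen B * ω.cobrTerm C c D d (E ++ A)) +
        ω.chord c d • sgn (cobrSign (wpar (A ++ a :: (B ++ b :: C))) c.p (wpar D) d.p (wpar E) +
            wpar D) •
          (cycGen D * ω.cobrTerm (E ++ A) a B b C)) := by
    rw [Delta_cycGen_cut2, map_cut2]
    simp only [h]
    rw [← cut2_add, ← cut2_add, ← cut2_add, cut2_cut2_mid, cut2_cut2_right, cut2_cut2_left,
      cut2_cutsum_outer, ← cut4_add, ← cut4_add]
    abel
  rw [h2, cut4_eq_zero, cut4_eq_zero, add_zero]
  · intro A a B b C c D d E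
    simp only [cobrTerm, mul_smul_comm]
    have hX : cycGen B * (cycGen D * cycGen (E ++ A ++ C)) =
        sgn (wpar B * wpar D + (wpar E + wpar A) * wpar C) •
          (cycGen D * (cycGen B * cycGen (C ++ (E ++ A)))) := by
      rw [← mul_assoc, cycGen_append_comm (E ++ A) C, cycGen_mul_comm B D, smul_mul_assoc,
        mul_smul_comm, sgn_smul_smul, wpar_append, mul_assoc]
    refine ω.chord_pair_add _ hX fun h1 h2 => ?_
    simp only [cobrSign, cutSign, wpar_append, wpar_cons, h1, h2]
    clear * -
    have := zmod_two_mul_self (wpar A)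
    have := zmod_two_mul_self (wpar B)
    have := zmod_two_mul_self (wpar C)
    have := zmod_two_mul_self (wpar D)
    have := zmod_two_mul_self (wpar E)
    have := zmod_two_mul_self a.p
    have := zmod_two_mul_self c.p
    grind
  · intro A a B b C c D d E
    simp only [cobrTerm, mul_smul_comm, smul_mul_assoc]
    have hX : cycGen C * cycGen (D ++ B) * cycGen (E ++ A) =
        sgn (wpar D * wpar B + (wpar B + wpar D) * (wpar E + wpar A)) •
          (cycGen C * (cycGen (E ++ A) * cycGen (B ++ D))) := by
      rw [mul_assoc, cycGen_append_comm D B, smul_mul_assoc, cycGen_mul_comm (B ++ D),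
        mul_smul_comm, mul_smul_comm, sgn_smul_smul, wpar_append, wpar_append]
    rw [ω.chord_comm d a]
    refine ω.chord_pair_add _ hX fun h1 h2 => ?_
    simp only [cobrSign, cutSign, wpar_append, wpar_cons, h1, h2]
    clear * -
    have := zmod_two_mul_self (wpar A)
    have := zmod_two_mul_self (wpar B)
    have := zmod_two_mul_self (wpar C)
    have := zmod_two_mul_self (wpar D)
    have := zmod_two_mul_self (wpar E)
    have := zmod_two_mul_self a.p
    have := zmod_two_mul_self b.p
    grind

/-- The involutivity of the cobracket on cyclic words: the two ways to cut along a pair of letters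
and to join along another pair that it separates cancel. -/
theorem delta_Delta_cycGen (l : List (HomEl (Module.Dual ℚ V))) :
    ω.oddBracket.delta (ω.oddCobracket.Delta (cycGen l)) = 0 := by
  -- On the product of the two pieces `B` and `C A`, the differential `δ` is their bracket. It joins
  -- a letter of `B` to a letter of `C` or of `A`.
  have h : ∀ A a B b C, ω.oddBracket.delta (ω.cobrTerm A a B b C) =
      cutsum B (fun u x v => cutsum C fun r y s =>
        ω.chord a b • sgn (cobrSign (wpar A) a.p (wpar (u ++ x :: v)) b.p (wpar (r ++ y :: s))) •
          ω.chord x y • sgn ((wpar u + x.p + wpar v + 1) * wpar r + cutSign (wpar u) x.p (wpar v)) •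
            cycGen (r ++ v ++ u ++ (s ++ A))) +
      cutsum B (fun u x v => cutsum A fun r y s =>
        ω.chord a b • sgn (cobrSign (wpar (r ++ y :: s)) a.p (wpar (u ++ x :: v)) b.p (wpar C)) •
          ω.chord x y • sgn ((wpar u + x.p + wpar v + 1) * wpar (C ++ r) +
            cutSign (wpar u) x.p (wpar v)) • cycGen (C ++ r ++ v ++ u ++ s)) := by
    intro A a B b C
    have h1 : ω.oddBracket.delta (cycGen B * cycGen (C ++ A)) =
        CE.ι (Ham V) (ω.bracket (cword B) (cword (C ++ A))) := by
      rw [cycGen, cycGen, OddBracket.delta_ι_mul, OddBracket.delta_ι, mul_zero, add_zero,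
        OddBracket.ad_ι]
      rfl
    rw [cobrTerm, map_smul, map_smul, h1, br_cycGen, smul_cutsum, smul_cutsum, ← cutsum_add]
    refine cutsum_congr fun u x v hB => ?_
    rw [cutsum_append, smul_add, smul_add, smul_cutsum, smul_cutsum, smul_cutsum, smul_cutsum]
    congr 1
    · exact cutsum_congr fun r y s hC => by rw [hB, hC]
    · exact cutsum_congr fun r y s hA => by rw [hB, hA]
  rw [Delta_cycGen_cut2, map_cut2]
  simp only [h]
  rw [← cut2_add, cut2_cutsum_mid_right l fun A a u x v b r y s =>
      ω.chord a b • sgn (cobrSign (wpar A) a.p (wpar (u ++ x :: v)) b.p (wpar (r ++ y :: s))) •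
        ω.chord x y • sgn ((wpar u + x.p + wpar v + 1) * wpar r + cutSign (wpar u) x.p (wpar v)) •
          cycGen (r ++ v ++ u ++ (s ++ A)),
    cut2_cutsum_mid_left l fun r y s a u x v b C =>
      ω.chord a b • sgn (cobrSign (wpar (r ++ y :: s)) a.p (wpar (u ++ x :: v)) b.p (wpar C)) •
        ω.chord x y • sgn ((wpar u + x.p + wpar v + 1) * wpar (C ++ r) +
          cutSign (wpar u) x.p (wpar v)) • cycGen (C ++ r ++ v ++ u ++ s), cut4_add]
  -- The chords `a c` and `b d` cross: one may cut along either of them and join along the other.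
  refine cut4_eq_zero fun A a B b C c D d E => ?_
  have hX : cycGen (D ++ C ++ B ++ (E ++ A)) =
      sgn ((wpar D + wpar C + wpar B) * (wpar E + wpar A)) • cycGen (E ++ A ++ D ++ C ++ B) := by
    rw [cycGen_append_comm (D ++ C ++ B) (E ++ A)]
    simp only [wpar_append, List.append_assoc, add_assoc]
  rw [ω.chord_comm c a]
  refine ω.chord_pair_add _ hX fun h1 h2 => ?_
  simp only [cobrSign, cutSign, wpar_append, wpar_cons, h1, h2]
  clear * -
  have := zmod_two_mul_self (wpar A)
  have := zmod_two_mul_self (wpar B)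
  have := zmod_two_mul_self (wpar C)
  have := zmod_two_mul_self (wpar D)
  have := zmod_two_mul_self (wpar E)
  have := zmod_two_mul_self a.p
  have := zmod_two_mul_self b.p
  grind

end OddSymplecticForm
end

/-! ### Compatibility of the bracket and the cobracket -/

section
variable {X N : Type*} [AddCommMonoid N]

theorem cutsum_cutsum_right (l : List X) (H : List X → X → List X → List X → X → List X → N) :
    cutsum l (fun u x v => cutsum v (H u x v)) =
      cut2 l fun A a B b C => H A a (B ++ b :: C) B b C :=
  cutsum_congr fun u x v _ => cutsum_congr fun B b C h => by rw [h]

theorem cutsum_cutsum_left (l : List X) (H : List X → X → List X → List X → X → List X → N) :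
    cutsum l (fun u x v => cutsum u (H u x v)) =
      cut2 l fun A a B b C => H (A ++ a :: B) b C A a B := by
  refine Eq.trans ?_ (cutsum_coassoc l fun A a B b C => H (A ++ a :: B) b C A a B)
  exact cutsum_congr fun u x v _ => cutsum_congr fun B b C h => by rw [h]

theorem cutsum_cut2_right (l : List X)
    (H : List X → X → List X → List X → X → List X → X → List X → N) :
    cutsum l (fun u x v => cut2 v (H u x v)) =
      cut3 l fun A a B b C c D => H A a (B ++ b :: (C ++ c :: D)) B b C c D :=
  cutsum_congr fun u x v _ => cut2_congr fun B b C c D h => by rw [h]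

theorem cutsum_cut2_left' (l : List X)
    (H : List X → X → List X → List X → X → List X → X → List X → N) :
    cutsum l (fun u x v => cut2 u (H u x v)) =
      cut3 l fun A a B b C c D => H (A ++ a :: (B ++ b :: C)) c D A a B b C := by
  refine Eq.trans ?_ (cutsum_cut2_left l fun A a B b C c D =>
    H (A ++ a :: (B ++ b :: C)) c D A a B b C)
  exact cutsum_congr fun u x v _ => cut2_congr fun A a B b C h => by rw [h]

theorem cutsum_cutsum_both (l : List X)
    (H : List X → X → List X → List X → X → List X → List X → X → List X → N) :
    cutsum l (fun u x v => cutsum v fun p y q => cutsum u fun p' y' q' =>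
      H u x v p y q p' y' q') =
      cut3 l fun A a B b C c D => H (A ++ a :: B) b (C ++ c :: D) C c D A a B := by
  refine Eq.trans ?_ (cutsum_cut2_cross l fun A a B b C c D =>
    H (A ++ a :: B) b (C ++ c :: D) C c D A a B)
  exact cutsum_congr fun u x v _ => cutsum_congr fun A a B hv => cutsum_congr fun _ _ _ hu => by
    rw [hv, hu]

theorem cut2_cutsum_left' (l : List X)
    (H : List X → X → List X → X → List X → List X → X → List X → N) :
    cut2 l (fun A a B b C => cutsum A (H A a B b C)) =
      cut3 l fun A a B b C c D => H (A ++ a :: B) b C c D A a B := by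
  rw [← cut2_cutsum_left]
  exact cutsum_congr fun A a w _ => cutsum_congr fun B b C _ =>
    cutsum_congr fun u x v h => by rw [h]

theorem cut2_cutsum_mid' (l : List X)
    (H : List X → X → List X → X → List X → List X → X → List X → N) :
    cut2 l (fun A a B b C => cutsum B (H A a B b C)) =
      cut3 l fun A a B b C c D => H A a (B ++ b :: C) c D B b C := by
  rw [← cut2_cutsum_mid]
  exact cutsum_congr fun A a w _ => cutsum_congr fun B b C _ =>
    cutsum_congr fun u x v h => by rw [h]

theorem cut2_cutsum_right' (l : List X)
    (H : List X → X → List X → X → List X → List X → X → List X → N) :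
    cut2 l (fun A a B b C => cutsum C (H A a B b C)) =
      cut3 l fun A a B b C c D => H A a B b (C ++ c :: D) C c D :=
  cutsum_congr fun A a w _ => cutsum_congr fun B b C _ =>
    cutsum_congr fun u x v h => by rw [h]

/-- Two cuts of a word that has been joined from a word `l` with one cut and a word `m` with one
cut: either both lie in `l`, or both in `m`, or one lies in each. -/
theorem cut2_join (l m : List X)
    (f : List X → X → List X → List X → X → List X → List X → X → List X → X → List X → N) :
    cutsum l (fun u x v => cutsum m fun r y s => cut2 (r ++ v ++ u ++ s) (f u x v r y s)) =
      cut3 l (fun A a B b C c D => cutsum m fun r y s =>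
        f A a (B ++ b :: (C ++ c :: D)) r y s (r ++ B) b C c (D ++ A ++ s) +
        (f (A ++ a :: (B ++ b :: C)) c D r y s (r ++ D ++ A) a B b (C ++ s) +
        f (A ++ a :: B) b (C ++ c :: D) r y s (r ++ C) c (D ++ A) a (B ++ s))) +
      (cutsum l (fun u x v => cut3 m fun A a B b C c D =>
        f u x v (A ++ a :: (B ++ b :: C)) c D A a B b (C ++ v ++ u ++ D) +
        (f u x v A a (B ++ b :: (C ++ c :: D)) (A ++ v ++ u ++ B) b C c D +
        f u x v (A ++ a :: B) b (C ++ c :: D) A a (B ++ v ++ u ++ C) c D)) +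
      cut2 l (fun A x B y C => cut2 m fun D z E w F =>
        f A x (B ++ y :: C) (D ++ z :: E) w F D z (E ++ B) y (C ++ A ++ F) +
        f (A ++ x :: B) y C D z (E ++ w :: F) (D ++ C ++ A) x (B ++ E) w F +
        (f (A ++ x :: B) y C (D ++ z :: E) w F D z (E ++ C ++ A) x (B ++ F) +
        f A x (B ++ y :: C) D z (E ++ w :: F) (D ++ B) y (C ++ A ++ E) w F))) := by
  -- The joined word consists of the pieces `v`, `u` of `l` and `r`, `s` of `m`. The facts below treat
  -- the possible positions of the two cuts, and are named after the pieces that contain them.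
  have vv : (cutsum l fun u x v => cutsum m fun r y s => cut2 v fun A a B b C =>
      f u x v r y s (r ++ A) a B b (C ++ u ++ s)) =
      cut3 l fun A a B b C c D => cutsum m fun r y s =>
        f A a (B ++ b :: (C ++ c :: D)) r y s (r ++ B) b C c (D ++ A ++ s) := by
    rw [← cutsum_cut2_right l fun u x v B b C c D => cutsum m fun r y s =>
      f u x v r y s (r ++ B) b C c (D ++ u ++ s)]
    exact cutsum_congr fun u x v _ => (cut2_comm v m _).symm
  have uu : (cutsum l fun u x v => cutsum m fun r y s => cut2 u fun A a B b C =>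
      f u x v r y s (r ++ v ++ A) a B b (C ++ s)) =
      cut3 l fun A a B b C c D => cutsum m fun r y s =>
        f (A ++ a :: (B ++ b :: C)) c D r y s (r ++ D ++ A) a B b (C ++ s) := by
    rw [← cutsum_cut2_left' l fun u x v A a B b C => cutsum m fun r y s =>
      f u x v r y s (r ++ v ++ A) a B b (C ++ s)]
    exact cutsum_congr fun u x v _ => (cut2_comm u m _).symm
  have vu : (cutsum l fun u x v => cutsum m fun r y s => cutsum v fun C c D => cutsum u fun A a B =>
      f u x v r y s (r ++ C) c (D ++ A) a (B ++ s)) =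
      cut3 l fun A a B b C c D => cutsum m fun r y s =>
        f (A ++ a :: B) b (C ++ c :: D) r y s (r ++ C) c (D ++ A) a (B ++ s) := by
    rw [← cutsum_cutsum_both l fun u x v C c D A a B => cutsum m fun r y s =>
      f u x v r y s (r ++ C) c (D ++ A) a (B ++ s)]
    refine cutsum_congr fun u x v _ => (cutsum_comm m v _).trans ?_
    exact cutsum_congr fun C c D _ => cutsum_comm m u _
  have rr : (cutsum l fun u x v => cutsum m fun r y s => cut2 r fun A a B b C =>
      f u x v r y s A a B b (C ++ v ++ u ++ s)) = cutsum l fun u x v => cut3 m fun A a B b C c D =>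
        f u x v (A ++ a :: (B ++ b :: C)) c D A a B b (C ++ v ++ u ++ D) :=
    cutsum_congr fun u x v _ => cutsum_cut2_left' m fun r y s A a B b C =>
      f u x v r y s A a B b (C ++ v ++ u ++ s)
  have ss : (cutsum l fun u x v => cutsum m fun r y s => cut2 s fun A a B b C =>
      f u x v r y s (r ++ v ++ u ++ A) a B b C) = cutsum l fun u x v => cut3 m fun A a B b C c D =>
        f u x v A a (B ++ b :: (C ++ c :: D)) (A ++ v ++ u ++ B) b C c D :=
    cutsum_congr fun u x v _ => cutsum_cut2_right m fun r y s A a B b C =>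
      f u x v r y s (r ++ v ++ u ++ A) a B b C
  have rs : (cutsum l fun u x v => cutsum m fun r y s => cutsum r fun A a B => cutsum s fun C c D =>
      f u x v r y s A a (B ++ v ++ u ++ C) c D) = cutsum l fun u x v => cut3 m fun A a B b C c D =>
        f u x v (A ++ a :: B) b (C ++ c :: D) A a (B ++ v ++ u ++ C) c D := by
    refine cutsum_congr fun u x v _ => Eq.trans ?_ (cutsum_cutsum_both m fun r y s C c D A a B =>
      f u x v r y s A a (B ++ v ++ u ++ C) c D)
    exact cutsum_congr fun r y s _ => cutsum_comm r s _
  have rv : (cutsum l fun u x v => cutsum m fun r y s => cutsum r fun D z E => cutsum v fun B b C =>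
      f u x v r y s D z (E ++ B) b (C ++ u ++ s)) = cut2 l fun A x B y C => cut2 m fun D z E w F =>
        f A x (B ++ y :: C) (D ++ z :: E) w F D z (E ++ B) y (C ++ A ++ F) := by
    rw [← cutsum_cutsum_right l fun u x v B b C => cut2 m fun D z E w F =>
      f u x v (D ++ z :: E) w F D z (E ++ B) b (C ++ u ++ F)]
    refine cutsum_congr fun u x v _ => Eq.trans ?_ (cutsum_comm m v fun r y s B b C =>
      cutsum r fun D z E => f u x v r y s D z (E ++ B) b (C ++ u ++ s)) |>.trans
        (cutsum_congr fun B b C _ => cutsum_cutsum_left m fun r y s D z E =>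
          f u x v r y s D z (E ++ B) b (C ++ u ++ s))
    exact cutsum_congr fun r y s _ => cutsum_comm r v _
  have us : (cutsum l fun u x v => cutsum m fun r y s => cutsum u fun A a B => cutsum s fun E w F =>
      f u x v r y s (r ++ v ++ A) a (B ++ E) w F) = cut2 l fun A x B y C => cut2 m fun D z E w F =>
        f (A ++ x :: B) y C D z (E ++ w :: F) (D ++ C ++ A) x (B ++ E) w F := by
    rw [← cutsum_cutsum_left l fun u x v A a B => cut2 m fun D z E w F =>
      f u x v D z (E ++ w :: F) (D ++ v ++ A) a (B ++ E) w F]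
    refine cutsum_congr fun u x v _ => (cutsum_comm m u _).trans ?_
    exact cutsum_congr fun A a B _ => cutsum_cutsum_right m fun r y s E w F =>
      f u x v r y s (r ++ v ++ A) a (B ++ E) w F
  have ru : (cutsum l fun u x v => cutsum m fun r y s => cutsum r fun D z E => cutsum u fun A a B =>
      f u x v r y s D z (E ++ v ++ A) a (B ++ s)) = cut2 l fun A x B y C => cut2 m fun D z E w F =>
        f (A ++ x :: B) y C (D ++ z :: E) w F D z (E ++ C ++ A) x (B ++ F) := by
    rw [← cutsum_cutsum_left l fun u x v A a B => cut2 m fun D z E w F =>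
      f u x v (D ++ z :: E) w F D z (E ++ v ++ A) a (B ++ F)]
    refine cutsum_congr fun u x v _ => Eq.trans ?_ (cutsum_comm m u fun r y s A a B =>
      cutsum r fun D z E => f u x v r y s D z (E ++ v ++ A) a (B ++ s)) |>.trans
        (cutsum_congr fun A a B _ => cutsum_cutsum_left m fun r y s D z E =>
          f u x v r y s D z (E ++ v ++ A) a (B ++ s))
    exact cutsum_congr fun r y s _ => cutsum_comm r u _
  have vs : (cutsum l fun u x v => cutsum m fun r y s => cutsum v fun B b C => cutsum s fun E w F =>
      f u x v r y s (r ++ B) b (C ++ u ++ E) w F) = cut2 l fun A x B y C => cut2 m fun D z E w F =>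
        f A x (B ++ y :: C) D z (E ++ w :: F) (D ++ B) y (C ++ A ++ E) w F := by
    rw [← cutsum_cutsum_right l fun u x v B b C => cut2 m fun D z E w F =>
      f u x v D z (E ++ w :: F) (D ++ B) b (C ++ u ++ E) w F]
    refine cutsum_congr fun u x v _ => (cutsum_comm m v _).trans ?_
    exact cutsum_congr fun B b C _ => cutsum_cutsum_right m fun r y s E w F =>
      f u x v r y s (r ++ B) b (C ++ u ++ E) w F
  simp only [cut2_append, cutsum_append, cutsum_add, ← cut3_add, ← cut2_add]
  rw [vv, uu, vu, rr, ss, rs, rv, us, ru, vs]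
  abel

end

section
variable {V : Type*} [AddCommGroup V] [Module ℚ V] [SuperSpace V]

theorem mul_cycGen_rotate (z : CE (Ham V)) (a b : List (HomEl (Module.Dual ℚ V)))
    {m : List (HomEl (Module.Dual ℚ V))} (h : b ++ a = m) :
    z * cycGen (a ++ b) = sgn (wpar a * wpar b) • (z * cycGen m) := by
  rw [cycGen_append_comm, h, mul_smul_comm]

namespace OddSymplecticForm
variable (ω : OddSymplecticForm V)

/-- The sign of the term in which the words `u x v` and `r y s` are joined along `x` and `y`, as a
function of the parities of `u`, `x`, `v`, `r`. -/
def brSign (u x v r : ZMod 2) : ZMod 2 := (u + x + v + 1) * r + cutSign u x v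

/-- The term of the cuts `u x v` and `r y s` in the bracket of two cyclic words. -/
def brTerm (u : List (HomEl (Module.Dual ℚ V))) (x : HomEl (Module.Dual ℚ V))
    (v r : List (HomEl (Module.Dual ℚ V))) (y : HomEl (Module.Dual ℚ V))
    (s : List (HomEl (Module.Dual ℚ V))) : CE (Ham V) :=
  ω.chord x y • sgn (brSign (wpar u) x.p (wpar v) (wpar r)) • cycGen (r ++ v ++ u ++ s)

theorem ad_cycGen (l m : List (HomEl (Module.Dual ℚ V))) :
    ω.oddBracket.ad (cword l) (cycGen m) =
      cutsum l fun u x v => cutsum m fun r y s => ω.brTerm u x v r y s :=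
  (ω.oddBracket.ad_ι _ _).trans (ω.br_cycGen l m)

theorem bracket_cycGen (l m : List (HomEl (Module.Dual ℚ V))) :
    ω.oddBracket.bracket (cycGen l) (cycGen m) =
      cutsum l fun u x v => cutsum m fun r y s => ω.brTerm u x v r y s :=
  (ω.oddBracket.bracket_ι _ _).trans (ω.ad_cycGen l m)

variable [FiniteDimensional ℚ V]

/-- The terms of `{Δ(l), m}`, by the position of the letter of `l` that is joined to `m`. -/
theorem bracket_Delta_cycGen (l m : List (HomEl (Module.Dual ℚ V))) :
    ω.oddBracket.bracket (ω.oddCobracket.Delta (cycGen l)) (cycGen m) =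
      cut3 l fun A a B b C c D => cutsum m fun r y s =>
        ω.chord b c • sgn (cobrSign (wpar (A ++ a :: B)) b.p (wpar C) c.p (wpar D) + wpar C) •
          (cycGen C * ω.brTerm (D ++ A) a B r y s) +
        (ω.chord a b • sgn (cobrSign (wpar A) a.p (wpar B) b.p (wpar (C ++ c :: D)) + wpar B) •
          (cycGen B * ω.brTerm C c (D ++ A) r y s) +
        ω.chord a c • sgn (cobrSign (wpar A) a.p (wpar (B ++ b :: C)) c.p (wpar D) +
            (wpar D + wpar A) * wpar (r ++ y :: s)) •
          (ω.brTerm B b C r y s * cycGen (D ++ A))) := by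
  have h : ∀ A a B b C, ω.oddBracket.bracket (ω.cobrTerm A a B b C) (cycGen m) =
      cutsum A (fun u x v => cutsum m fun r y s =>
        ω.chord a b • sgn (cobrSign (wpar A) a.p (wpar B) b.p (wpar C) + wpar B) •
          (cycGen B * ω.brTerm (C ++ u) x v r y s)) +
      (cutsum C (fun u x v => cutsum m fun r y s =>
        ω.chord a b • sgn (cobrSign (wpar A) a.p (wpar B) b.p (wpar C) + wpar B) •
          (cycGen B * ω.brTerm u x (v ++ A) r y s)) +
      cutsum B (fun u x v => cutsum m fun r y s =>
        ω.chord a b • sgn (cobrSign (wpar A) a.p (wpar B) b.p (wpar C) +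
            (wpar C + wpar A) * wpar (r ++ y :: s)) •
          (ω.brTerm u x v r y s * cycGen (C ++ A)))) := by
    intro A a B b C
    rw [cobrTerm, map_smul, map_smul, LinearMap.smul_apply, LinearMap.smul_apply,
      OddBracket.bracket_mul_left _ (cycGen_mem m), par_of_mem (cycGen_mem B),
      tw_of_mem (cycGen_mem (C ++ A)), bracket_cycGen, bracket_cycGen, cutsum_append]
    simp only [smul_add, mul_add, smul_cutsum, mul_cutsum, cutsum_mul, smul_mul_assoc,
      mul_smul_comm,
      sgn_smul_smul]
    rw [add_comm (cutsum C _), add_assoc]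
    congr 2
    refine cutsum_congr fun u x v _ => cutsum_congr fun r y s hm => ?_
    rw [← hm, wpar_append C A, mul_comm (wpar m)]
  rw [Delta_cycGen_cut2, ← LinearMap.flip_apply, map_cut2]
  simp only [LinearMap.flip_apply, h]
  rw [← cut2_add, ← cut2_add, cut2_cutsum_left' l fun A a B b C u x v => cutsum m fun r y s =>
        ω.chord a b • sgn (cobrSign (wpar A) a.p (wpar B) b.p (wpar C) + wpar B) •
          (cycGen B * ω.brTerm (C ++ u) x v r y s),
    cut2_cutsum_right' l fun A a B b C u x v => cutsum m fun r y s =>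
        ω.chord a b • sgn (cobrSign (wpar A) a.p (wpar B) b.p (wpar C) + wpar B) •
          (cycGen B * ω.brTerm u x (v ++ A) r y s),
    cut2_cutsum_mid' l fun A a B b C u x v => cutsum m fun r y s =>
        ω.chord a b • sgn (cobrSign (wpar A) a.p (wpar B) b.p (wpar C) +
            (wpar C + wpar A) * wpar (r ++ y :: s)) •
          (ω.brTerm u x v r y s * cycGen (C ++ A))]
  simp only [cutsum_add, ← cut3_add]

/-- The terms of `{l, Δ(m)}`, by the position of the letter of `m` that is joined to `l`. -/
theorem ad_Delta_cycGen (l m : List (HomEl (Module.Dual ℚ V))) :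
    sgn (wpar l) • ω.oddBracket.ad (cword l) (ω.oddCobracket.Delta (cycGen m)) =
      cutsum l fun u x v => cut3 m fun A a B b C c D =>
        ω.chord a b • sgn (cobrSign (wpar A) a.p (wpar B) b.p (wpar (C ++ c :: D)) +
            (wpar (u ++ x :: v) + (wpar (u ++ x :: v) + 1) * wpar B)) •
          (cycGen B * ω.brTerm u x v C c (D ++ A)) +
        (ω.chord b c • sgn (cobrSign (wpar (A ++ a :: B)) b.p (wpar C) c.p (wpar D) +
            (wpar (u ++ x :: v) + (wpar (u ++ x :: v) + 1) * wpar C)) •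
          (cycGen C * ω.brTerm u x v (D ++ A) a B) +
        ω.chord a c • sgn (cobrSign (wpar A) a.p (wpar (B ++ b :: C)) c.p (wpar D) +
            wpar (u ++ x :: v)) •
          (ω.brTerm u x v B b C * cycGen (D ++ A))) := by
  have h : ∀ A a B b C, sgn (wpar l) • ω.oddBracket.ad (cword l) (ω.cobrTerm A a B b C) =
      cutsum l fun u x v =>
        cutsum C (fun r y s =>
          ω.chord a b • sgn (cobrSign (wpar A) a.p (wpar B) b.p (wpar C) +
              (wpar (u ++ x :: v) + (wpar (u ++ x :: v) + 1) * wpar B)) •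
            (cycGen B * ω.brTerm u x v r y (s ++ A))) +
        (cutsum A (fun r y s =>
          ω.chord a b • sgn (cobrSign (wpar A) a.p (wpar B) b.p (wpar C) +
              (wpar (u ++ x :: v) + (wpar (u ++ x :: v) + 1) * wpar B)) •
            (cycGen B * ω.brTerm u x v (C ++ r) y s)) +
        cutsum B (fun r y s =>
          ω.chord a b • sgn (cobrSign (wpar A) a.p (wpar B) b.p (wpar C) +
              wpar (u ++ x :: v)) •
            (ω.brTerm u x v r y s * cycGen (C ++ A)))) := by
    intro A a B b C
    rw [cobrTerm, map_smul, map_smul, OddBracket.ad_mul_of_mem _ (cword_mem l) (cycGen_mem B),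
      ad_cycGen, ad_cycGen]
    simp only [cutsum_append, smul_add, mul_add, smul_cutsum, mul_cutsum, cutsum_mul, cutsum_add]
    rw [add_comm, add_assoc]
    have e1 : ∀ (i j : ZMod 2) (z : CE (Ham V)), sgn (wpar l) • ω.chord a b • sgn i • sgn j • z =
        ω.chord a b • sgn (i + (wpar l + j)) • z := fun i j z => by
      rw [smul_comm (sgn (wpar l)), sgn_smul_smul, sgn_smul_smul, add_left_comm, add_assoc]
    have e2 : ∀ (i : ZMod 2) (z : CE (Ham V)), sgn (wpar l) • ω.chord a b • sgn i • z =
        ω.chord a b • sgn (i + wpar l) • z := fun i z => by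
      rw [smul_comm (sgn (wpar l)), sgn_smul_smul, add_comm]
    refine congrArg₂ (· + ·) ?_ (congrArg₂ (· + ·) ?_ ?_)
    · exact cutsum_congr fun u x v hl => cutsum_congr fun _ _ _ _ => by rw [e1, ← hl]
    · exact cutsum_congr fun u x v hl => cutsum_congr fun _ _ _ _ => by rw [e1, ← hl]
    · exact cutsum_congr fun u x v hl => cutsum_congr fun _ _ _ _ => by rw [e2, ← hl]
  rw [Delta_cycGen_cut2, map_cut2, smul_cut2]
  simp only [h]
  rw [cut2_comm m l]
  refine cutsum_congr fun u x v _ => ?_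
  rw [← cut2_add, ← cut2_add, cut2_cutsum_right' m fun A a B b C r y s =>
      ω.chord a b • sgn (cobrSign (wpar A) a.p (wpar B) b.p (wpar C) +
              (wpar (u ++ x :: v) + (wpar (u ++ x :: v) + 1) * wpar B)) •
            (cycGen B * ω.brTerm u x v r y (s ++ A)),
    cut2_cutsum_left' m fun A a B b C r y s =>
      ω.chord a b • sgn (cobrSign (wpar A) a.p (wpar B) b.p (wpar C) +
              (wpar (u ++ x :: v) + (wpar (u ++ x :: v) + 1) * wpar B)) •
            (cycGen B * ω.brTerm u x v (C ++ r) y s),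
    cut2_cutsum_mid' m fun A a B b C r y s =>
      ω.chord a b • sgn (cobrSign (wpar A) a.p (wpar B) b.p (wpar C) + wpar (u ++ x :: v)) •
            (ω.brTerm u x v r y s * cycGen (C ++ A))]
  simp only [← cut3_add]

/-- The cobracket is a derivation of the bracket, on cyclic words: the cuts of a joined word that
lie in one of the two factors give the terms of the other two summands, and the remaining ones
cancel in pairs. -/
theorem compatible_cword (l m : List (HomEl (Module.Dual ℚ V))) :
    ω.oddCobracket.Delta (CE.ι (Ham V) (ω.bracket (cword l) (cword m))) +
      ω.oddBracket.bracket (ω.oddCobracket.Delta (cycGen l)) (cycGen m) +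
      sgn (wpar l) • ω.oddBracket.ad (cword l) (ω.oddCobracket.Delta (cycGen m)) = 0 := by
  have h : ω.oddCobracket.Delta (CE.ι (Ham V) (ω.bracket (cword l) (cword m))) =
      cutsum l fun u x v => cutsum m fun r y s => cut2 (r ++ v ++ u ++ s) fun A a B b C =>
        ω.chord x y • sgn (brSign (wpar u) x.p (wpar v) (wpar r)) • ω.cobrTerm A a B b C := by
    rw [br_cycGen, map_cutsum]
    refine cutsum_congr fun u x v _ => ?_
    rw [map_cutsum]
    refine cutsum_congr fun r y s _ => ?_
    rw [map_smul, map_smul, Delta_cycGen_cut2, smul_cut2, smul_cut2]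
    rfl
  rw [h, cut2_join l m fun u x v r y s A a B b C =>
      ω.chord x y • sgn (brSign (wpar u) x.p (wpar v) (wpar r)) • ω.cobrTerm A a B b C,
    bracket_Delta_cycGen, ad_Delta_cycGen]
  have e3 : ∀ a b c d e : CE (Ham V), a + d = 0 → b + e = 0 → c = 0 → a + (b + c) + d + e = 0 := by
    intro a b c d e h1 h2 h3
    rw [h3, eq_neg_of_add_eq_zero_right h1, eq_neg_of_add_eq_zero_right h2]
    abel
  have e6 : ∀ a b c a' b' c' : CE (Ham V), a + a' = 0 → b + b' = 0 → c + c' = 0 →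
      a + (b + c) + (a' + (b' + c')) = 0 := by
    intro a b c a' b' c' h1 h2 h3
    rw [eq_neg_of_add_eq_zero_right h1, eq_neg_of_add_eq_zero_right h2,
      eq_neg_of_add_eq_zero_right h3]
    abel
  refine e3 _ _ _ _ _ ?_ ?_ ?_
  -- Both ends of the cutting chord lie in `l`: cutting after joining against joining after cutting.
  · rw [cut3_add]
    refine cut3_eq_zero fun A a B b C c D => ?_
    rw [← cutsum_add]
    refine cutsum_eq_zero fun r y s => e6 _ _ _ _ _ _ ?_ ?_ ?_
    · simp only [cobrTerm, brTerm, mul_smul_comm]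
      have hX := mul_cycGen_rotate (cycGen C) (D ++ A ++ s) (r ++ B)
        (m := r ++ B ++ (D ++ A) ++ s) (by simp only [List.append_assoc])
      refine ω.chord_pair_add _ hX fun h1 h2 => ?_
      simp only [brSign, cobrSign, cutSign, wpar_append, wpar_cons, h2]
      clear * -
      have := zmod_two_mul_self (wpar A)
      have := zmod_two_mul_self (wpar B)
      have := zmod_two_mul_self (wpar C)
      have := zmod_two_mul_self (wpar D)
      have := zmod_two_mul_self (wpar r)
      have := zmod_two_mul_self (wpar s)
      have := zmod_two_mul_self a.p
      have := zmod_two_mul_self b.p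
      grind
    · simp only [cobrTerm, brTerm, mul_smul_comm]
      have hX := mul_cycGen_rotate (cycGen B) (C ++ s) (r ++ D ++ A)
        (m := r ++ (D ++ A) ++ C ++ s) (by simp only [List.append_assoc])
      refine ω.chord_pair_add _ hX fun h1 h2 => ?_
      simp only [brSign, cobrSign, cutSign, wpar_append, wpar_cons, h2]
      clear * -
      have := zmod_two_mul_self (wpar A)
      have := zmod_two_mul_self (wpar B)
      have := zmod_two_mul_self (wpar C)
      have := zmod_two_mul_self (wpar D)
      have := zmod_two_mul_self (wpar r)
      have := zmod_two_mul_self (wpar s)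
      have := zmod_two_mul_self a.p
      have := zmod_two_mul_self c.p
      grind
    · simp only [cobrTerm, brTerm, smul_mul_assoc]
      have hX : cycGen (D ++ A) * cycGen (B ++ s ++ (r ++ C)) =
          sgn ((wpar D + wpar A) * (wpar B + wpar s + (wpar r + wpar C)) +
            (wpar B + wpar s) * (wpar r + wpar C)) •
            (cycGen (r ++ C ++ B ++ s) * cycGen (D ++ A)) := by
        rw [cycGen_mul_comm, cycGen_append_comm (B ++ s) (r ++ C), smul_mul_assoc, sgn_smul_smul]
        simp only [wpar_append, List.append_assoc, add_assoc]
      rw [ω.chord_comm c a]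
      refine ω.chord_pair_add _ hX fun h1 h2 => ?_
      simp only [brSign, cobrSign, cutSign, wpar_append, wpar_cons, h1, h2]
      clear * -
      have := zmod_two_mul_self (wpar A)
      have := zmod_two_mul_self (wpar B)
      have := zmod_two_mul_self (wpar C)
      have := zmod_two_mul_self (wpar D)
      have := zmod_two_mul_self (wpar r)
      have := zmod_two_mul_self (wpar s)
      have := zmod_two_mul_self a.p
      have := zmod_two_mul_self b.p
      grind
  -- Both ends of the cutting chord lie in `m`.
  · rw [← cutsum_add]
    refine cutsum_eq_zero fun u x v => ?_
    rw [cut3_add]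
    refine cut3_eq_zero fun A a B b C c D => e6 _ _ _ _ _ _ ?_ ?_ ?_
    · simp only [cobrTerm, brTerm, mul_smul_comm]
      have hX : cycGen B * cycGen (C ++ v ++ u ++ D ++ A) =
          sgn 0 • (cycGen B * cycGen (C ++ v ++ u ++ (D ++ A))) := by
        rw [sgn_zero, one_smul]; simp only [List.append_assoc]
      refine ω.chord_pair_add _ hX fun h1 h2 => ?_
      simp only [brSign, cobrSign, cutSign, wpar_append, wpar_cons, h1, h2]
      clear * -
      have := zmod_two_mul_self (wpar A)
      have := zmod_two_mul_self (wpar B)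
      have := zmod_two_mul_self (wpar C)
      have := zmod_two_mul_self (wpar D)
      have := zmod_two_mul_self (wpar u)
      have := zmod_two_mul_self (wpar v)
      have := zmod_two_mul_self a.p
      have := zmod_two_mul_self x.p
      grind
    · simp only [cobrTerm, brTerm, mul_smul_comm]
      have hX : cycGen C * cycGen (D ++ (A ++ v ++ u ++ B)) =
          sgn 0 • (cycGen C * cycGen (D ++ A ++ v ++ u ++ B)) := by
        rw [sgn_zero, one_smul]; simp only [List.append_assoc]
      refine ω.chord_pair_add _ hX fun h1 h2 => ?_
      simp only [brSign, cobrSign, cutSign, wpar_append, wpar_cons, h1, h2]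
      clear * -
      have := zmod_two_mul_self (wpar A)
      have := zmod_two_mul_self (wpar B)
      have := zmod_two_mul_self (wpar C)
      have := zmod_two_mul_self (wpar D)
      have := zmod_two_mul_self (wpar u)
      have := zmod_two_mul_self (wpar v)
      have := zmod_two_mul_self b.p
      have := zmod_two_mul_self x.p
      grind
    · simp only [cobrTerm, brTerm, smul_mul_assoc]
      have hX : cycGen (B ++ v ++ u ++ C) * cycGen (D ++ A) =
          sgn 0 • (cycGen (B ++ v ++ u ++ C) * cycGen (D ++ A)) := by
        rw [sgn_zero, one_smul]
      refine ω.chord_pair_add _ hX fun h1 h2 => ?_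
      simp only [brSign, cobrSign, cutSign, wpar_append, wpar_cons, h1, h2]
      clear * -
      have := zmod_two_mul_self (wpar A)
      have := zmod_two_mul_self (wpar B)
      have := zmod_two_mul_self (wpar C)
      have := zmod_two_mul_self (wpar D)
      have := zmod_two_mul_self (wpar u)
      have := zmod_two_mul_self (wpar v)
      have := zmod_two_mul_self a.p
      have := zmod_two_mul_self x.p
      grind
  -- Both chords lead from `l` to `m`: the terms that join along one and cut along the other cancel
  -- those with the two chords exchanged.
  · refine cut2_eq_zero fun A x B y C => cut2_eq_zero fun D z E w F => ?_
    simp only [cobrTerm]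
    have hX : cycGen (E ++ B) * cycGen (C ++ A ++ F ++ D) =
        sgn (wpar E * wpar B + (wpar C + wpar A) * (wpar F + wpar D)) •
          (cycGen (B ++ E) * cycGen (F ++ (D ++ C ++ A))) := by
      have h1 : C ++ A ++ F ++ D = C ++ A ++ (F ++ D) := by simp only [List.append_assoc]
      rw [h1, cycGen_append_comm E B, cycGen_append_comm (C ++ A) (F ++ D), smul_mul_assoc,
        mul_smul_comm, sgn_smul_smul]
      simp only [wpar_append, List.append_assoc]
    have hY : cycGen (E ++ C ++ A) * cycGen (B ++ F ++ D) =
        sgn (wpar E * (wpar C + wpar A) + wpar B * (wpar F + wpar D)) •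
          (cycGen (C ++ A ++ E) * cycGen (F ++ (D ++ B))) := by
      have h1 : B ++ F ++ D = B ++ (F ++ D) := by simp only [List.append_assoc]
      have h2 : E ++ C ++ A = E ++ (C ++ A) := by simp only [List.append_assoc]
      rw [h1, h2, cycGen_append_comm E (C ++ A), cycGen_append_comm B (F ++ D), smul_mul_assoc,
        mul_smul_comm, sgn_smul_smul]
      simp only [wpar_append, List.append_assoc]
    rw [ω.chord_comm y z, ω.chord_comm x z, ω.chord_pair_add _ hX fun h1 h2 => ?_, zero_add,
      ω.chord_pair_add _ hY fun h1 h2 => ?_]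
    · simp only [brSign, cobrSign, cutSign, wpar_append, wpar_cons, h1, h2]
      clear * -
      have := zmod_two_mul_self (wpar A)
      have := zmod_two_mul_self (wpar B)
      have := zmod_two_mul_self (wpar C)
      have := zmod_two_mul_self (wpar D)
      have := zmod_two_mul_self (wpar E)
      have := zmod_two_mul_self (wpar F)
      have := zmod_two_mul_self y.p
      have := zmod_two_mul_self z.p
      grind
    · simp only [brSign, cobrSign, cutSign, wpar_append, wpar_cons, h1, h2]
      clear * -
      have := zmod_two_mul_self (wpar A)
      have := zmod_two_mul_self (wpar B)
      have := zmod_two_mul_self (wpar C)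
      have := zmod_two_mul_self (wpar D)
      have := zmod_two_mul_self (wpar E)
      have := zmod_two_mul_self (wpar F)
      have := zmod_two_mul_self x.p
      have := zmod_two_mul_self z.p
      grind

/-- The bracket and the cobracket of `𝔥[V]` are compatible: both sides being linear, it suffices to
compare them on cyclic words. -/
theorem compatible : ω.oddCobracket.Compatible ω.oddBracket := by
  intro p q a ha b hb
  change ω.oddCobracket.Delta (CE.ι (Ham V) (ω.bracket a b)) + _ + _ = 0
  refine cyc_hom_induction (C := fun a => ω.oddCobracket.Delta (CE.ι (Ham V) (ω.bracket a b)) +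
    ω.oddBracket.bracket (ω.oddCobracket.Delta (CE.ι (Ham V) a)) (CE.ι (Ham V) b) +
    sgn p • ω.oddBracket.ad a (ω.oddCobracket.Delta (CE.ι (Ham V) b)) = 0)
    (by simp) ?_ ?_ ?_ ha
  · rintro l rfl
    refine cyc_hom_induction (C := fun b => ω.oddCobracket.Delta (CE.ι (Ham V)
        (ω.bracket (cword l) b)) +
      ω.oddBracket.bracket (ω.oddCobracket.Delta (CE.ι (Ham V) (cword l))) (CE.ι (Ham V) b) +
      sgn (wpar l) • ω.oddBracket.ad (cword l) (ω.oddCobracket.Delta (CE.ι (Ham V) b)) = 0)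
      (by simp) ?_ ?_ ?_ hb
    · exact fun m _ => ω.compatible_cword l m
    · intro x y hx hy
      simp only [map_add, smul_add]
      convert congrArg₂ (· + ·) hx hy using 1
      · abel
      · rw [add_zero]
    · intro c x hx
      simp only [map_smul, smul_comm (sgn (wpar l)) c, ← smul_add, hx, smul_zero]
  · intro x y hx hy
    simp only [map_add, LinearMap.add_apply, smul_add]
    convert congrArg₂ (· + ·) hx hy using 1
    · abel
    · rw [add_zero]
  · intro c x hx
    simp only [map_smul, LinearMap.smul_apply, smul_comm (sgn p) c, ← smul_add, hx, smul_zero]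

/-- The square of `Δ` vanishes, by the co-Jacobi identity. -/
theorem Delta_Delta (x : CE (Ham V)) : ω.oddCobracket.Delta (ω.oddCobracket.Delta x) = 0 := by
  refine ω.oddCobracket.Delta_Delta (fun p a ha => ?_) x
  refine cyc_hom_induction (C := fun a =>
    ω.oddCobracket.Delta (ω.oddCobracket.Delta (CE.ι (Ham V) a)) = 0) (by simp)
    (fun l _ => ω.Delta_Delta_cycGen l) (fun x y hx hy => ?_) (fun c x hx => ?_) ha
  · simp only [map_add, hx, hy, add_zero]
  · simp only [map_smul, hx, smul_zero]

/-- The differentials `δ` and `Δ` anticommute, by involutivity and compatibility. -/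
theorem delta_Delta (x : CE (Ham V)) : ω.oddBracket.delta (ω.oddCobracket.Delta x) +
    ω.oddCobracket.Delta (ω.oddBracket.delta x) = 0 := by
  refine ω.compatible.delta_Delta (fun p a ha => ?_) x
  refine cyc_hom_induction (C := fun a =>
    ω.oddBracket.delta (ω.oddCobracket.Delta (CE.ι (Ham V) a)) = 0) (by simp)
    (fun l _ => ω.delta_Delta_cycGen l) (fun x y hx hy => ?_) (fun c x hx => ?_) ha
  · simp only [map_add, hx, hy, add_zero]
  · simp only [map_smul, hx, smul_zero]

end OddSymplecticForm
end

/-! ### The differential graded Lie algebra `ℚ[γ] ⊗ S(𝔥)` -/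

section
variable {M : Type*} [AddCommGroup M] [Module ℚ M] [SuperSpace M]

theorem tmul_mem_hom {p : ZMod 2} (a : Polynomial ℚ) {x : M} (hx : x ∈ hom M p) :
    a ⊗ₜ[ℚ] x ∈ hom (Polynomial ℚ ⊗[ℚ] M) p := by
  have h : par (a ⊗ₜ[ℚ] x) = a ⊗ₜ[ℚ] par x := rfl
  rw [mem_hom, h, par_of_mem hx, TensorProduct.tmul_smul]

/-- Induction over the elements of parity `p` of `ℚ[γ] ⊗ M`. -/
theorem tensor_hom_induction {p : ZMod 2} {C : Polynomial ℚ ⊗[ℚ] M → Prop} (zero : C 0)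
    (tmul : ∀ a, ∀ x ∈ hom M p, C (a ⊗ₜ x)) (add : ∀ x y, C x → C y → C (x + y))
    {z : Polynomial ℚ ⊗[ℚ] M} (hz : z ∈ hom (Polynomial ℚ ⊗[ℚ] M) p) : C z := by
  suffices h : ∀ y, C (proj _ p y) by simpa [proj_of_mem hz] using h z
  intro y
  induction y with
  | zero => rwa [map_zero]
  | tmul a x =>
    have h : proj (Polynomial ℚ ⊗[ℚ] M) p (a ⊗ₜ x) = a ⊗ₜ proj M p x := by
      have h2 : par (a ⊗ₜ[ℚ] x) = a ⊗ₜ[ℚ] par x := rfl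
      rw [proj_apply, proj_apply, h2, TensorProduct.tmul_smul, TensorProduct.tmul_add,
        TensorProduct.tmul_smul]
    rw [h]
    exact tmul a _ (proj_mem p x)
  | add x y hx hy => rw [map_add]; exact add _ _ hx hy

end

namespace OddSymplecticForm
variable {V : Type*} [AddCommGroup V] [Module ℚ V] [SuperSpace V] (ω : OddSymplecticForm V)

theorem fullBracket_tmul (a b : Polynomial ℚ) (x y : CE (Ham V)) :
    ω.fullBracket (a ⊗ₜ x) (b ⊗ₜ y) = (a * b) ⊗ₜ ω.oddBracket.bracket x y := rfl

theorem fullBracket_mem {p q : ZMod 2} {x y : FullDGLA V} (hx : x ∈ hom (FullDGLA V) p)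
    (hy : y ∈ hom (FullDGLA V) q) : ω.fullBracket x y ∈ hom (FullDGLA V) (p + q + 1) := by
  refine tensor_hom_induction (C := fun x => ω.fullBracket x y ∈ hom (FullDGLA V) (p + q + 1))
    (by simp) (fun a x hx => ?_) (fun u v hu hv => ?_) hx
  · refine tensor_hom_induction (C := fun y => ω.fullBracket (a ⊗ₜ x) y ∈
      hom (FullDGLA V) (p + q + 1)) (by simp) (fun b y hy => ?_) (fun u v hu hv => ?_) hy
    · exact tmul_mem_hom _ (ω.oddBracket.bracket_mem hx hy)
    · rw [map_add]; exact add_mem hu hv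
  · rw [map_add]; exact add_mem hu hv

theorem fullBracket_symm {p q : ZMod 2} {x y : FullDGLA V} (hx : x ∈ hom (FullDGLA V) p)
    (hy : y ∈ hom (FullDGLA V) q) : ω.fullBracket x y = sgn (p * q) • ω.fullBracket y x := by
  refine tensor_hom_induction (C := fun x => ω.fullBracket x y = sgn (p * q) • ω.fullBracket y x)
    (by simp) (fun a x hx => ?_) (fun u v hu hv => ?_) hx
  · refine tensor_hom_induction (C := fun y => ω.fullBracket (a ⊗ₜ x) y =
      sgn (p * q) • ω.fullBracket y (a ⊗ₜ x)) (by simp) (fun b y hy => ?_) (fun u v hu hv => ?_) hy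
    · rw [fullBracket_tmul, fullBracket_tmul, ω.oddBracket.bracket_comm hx hy, mul_comm,
        TensorProduct.tmul_smul]
    · rw [map_add, hu, hv, map_add, LinearMap.add_apply, smul_add]
  · rw [map_add, LinearMap.add_apply, hu, hv, map_add, smul_add]

theorem fullBracket_jacobi {p q : ZMod 2} {x y : FullDGLA V} (hx : x ∈ hom (FullDGLA V) p)
    (hy : y ∈ hom (FullDGLA V) q) (z : FullDGLA V) :
    ω.fullBracket x (ω.fullBracket y z) = sgn (p + 1) • ω.fullBracket (ω.fullBracket x y) z +
      sgn ((p + 1) * (q + 1)) • ω.fullBracket y (ω.fullBracket x z) := by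
  refine tensor_hom_induction (C := fun x => ω.fullBracket x (ω.fullBracket y z) =
    sgn (p + 1) • ω.fullBracket (ω.fullBracket x y) z +
      sgn ((p + 1) * (q + 1)) • ω.fullBracket y (ω.fullBracket x z))
    (by simp) (fun a x hx => ?_) (fun u v hu hv => ?_) hx
  · refine tensor_hom_induction (C := fun y => ω.fullBracket (a ⊗ₜ x) (ω.fullBracket y z) =
      sgn (p + 1) • ω.fullBracket (ω.fullBracket (a ⊗ₜ x) y) z +
        sgn ((p + 1) * (q + 1)) • ω.fullBracket y (ω.fullBracket (a ⊗ₜ x) z))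
      (by simp) (fun b y hy => ?_) (fun u v hu hv => ?_) hy
    · induction z using TensorProduct.induction_on with
      | zero => simp
      | tmul c z =>
        simp only [fullBracket_tmul]
        rw [ω.jacobi.bracket hx hy z, TensorProduct.tmul_add, TensorProduct.tmul_smul,
          TensorProduct.tmul_smul, mul_assoc, mul_left_comm a b c]
      | add u v hu hv => simp only [map_add, hu, hv, smul_add]; abel
    · simp only [map_add, LinearMap.add_apply, hu, hv, smul_add]; abel
  · simp only [map_add, LinearMap.add_apply, hu, hv, smul_add]; abel

variable [FiniteDimensional ℚ V]

theorem fullD_tmul (a : Polynomial ℚ) (x : CE (Ham V)) : ω.fullD (a ⊗ₜ x) =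
    (Polynomial.X * a) ⊗ₜ ω.oddBracket.delta x + a ⊗ₜ ω.oddCobracket.Delta x := rfl

theorem fullD_mem {p : ZMod 2} {x : FullDGLA V} (hx : x ∈ hom (FullDGLA V) p) :
    ω.fullD x ∈ hom (FullDGLA V) (p + 1) := by
  refine tensor_hom_induction (C := fun x => ω.fullD x ∈ hom (FullDGLA V) (p + 1))
    (by simp) (fun a x hx => ?_) (fun u v hu hv => ?_) hx
  · exact add_mem (tmul_mem_hom _ (ω.oddBracket.delta_mem hx))
      (tmul_mem_hom _ (ω.oddCobracket.Delta_mem hx))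
  · rw [map_add]; exact add_mem hu hv

/-- The coefficients of `γ²`, `γ` and `1` in `(γδ + Δ)²` vanish separately. -/
theorem fullD_fullD (x : FullDGLA V) : ω.fullD (ω.fullD x) = 0 := by
  induction x using TensorProduct.induction_on with
  | zero => simp
  | tmul a x =>
    rw [fullD_tmul, map_add, fullD_tmul, fullD_tmul, ω.jacobi.delta_delta, ω.Delta_Delta,
      TensorProduct.tmul_zero, TensorProduct.tmul_zero, zero_add, add_zero,
      ← TensorProduct.tmul_add,
      add_comm, ω.delta_Delta, TensorProduct.tmul_zero]
  | add x y hx hy => rw [map_add, map_add, hx, hy, add_zero]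

/-- The differential `γδ + Δ` is a derivation of the bracket, as `δ` and `Δ` are. -/
theorem fullD_fullBracket {p : ZMod 2} {x : FullDGLA V} (hx : x ∈ hom (FullDGLA V) p)
    (y : FullDGLA V) : ω.fullD (ω.fullBracket x y) + ω.fullBracket (ω.fullD x) y +
      sgn p • ω.fullBracket x (ω.fullD y) = 0 := by
  refine tensor_hom_induction (C := fun x => ω.fullD (ω.fullBracket x y) +
    ω.fullBracket (ω.fullD x) y + sgn p • ω.fullBracket x (ω.fullD y) = 0)
    (by simp) (fun a x hx => ?_) (fun u v hu hv => ?_) hx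
  · induction y using TensorProduct.induction_on with
    | zero => simp
    | tmul b y =>
      rw [fullD_tmul, fullD_tmul, fullBracket_tmul, fullD_tmul, map_add, map_add,
        LinearMap.add_apply,
        fullBracket_tmul, fullBracket_tmul, fullBracket_tmul, fullBracket_tmul,
        ← mul_assoc Polynomial.X, mul_left_comm a]
      have h1 := congrArg (fun z => (Polynomial.X * a * b) ⊗ₜ[ℚ] z) (ω.jacobi.delta_bracket hx y)
      have h2 := congrArg (fun z => (a * b) ⊗ₜ[ℚ] z) (ω.compatible.Delta_bracket hx y)
      simp only [TensorProduct.tmul_add, TensorProduct.tmul_smul, TensorProduct.tmul_zero] at h1 h2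
      rw [← add_zero (0 : FullDGLA V)]
      nth_rw 2 [← h2]
      rw [← h1, smul_add, ← mul_assoc]
      abel
    | add u v hu hv =>
      simp only [map_add, smul_add]
      convert congrArg₂ (· + ·) hu hv using 1
      · abel
      · rw [add_zero]
  · simp only [map_add, LinearMap.add_apply, smul_add]
    convert congrArg₂ (· + ·) hu hv using 1
    · abel
    · rw [add_zero]

end OddSymplecticForm

/-! ### Monomials in cyclic words -/

theorem cutsum_mem {X N : Type*} [AddCommGroup N] [Module ℚ N] (S : Submodule ℚ N) {l : List X}
    {f : List X → X → List X → N} (h : ∀ u x v, l = u ++ x :: v → f u x v ∈ S) :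
    cutsum l f ∈ S := by
  induction l generalizing f with
  | nil => exact zero_mem _
  | cons x l ih =>
    rw [cutsum_cons]
    exact add_mem (h [] x l rfl) (ih fun u y v hl => h (x :: u) y v (by rw [hl]; rfl))

section
variable {V : Type*} [AddCommGroup V] [Module ℚ V] [SuperSpace V]

/-- The product of the generators of `S(𝔥)` given by a list of cyclic words. The empty word gives
the factor `ν`. -/
def wprod (L : List (List (HomEl (Module.Dual ℚ V)))) : CE (Ham V) := (L.map cycGen).prod

theorem wprod_nil : wprod ([] : List (List (HomEl (Module.Dual ℚ V)))) = 1 := rfl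

theorem wprod_cons (l : List (HomEl (Module.Dual ℚ V)))
    (L : List (List (HomEl (Module.Dual ℚ V)))) :
    wprod (l :: L) = cycGen l * wprod L := by simp [wprod]

theorem wprod_append (L L' : List (List (HomEl (Module.Dual ℚ V)))) :
    wprod (L ++ L') = wprod L * wprod L' := by simp [wprod]

variable (V) in
/-- The span of the products of at least `n` cyclic words, the ideal of `S(𝔥)` of elements of order
at least `n`. -/
def symGE (n : ℕ) : Submodule ℚ (CE (Ham V)) := Submodule.span ℚ
  {x | ∃ L : List (List (HomEl (Module.Dual ℚ V))), n ≤ L.length ∧ x = wprod L}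

theorem wprod_mem_symGE {n : ℕ} {L : List (List (HomEl (Module.Dual ℚ V)))} (h : n ≤ L.length) :
    wprod L ∈ symGE V n := Submodule.subset_span ⟨L, h, rfl⟩

theorem cycGen_mem_symGE (l : List (HomEl (Module.Dual ℚ V))) : cycGen l ∈ symGE V 1 := by
  simpa [wprod] using wprod_mem_symGE (L := [l]) le_rfl

theorem mul_mem_symGE {m n : ℕ} {x y : CE (Ham V)} (hx : x ∈ symGE V m) (hy : y ∈ symGE V n) :
    x * y ∈ symGE V (m + n) := by
  have h := Submodule.mul_mem_mul hx hy
  rw [symGE, symGE, Submodule.span_mul_span] at h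
  refine Submodule.span_mono ?_ h
  rintro _ ⟨_, ⟨L, hL, rfl⟩, _, ⟨L', hL', rfl⟩, rfl⟩
  exact ⟨L ++ L', by rw [List.length_append]; omega, (wprod_append L L').symm⟩

theorem symGE_zero : symGE V 0 = ⊤ := by
  have h1 : ∀ x : Ham V, CE.ι (Ham V) x ∈ symGE V 0 := by
    intro x
    have hx : x ∈ Submodule.span ℚ (Set.range (cword (M := Module.Dual ℚ V))) := by
      have := span_map_word (M := Module.Dual ℚ V) (Cyc.mk_surjective (R := Fun V))
      rw [show Set.range (cword (M := Module.Dual ℚ V)) =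
        Set.range fun l => Cyc.mk (Fun V) (word l) from rfl, this]
      exact Submodule.mem_top
    induction hx using Submodule.span_induction with
    | mem x h =>
      obtain ⟨l, rfl⟩ := h
      simpa [wprod, cycGen] using wprod_mem_symGE (n := 0) (L := [l]) (Nat.zero_le _)
    | zero => rw [map_zero]; exact zero_mem _
    | add x y _ _ hx hy => rw [map_add]; exact add_mem hx hy
    | smul c x _ hx => rw [map_smul]; exact Submodule.smul_mem _ _ hx
  refine eq_top_iff.2 fun x _ => ?_
  induction x using CE.induction with
  | algebraMap r =>
    rw [Algebra.algebraMap_eq_smul_one]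
    exact Submodule.smul_mem _ _ (wprod_nil (V := V) ▸ wprod_mem_symGE (Nat.zero_le _))
  | ι x => exact h1 x
  | mul a b ha hb => exact mul_mem_symGE (m := 0) (n := 0) (ha trivial) (hb trivial)
  | add a b ha hb => exact add_mem (ha trivial) (hb trivial)

theorem mem_symGE_zero (x : CE (Ham V)) : x ∈ symGE V 0 := symGE_zero (V := V) ▸ Submodule.mem_top

theorem mul_mem_symGE_left {n : ℕ} (x : CE (Ham V)) {y : CE (Ham V)} (hy : y ∈ symGE V n) :
    x * y ∈ symGE V n := by
  simpa using mul_mem_symGE (mem_symGE_zero x) hy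

theorem mul_mem_symGE_right {n : ℕ} {x : CE (Ham V)} (hx : x ∈ symGE V n) (y : CE (Ham V)) :
    x * y ∈ symGE V n := mul_mem_symGE (n := 0) hx (mem_symGE_zero y)

/-- Induction over `S(𝔥)`, which is spanned by products of cyclic words. -/
theorem wprod_induction {C : CE (Ham V) → Prop} (zero : C 0) (wprod : ∀ L, C (wprod L))
    (add : ∀ x y, C x → C y → C (x + y)) (smul : ∀ (c : ℚ) x, C x → C (c • x)) (x : CE (Ham V)) :
    C x := by
  induction mem_symGE_zero x using Submodule.span_induction with
  | mem x h => obtain ⟨L, _, rfl⟩ := h; exact wprod L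
  | zero => exact zero
  | add x y _ _ hx hy => exact add x y hx hy
  | smul c x _ hx => exact smul c x hx

theorem wprod_mem (L : List (List (HomEl (Module.Dual ℚ V)))) :
    wprod L ∈ hom (CE (Ham V)) (L.map wpar).sum := by
  induction L with
  | nil => exact one_mem_hom
  | cons l L ih =>
    rw [wprod_cons, List.map_cons, List.sum_cons]
    exact mul_mem_hom (cycGen_mem l) ih

end

namespace OddSymplecticForm
variable {V : Type*} [AddCommGroup V] [Module ℚ V] [SuperSpace V] (ω : OddSymplecticForm V)

/-- By the Leibniz rules a bracket is a sum of products with at least one factor `{l, m}`. -/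
theorem bracket_mem_symGE_one (x y : CE (Ham V)) : ω.oddBracket.bracket x y ∈ symGE V 1 := by
  have h1 : ∀ l L, ω.oddBracket.bracket (cycGen l) (wprod L) ∈ symGE V 1 := by
    intro l L
    induction L with
    | nil =>
      rw [wprod_nil, OddBracket.bracket_one_right]
      exact zero_mem _
    | cons m L ih =>
      rw [wprod_cons, ω.oddBracket.bracket_mul_right (cycGen_mem l) (cycGen_mem m), bracket_cycGen]
      refine add_mem (mul_mem_symGE_right ?_ _)
        (Submodule.smul_mem _ _ (mul_mem_symGE_left _ ih))
      exact cutsum_mem _ fun u x v _ => cutsum_mem _ fun r y s _ =>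
        Submodule.smul_mem _ _ (Submodule.smul_mem _ _ (cycGen_mem_symGE _))
  refine wprod_induction (C := fun y => ω.oddBracket.bracket x y ∈ symGE V 1) ?_
    (fun L' => ?_) ?_ ?_ y
  · rw [map_zero]; exact zero_mem _
  · refine wprod_induction (C := fun x => ω.oddBracket.bracket x (wprod L') ∈ symGE V 1)
      ?_ (fun L => ?_) ?_ ?_ x
    · simp
    · induction L with
      | nil => rw [wprod_nil, OddBracket.bracket_one_left]; exact zero_mem _
      | cons l L ih =>
        rw [wprod_cons, ω.oddBracket.bracket_mul_left (wprod_mem L')]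
        exact add_mem (mul_mem_symGE_left _ ih) (mul_mem_symGE_right (h1 l L') _)
    · intro u v hu hv; rw [map_add]; exact add_mem hu hv
    · intro c u hu; rw [map_smul]; exact Submodule.smul_mem _ _ hu
  · intro u v hu hv; rw [map_add]; exact add_mem hu hv
  · intro c u hu; rw [map_smul]; exact Submodule.smul_mem _ _ hu

/-- The bracket of a product of at least two generators with an arbitrary product has order at least
two. -/
theorem bracket_mem_symGE_two {L : List (List (HomEl (Module.Dual ℚ V)))} (hL : 2 ≤ L.length)
    (L' : List (List (HomEl (Module.Dual ℚ V)))) :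
    ω.oddBracket.bracket (wprod L) (wprod L') ∈ symGE V 2 := by
  match L, hL with
  | l :: m :: L, _ =>
    rw [wprod_cons, ω.oddBracket.bracket_mul_left (wprod_mem L'), par_of_mem (cycGen_mem l),
      tw_of_mem (wprod_mem _), smul_mul_assoc, mul_smul_comm]
    refine add_mem (Submodule.smul_mem _ _ ?_) (Submodule.smul_mem _ _ ?_)
    · exact mul_mem_symGE (m := 1) (n := 1) (cycGen_mem_symGE l) (ω.bracket_mem_symGE_one _ _)
    · exact mul_mem_symGE (m := 1) (n := 1) (ω.bracket_mem_symGE_one _ _)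
        (wprod_mem_symGE (by simp))

variable [FiniteDimensional ℚ V]

/-- By the Leibniz rule `Δ` takes values in products with a factor that is cut into two words. -/
theorem Delta_mem_symGE_two (x : CE (Ham V)) : ω.oddCobracket.Delta x ∈ symGE V 2 := by
  refine wprod_induction (C := fun x => ω.oddCobracket.Delta x ∈ symGE V 2) ?_ (fun L => ?_) ?_ ?_ x
  · rw [map_zero]; exact zero_mem _
  · induction L with
    | nil => rw [wprod_nil, OddCobracket.Delta_one]; exact zero_mem _
    | cons l L ih =>
      rw [wprod_cons, OddCobracket.Delta_mul, Delta_cycGen]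
      refine add_mem (mul_mem_symGE_right ?_ _) (mul_mem_symGE_left _ ih)
      exact cutsum_mem _ fun u x v _ => cutsum_mem _ fun r y s _ =>
        Submodule.smul_mem _ _ (Submodule.smul_mem _ _
          (mul_mem_symGE (m := 1) (n := 1) (cycGen_mem_symGE _) (cycGen_mem_symGE _)))
  · intro u v hu hv; rw [map_add]; exact add_mem hu hv
  · intro c u hu; rw [map_smul]; exact Submodule.smul_mem _ _ hu

end OddSymplecticForm

/-! ### The subspace `Λ` in terms of monomials -/

section
variable {V : Type*} [AddCommGroup V] [Module ℚ V] [SuperSpace V]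

theorem nu_eq_cycGen : nu V = cycGen [] := rfl

theorem nu_pow_mul_wprod (j : ℕ) (L : List (List (HomEl (Module.Dual ℚ V)))) :
    nu V ^ j * wprod L = wprod (List.replicate j [] ++ L) := by
  rw [wprod_append, nu_eq_cycGen]
  simp [wprod]

theorem nu_mem : nu V ∈ hom (CE (Ham V)) 0 := cycGen_mem []

theorem nu_pow_mem (j : ℕ) : nu V ^ j ∈ hom (CE (Ham V)) 0 := by
  induction j with
  | zero => rw [pow_zero]; exact one_mem_hom
  | succ j ih =>
    have h := mul_mem_hom ih (nu_mem (V := V))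
    rwa [add_zero, ← pow_succ] at h

theorem nu_pow_mul_comm (j : ℕ) (l : List (HomEl (Module.Dual ℚ V))) :
    cycGen l * nu V ^ j = nu V ^ j * cycGen l := by
  rw [CE.mul_comm_of_mem (cycGen_mem l) (nu_pow_mem j), mul_zero, sgn_zero, one_smul]

/-- Splitting off the empty words of a monomial. -/
theorem wprod_eq_nu_pow_mul (L : List (List (HomEl (Module.Dual ℚ V)))) :
    ∃ j L', wprod L = nu V ^ j * wprod L' ∧ (∀ l ∈ L', 1 ≤ l.length) ∧ (j = 0 → L = L') := by
  induction L with
  | nil => exact ⟨0, [], by simp, by simp, fun _ => rfl⟩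
  | cons l L ih =>
    obtain ⟨j, L', h, h1, h2⟩ := ih
    cases l with
    | nil =>
      exact ⟨j + 1, L', by rw [wprod_cons, h, ← mul_assoc, pow_succ', nu_eq_cycGen], h1, by simp⟩
    | cons x l =>
      refine ⟨j, (x :: l) :: L', ?_, ?_, fun hj => by rw [h2 hj]⟩
      · rw [wprod_cons, wprod_cons, h, ← mul_assoc, nu_pow_mul_comm, mul_assoc]
      · simpa using h1

/-- The tensors of degree `n` are spanned by the words of length `n` in homogeneous letters. -/
theorem range_ι_pow (n : ℕ) :
    LinearMap.range (TensorAlgebra.ι ℚ : Module.Dual ℚ V →ₗ[ℚ] Fun V) ^ n =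
      Submodule.span ℚ {x | ∃ l : List (HomEl (Module.Dual ℚ V)), l.length = n ∧ x = word l} := by
  have h1 : LinearMap.range (TensorAlgebra.ι ℚ : Module.Dual ℚ V →ₗ[ℚ] Fun V) =
      Submodule.span ℚ (Set.range fun x : HomEl (Module.Dual ℚ V) => TensorAlgebra.ι ℚ x.val) := by
    refine le_antisymm ?_ (Submodule.span_le.2 ?_)
    · rintro _ ⟨x, rfl⟩
      rw [← proj_add_proj x, map_add]
      exact add_mem (Submodule.subset_span ⟨⟨_, 0, proj_mem 0 x⟩, rfl⟩)
        (Submodule.subset_span ⟨⟨_, 1, proj_mem 1 x⟩, rfl⟩)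
    · rintro _ ⟨x, rfl⟩
      exact ⟨x.val, rfl⟩
  induction n with
  | zero =>
    rw [pow_zero, Submodule.one_eq_span]
    congr 1
    ext x
    simp [List.length_eq_zero_iff, word_nil]
  | succ n ih =>
    rw [pow_succ', ih, h1, Submodule.span_mul_span]
    congr 1
    ext x
    constructor
    · rintro ⟨_, ⟨x, rfl⟩, _, ⟨l, rfl, rfl⟩, rfl⟩
      exact ⟨x :: l, rfl, rfl⟩
    · rintro ⟨l, hl, rfl⟩
      cases l with
      | nil => simp at hl
      | cons x l => exact ⟨_, ⟨x, rfl⟩, _, ⟨l, by simpa using hl, rfl⟩, rfl⟩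

theorem hamOrder_eq_span (n : ℕ) : hamOrder V n =
    Submodule.span ℚ {x | ∃ l : List (HomEl (Module.Dual ℚ V)), l.length = n ∧ x = cword l} := by
  rw [hamOrder, range_ι_pow, Submodule.map_span]
  congr 1
  ext x
  constructor
  · rintro ⟨_, ⟨l, h, rfl⟩, rfl⟩
    exact ⟨l, h, rfl⟩
  · rintro ⟨l, h, rfl⟩
    exact ⟨_, ⟨l, h, rfl⟩, rfl⟩

theorem map_hamOrder_eq_span (n : ℕ) : (hamOrder V n).map (CE.ι (Ham V)) =
    Submodule.span ℚ {x | ∃ l : List (HomEl (Module.Dual ℚ V)), l.length = n ∧ x = cycGen l} := by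
  rw [hamOrder_eq_span, Submodule.map_span]
  congr 1
  ext x
  constructor
  · rintro ⟨_, ⟨l, h, rfl⟩, rfl⟩
    exact ⟨l, h, rfl⟩
  · rintro ⟨l, h, rfl⟩
    exact ⟨_, ⟨l, h, rfl⟩, rfl⟩

theorem map_hamGE_eq_span (n : ℕ) : (hamGE V n).map (CE.ι (Ham V)) =
    Submodule.span ℚ {x | ∃ l : List (HomEl (Module.Dual ℚ V)), n ≤ l.length ∧ x = cycGen l} := by
  refine le_antisymm ?_ (Submodule.span_le.2 ?_)
  · rw [hamGE, Submodule.map_iSup]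
    refine iSup_le fun i => ?_
    rw [Submodule.map_iSup]
    refine iSup_le fun hi => ?_
    rw [map_hamOrder_eq_span]
    refine Submodule.span_mono ?_
    rintro _ ⟨l, rfl, rfl⟩
    exact ⟨l, hi, rfl⟩
  · rintro _ ⟨l, h, rfl⟩
    refine ⟨cword l, ?_, rfl⟩
    refine Submodule.mem_iSup_of_mem l.length (Submodule.mem_iSup_of_mem h ?_)
    rw [hamOrder_eq_span]
    exact Submodule.subset_span ⟨l, rfl, rfl⟩

theorem symPower_eq_span (k : ℕ) : symPower V k =
    Submodule.span ℚ {x | ∃ L : List (List (HomEl (Module.Dual ℚ V))),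
      (L.length = k ∧ ∀ l ∈ L, 1 ≤ l.length) ∧ x = wprod L} := by
  rw [symPower]
  induction k with
  | zero =>
    rw [pow_zero, Submodule.one_eq_span]
    congr 1
    ext x
    constructor
    · rintro rfl
      exact ⟨[], by simp, rfl⟩
    · rintro ⟨L, ⟨h, _⟩, rfl⟩
      rw [List.length_eq_zero_iff.1 h]; rfl
  | succ k ih =>
    rw [pow_succ', ih, map_hamGE_eq_span, Submodule.span_mul_span]
    congr 1
    ext x
    constructor
    · rintro ⟨_, ⟨l, hl, rfl⟩, _, ⟨L, ⟨hL, hL'⟩, rfl⟩, rfl⟩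
      exact ⟨l :: L, ⟨by simp [hL], by simpa using ⟨hl, hL'⟩⟩, (wprod_cons l L).symm⟩
    · rintro ⟨L, ⟨hL, hL'⟩, rfl⟩
      cases L with
      | nil => simp at hL
      | cons l L =>
        simp only [List.mem_cons, forall_eq_or_imp] at hL'
        exact ⟨_, ⟨l, hL'.1, rfl⟩, _, ⟨L, ⟨by simpa using hL, hL'.2⟩, rfl⟩, (wprod_cons l L).symm⟩

variable (V) in
/-- The span of all monomials in `γ` and cyclic words except for the single letters: the preimage of
`Λ_{γ,ν}[V]` in `𝔩`. -/
def lambdaSpan : Submodule ℚ (FullDGLA V) := Submodule.span ℚ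
  {z | ∃ (i : ℕ) (L : List (List (HomEl (Module.Dual ℚ V)))), (i ≠ 0 ∨ ∀ x, L ≠ [[x]]) ∧
    z = (Polynomial.X ^ i : Polynomial ℚ) ⊗ₜ wprod L}

theorem tmul_wprod_mem_lambdaSpan {i : ℕ} {L : List (List (HomEl (Module.Dual ℚ V)))}
    (h : i ≠ 0 ∨ ∀ x, L ≠ [[x]]) :
    (Polynomial.X ^ i : Polynomial ℚ) ⊗ₜ wprod L ∈ lambdaSpan V :=
  Submodule.subset_span ⟨i, L, h, rfl⟩

theorem monomialSpan_le_lambdaSpan {I : Set (ℕ × ℕ)}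
    {T : List (List (HomEl (Module.Dual ℚ V))) → Prop} {N : Submodule ℚ (CE (Ham V))}
    (hN : N ≤ Submodule.span ℚ {x | ∃ L, T L ∧ x = wprod L})
    (h : ∀ i j, (i, j) ∈ I → ∀ L, T L → i ≠ 0 ∨ ∀ x, List.replicate j [] ++ L ≠ [[x]]) :
    monomialSpan V I N ≤ lambdaSpan V := by
  refine Submodule.span_le.2 ?_
  rintro _ ⟨⟨i, j⟩, hI, n, hn, rfl⟩
  change (Polynomial.X ^ i : Polynomial ℚ) ⊗ₜ[ℚ] (nu V ^ j * n) ∈ lambdaSpan V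
  have hn' := hN hn
  clear hn
  induction hn' using Submodule.span_induction with
  | mem x hx =>
    obtain ⟨L, hL, rfl⟩ := hx
    rw [nu_pow_mul_wprod]
    exact tmul_wprod_mem_lambdaSpan (h i j hI L hL)
  | zero => rw [mul_zero, TensorProduct.tmul_zero]; exact zero_mem _
  | add x y _ _ hx hy => rw [mul_add, TensorProduct.tmul_add]; exact add_mem hx hy
  | smul c x _ hx =>
    rw [mul_smul_comm, TensorProduct.tmul_smul]; exact Submodule.smul_mem _ _ hx

/-- The constants and the three summands of `Λ_{γ,ν}[V]` together account for exactly the monomials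
that are not single letters: in the first summand either `γ` or `ν` has a positive exponent. -/
theorem comap_Lambda : (Lambda V).comap (constants V).mkQ = lambdaSpan V := by
  rw [Lambda, Submodule.comap_map_mkQ]
  have hrep : ∀ (j : ℕ) (L : List (List (HomEl (Module.Dual ℚ V)))) x,
      List.replicate j [] ++ L = [[x]] → j = 0 := by
    intro j L x h
    cases j with
    | zero => rfl
    | succ j => simp [List.replicate_succ] at h
  refine le_antisymm (sup_le ?_ (sup_le (sup_le ?_ ?_) (iSup₂_le fun k hk => ?_)))
    (Submodule.span_le.2 ?_)
  · refine monomialSpan_le_lambdaSpan (symPower_eq_span 0).le ?_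
    rintro i j - L ⟨hL, -⟩
    refine Or.inr fun x hx => ?_
    rw [hrep j L x hx, List.length_eq_zero_iff.1 hL] at hx
    simp at hx
  · refine monomialSpan_le_lambdaSpan (T := fun L => ∃ x, L = [[x]])
      ((map_hamOrder_eq_span 1).le.trans (Submodule.span_mono ?_)) ?_
    · rintro _ ⟨l, hl, rfl⟩
      obtain ⟨x, rfl⟩ := List.length_eq_one_iff.1 hl
      exact ⟨_, ⟨x, rfl⟩, by simp [wprod]⟩
    · rintro i j hij L -
      by_cases hi : i = 0
      · refine Or.inr fun x hx => hij ?_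
        rw [hi, hrep j L x hx]; rfl
      · exact Or.inl hi
  · refine monomialSpan_le_lambdaSpan (T := fun L => ∃ l, 2 ≤ l.length ∧ L = [l])
      ((map_hamGE_eq_span 2).le.trans (Submodule.span_mono ?_)) ?_
    · rintro _ ⟨l, hl, rfl⟩
      exact ⟨_, ⟨l, hl, rfl⟩, by simp [wprod]⟩
    · rintro i j - L ⟨l, hl, rfl⟩
      refine Or.inr fun x hx => ?_
      rw [hrep j _ x hx] at hx
      simp only [List.replicate_zero, List.nil_append, List.cons.injEq, and_true] at hx
      simp [hx] at hl
  · refine monomialSpan_le_lambdaSpan (symPower_eq_span k).le ?_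
    rintro i j - L ⟨hL, -⟩
    refine Or.inr fun x hx => ?_
    rw [hrep j _ x hx] at hx
    rw [List.replicate_zero, List.nil_append] at hx
    simp [hx] at hL
    omega
  · rintro _ ⟨i, L, hL, rfl⟩
    obtain ⟨j, L', h, h1, h2⟩ := wprod_eq_nu_pow_mul L
    rw [h]
    have hmem : ∀ {I : Set (ℕ × ℕ)} {N : Submodule ℚ (CE (Ham V))}, (i, j) ∈ I → wprod L' ∈ N →
        (Polynomial.X ^ i : Polynomial ℚ) ⊗ₜ[ℚ] (nu V ^ j * wprod L') ∈ monomialSpan V I N :=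
      fun hI hN => Submodule.subset_span ⟨(i, j), hI, _, hN, rfl⟩
    have hpow : ∀ k, L'.length = k → wprod L' ∈ symPower V k := fun k hk => by
      rw [symPower_eq_span]
      exact Submodule.subset_span ⟨L', ⟨hk, h1⟩, rfl⟩
    rcases L' with _ | ⟨l, _ | ⟨m, L'⟩⟩
    · exact Submodule.mem_sup_left (hmem (Set.mem_univ _) (hpow 0 rfl))
    · refine Submodule.mem_sup_right (Submodule.mem_sup_left ?_)
      have hl : wprod [l] = cycGen l := by simp [wprod]
      by_cases h3 : l.length = 1
      · refine Submodule.mem_sup_left (hmem ?_ ?_)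
        · obtain ⟨x, rfl⟩ := List.length_eq_one_iff.1 h3
          intro h0
          simp only [Set.mem_singleton_iff, Prod.mk.injEq] at h0
          exact hL.elim (fun hi => hi h0.1) fun hx => hx x (h2 h0.2)
        · rw [map_hamOrder_eq_span, hl]
          exact Submodule.subset_span ⟨l, h3, rfl⟩
      · refine Submodule.mem_sup_right (hmem (Set.mem_univ _) ?_)
        rw [map_hamGE_eq_span, hl]
        have := h1 l (by simp)
        exact Submodule.subset_span ⟨l, by omega, rfl⟩
    · refine Submodule.mem_sup_right (Submodule.mem_sup_right ?_)
      refine Submodule.mem_iSup_of_mem (L'.length + 2) (Submodule.mem_iSup_of_mem (by omega) ?_)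
      exact hmem (Set.mem_univ _) (hpow _ rfl)

theorem mkQ_mem_Lambda {x : FullDGLA V} : (constants V).mkQ x ∈ Lambda V ↔ x ∈ lambdaSpan V := by
  rw [← comap_Lambda]; rfl

theorem par_mem_lambdaSpan {x : FullDGLA V} (hx : x ∈ lambdaSpan V) : par x ∈ lambdaSpan V := by
  induction hx using Submodule.span_induction with
  | mem x h =>
    obtain ⟨i, L, h, rfl⟩ := h
    have : par ((Polynomial.X ^ i : Polynomial ℚ) ⊗ₜ[ℚ] wprod L) =
      (Polynomial.X ^ i : Polynomial ℚ) ⊗ₜ[ℚ] par (wprod L) := rfl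
    rw [this, par_of_mem (wprod_mem L), TensorProduct.tmul_smul]
    exact Submodule.smul_mem _ _ (tmul_wprod_mem_lambdaSpan h)
  | zero => rw [map_zero]; exact zero_mem _
  | add x y _ _ hx hy => rw [map_add]; exact add_mem hx hy
  | smul c x _ hx => rw [map_smul]; exact Submodule.smul_mem _ _ hx

theorem proj_mem_lambdaSpan (p : ZMod 2) {x : FullDGLA V} (hx : x ∈ lambdaSpan V) :
    proj _ p x ∈ lambdaSpan V := by
  rw [proj_apply]
  exact Submodule.smul_mem _ _ (add_mem hx (Submodule.smul_mem _ _ (par_mem_lambdaSpan hx)))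

theorem X_pow_succ_tmul_mem_lambdaSpan (i : ℕ) (x : CE (Ham V)) :
    (Polynomial.X ^ (i + 1) : Polynomial ℚ) ⊗ₜ x ∈ lambdaSpan V := by
  refine wprod_induction (C := fun x => (Polynomial.X ^ (i + 1) : Polynomial ℚ) ⊗ₜ x ∈ lambdaSpan V)
    ?_ (fun L => tmul_wprod_mem_lambdaSpan (Or.inl i.succ_ne_zero)) ?_ ?_ x
  · rw [TensorProduct.tmul_zero]; exact zero_mem _
  · intro x y hx hy; rw [TensorProduct.tmul_add]; exact add_mem hx hy
  · intro c x hx; rw [TensorProduct.tmul_smul]; exact Submodule.smul_mem _ _ hx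

theorem X_pow_tmul_mem_lambdaSpan (i : ℕ) {x : CE (Ham V)} (hx : x ∈ symGE V 2) :
    (Polynomial.X ^ i : Polynomial ℚ) ⊗ₜ x ∈ lambdaSpan V := by
  induction hx using Submodule.span_induction with
  | mem x h =>
    obtain ⟨L, hL, rfl⟩ := h
    exact tmul_wprod_mem_lambdaSpan (Or.inr fun x hx => by simp [hx] at hL)
  | zero => rw [TensorProduct.tmul_zero]; exact zero_mem _
  | add x y _ _ hx hy => rw [TensorProduct.tmul_add]; exact add_mem hx hy
  | smul c x _ hx => rw [TensorProduct.tmul_smul]; exact Submodule.smul_mem _ _ hx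

end

/-! ### Descent to the quotient by the constants -/

namespace OddSymplecticForm
variable {V : Type*} [AddCommGroup V] [Module ℚ V] [SuperSpace V] (ω : OddSymplecticForm V)

/-- The powers of `ν` are central, since there is no letter at which the empty word could be joined.
-/
theorem bracket_nu_pow_left (j : ℕ) (y : CE (Ham V)) : ω.oddBracket.bracket (nu V ^ j) y = 0 := by
  refine wprod_induction (C := fun y => ω.oddBracket.bracket (nu V ^ j) y = 0) (map_zero _)
    (fun L => ?_) (fun x y hx hy => by rw [map_add, hx, hy, add_zero])
    (fun c x hx => by rw [map_smul, hx, smul_zero]) y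
  have h : ω.oddBracket.bracket (nu V) (wprod L) = 0 := by
    rw [nu_eq_cycGen]
    induction L with
    | nil => rw [wprod_nil, OddBracket.bracket_one_right]
    | cons l L ih =>
      rw [wprod_cons, ω.oddBracket.bracket_mul_right (cycGen_mem []) (cycGen_mem l), ih,
        bracket_cycGen, cutsum_nil, zero_mul, mul_zero, smul_zero, add_zero]
  induction j with
  | zero => rw [pow_zero, OddBracket.bracket_one_left]
  | succ j ih =>
    rw [pow_succ, ω.oddBracket.bracket_mul_left (wprod_mem L), ih, h, mul_zero, zero_mul, add_zero]

theorem bracket_nu_pow_right (j : ℕ) (y : CE (Ham V)) : ω.oddBracket.bracket y (nu V ^ j) = 0 := by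
  refine wprod_induction (C := fun y => ω.oddBracket.bracket y (nu V ^ j) = 0) (by simp)
    (fun L => ?_) (fun x y hx hy => by rw [map_add, LinearMap.add_apply, hx, hy, add_zero])
    (fun c x hx => by rw [map_smul, LinearMap.smul_apply, hx, smul_zero]) y
  rw [ω.oddBracket.bracket_comm (wprod_mem L) (nu_pow_mem j), bracket_nu_pow_left, smul_zero]

theorem delta_nu_pow (j : ℕ) : ω.oddBracket.delta (nu V ^ j) = 0 := by
  induction j with
  | zero => rw [pow_zero, OddBracket.delta_one]
  | succ j ih =>
    rw [pow_succ, ω.oddBracket.delta_mul (nu_pow_mem j), ih, bracket_nu_pow_left, nu,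
      OddBracket.delta_ι, zero_mul, mul_zero, smul_zero, add_zero, add_zero]

theorem constants_induction {C : FullDGLA V → Prop} (zero : C 0)
    (tmul : ∀ (i j : ℕ), C ((Polynomial.X ^ i : Polynomial ℚ) ⊗ₜ (nu V ^ j)))
    (add : ∀ x y, C x → C y → C (x + y)) (smul : ∀ (c : ℚ) x, C x → C (c • x)) {x : FullDGLA V}
    (hx : x ∈ constants V) : C x := by
  induction hx using Submodule.span_induction with
  | mem x h =>
    obtain ⟨⟨i, j⟩, -, n, hn, rfl⟩ := h
    rw [symPower, pow_zero, Submodule.mem_one] at hn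
    obtain ⟨r, rfl⟩ := hn
    rw [Algebra.algebraMap_eq_smul_one, mul_smul_comm, mul_one, TensorProduct.tmul_smul]
    exact smul r _ (tmul i j)
  | zero => exact zero
  | add x y _ _ hx hy => exact add x y hx hy
  | smul c x _ hx => exact smul c x hx

theorem constants_le_hom : constants V ≤ hom (FullDGLA V) 0 := fun _ hx =>
  constants_induction (C := fun x => x ∈ hom (FullDGLA V) 0) (zero_mem _)
    (fun _ j => tmul_mem_hom _ (nu_pow_mem j)) (fun _ _ => add_mem)
    (fun c _ => Submodule.smul_mem _ c) hx

end OddSymplecticForm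

section
variable {V : Type*} [AddCommGroup V] [Module ℚ V] [SuperSpace V]

theorem exists_of_mem_lambdaHom {p : ZMod 2} {a : Lambda V} (ha : a ∈ lambdaHom V p) :
    ∃ x ∈ hom (FullDGLA V) p, ∃ hx : (constants V).mkQ x ∈ Lambda V,
      a = ⟨(constants V).mkQ x, hx⟩ := by
  obtain ⟨x, hx, h⟩ := ha
  exact ⟨x, hx, h ▸ a.2, Subtype.ext h.symm⟩

theorem mem_lambdaHom {p : ZMod 2} {x : FullDGLA V} (hx : x ∈ hom (FullDGLA V) p)
    (h : (constants V).mkQ x ∈ Lambda V) : (⟨(constants V).mkQ x, h⟩ : Lambda V) ∈ lambdaHom V p :=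
  ⟨x, hx, rfl⟩

/-- The constants are even and `Λ` contains the homogeneous components of its elements. -/
theorem lambdaHom_isInternal : DirectSum.IsInternal (lambdaHom V) := by
  rw [DirectSum.isInternal_submodule_iff_isCompl (lambdaHom V) (i := 0) (j := 1) (by decide)
    (by ext p; rcases zmod_two_cases p with rfl | rfl <;> simp)]
  constructor
  · rw [Submodule.disjoint_def]
    intro a h0 h1
    obtain ⟨x, hx, hx', rfl⟩ := exists_of_mem_lambdaHom h0
    obtain ⟨y, hy, hy', h⟩ := exists_of_mem_lambdaHom h1
    have h2 := OddSymplecticForm.constants_le_hom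
      ((Submodule.Quotient.eq _).1 (congrArg Subtype.val h))
    have h3 : y = 0 := by
      refine hom_inf (p := 0) ?_ hy
      simpa using sub_mem hx h2
    rw [h]
    refine Subtype.ext ?_
    change (constants V).mkQ y = 0
    rw [h3, map_zero]
  · rw [codisjoint_iff, eq_top_iff]
    rintro ⟨a, ha⟩ -
    obtain ⟨x, rfl⟩ := (constants V).mkQ_surjective a
    have h : ∀ p, (constants V).mkQ (proj _ p x) ∈ Lambda V := fun p =>
      mkQ_mem_Lambda.2 (proj_mem_lambdaSpan p (mkQ_mem_Lambda.1 ha))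
    have hx : (⟨(constants V).mkQ x, ha⟩ : Lambda V) = ⟨_, h 0⟩ + ⟨_, h 1⟩ := by
      refine Subtype.ext ?_
      change (constants V).mkQ x = (constants V).mkQ _ + (constants V).mkQ _
      rw [← map_add, proj_add_proj]
    rw [hx]
    exact add_mem (Submodule.mem_sup_left (mem_lambdaHom (proj_mem 0 x) _))
      (Submodule.mem_sup_right (mem_lambdaHom (proj_mem 1 x) _))

end

namespace OddSymplecticForm
variable {V : Type*} [AddCommGroup V] [Module ℚ V] [SuperSpace V] (ω : OddSymplecticForm V)

theorem fullBracket_constants_left {x : FullDGLA V} (hx : x ∈ constants V) (y : FullDGLA V) :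
    ω.fullBracket x y = 0 := by
  refine constants_induction (C := fun x => ω.fullBracket x y = 0) (by simp) (fun i j => ?_)
    (fun x y hx hy => by rw [map_add, LinearMap.add_apply, hx, hy, add_zero])
    (fun c x hx => by rw [map_smul, LinearMap.smul_apply, hx, smul_zero]) hx
  induction y using TensorProduct.induction_on with
  | zero => simp
  | tmul b y => rw [fullBracket_tmul, bracket_nu_pow_left, TensorProduct.tmul_zero]
  | add x y hx hy => rw [map_add, hx, hy, add_zero]

theorem fullBracket_constants_right {y : FullDGLA V} (hy : y ∈ constants V) (x : FullDGLA V) :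
    ω.fullBracket x y = 0 := by
  refine constants_induction (C := fun y => ω.fullBracket x y = 0) (by simp) (fun i j => ?_)
    (fun x y hx hy => by rw [map_add, hx, hy, add_zero])
    (fun c x hx => by rw [map_smul, hx, smul_zero]) hy
  induction x using TensorProduct.induction_on with
  | zero => simp
  | tmul b y => rw [fullBracket_tmul, bracket_nu_pow_right, TensorProduct.tmul_zero]
  | add x y hx hy => rw [map_add, LinearMap.add_apply, hx, hy, add_zero]

/-- The bracket of `𝔩' = 𝔩 / ℚ[γ, ν]`. -/
def reducedBracket : ReducedDGLA V →ₗ[ℚ] ReducedDGLA V →ₗ[ℚ] ReducedDGLA V :=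
  ((constants V).liftQ ((constants V).liftQ (ω.fullBracket.compr₂ (constants V).mkQ)
    (fun x hx => LinearMap.ext fun y => by
      rw [LinearMap.compr₂_apply, ω.fullBracket_constants_left hx, map_zero]; rfl)).flip
    (fun y hy => by
      refine Submodule.linearMap_qext _ (LinearMap.ext fun x => ?_)
      change (constants V).mkQ (ω.fullBracket x y) = 0
      rw [ω.fullBracket_constants_right hy, map_zero])).flip

theorem reducedBracket_mkQ (x y : FullDGLA V) :
    ω.reducedBracket ((constants V).mkQ x) ((constants V).mkQ y) =
      (constants V).mkQ (ω.fullBracket x y) := rfl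

/-- If neither word is a single letter, joining two cyclic words never leaves a single letter. -/
theorem X_pow_tmul_bracket_cycGen_mem (i : ℕ) {l m : List (HomEl (Module.Dual ℚ V))}
    (hl : l.length ≠ 1) (hm : m.length ≠ 1) : (Polynomial.X ^ i : Polynomial ℚ) ⊗ₜ
      ω.oddBracket.bracket (cycGen l) (cycGen m) ∈ lambdaSpan V := by
  have h : ω.oddBracket.bracket (cycGen l) (cycGen m) ∈ (lambdaSpan V).comap
      (TensorProduct.mk ℚ (Polynomial ℚ) (CE (Ham V)) (Polynomial.X ^ i)) := by
    rw [bracket_cycGen]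
    refine cutsum_mem _ fun u x v hl' => cutsum_mem _ fun r y s hm' =>
      Submodule.smul_mem _ _ (Submodule.smul_mem _ _ ?_)
    have h1 : wprod [r ++ v ++ u ++ s] = cycGen (r ++ v ++ u ++ s) := by simp [wprod]
    rw [← h1]
    refine tmul_wprod_mem_lambdaSpan (Or.inr fun z hz => ?_)
    -- The joined word has two letters fewer than `l` and `m` together. If it had one letter, then
    -- `l` and `m` would have three, and each at least one, so one of them would be a single letter.
    have h2 := congrArg (fun L => (L.map List.length).sum) hz
    simp only [List.map_cons, List.map_nil, List.sum_cons, List.sum_nil, List.length_append,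
      List.length_cons, List.length_nil] at h2
    rw [hl', List.length_append, List.length_cons] at hl
    rw [hm', List.length_append, List.length_cons] at hm
    omega
  exact h

/-- The span of the monomials other than single letters is a subalgebra. Without a factor `γ` and
with at least two words on one side, the bracket has order at least two; there remain the brackets
of two words. -/
theorem fullBracket_mem_lambdaSpan {x y : FullDGLA V} (hx : x ∈ lambdaSpan V)
    (hy : y ∈ lambdaSpan V) : ω.fullBracket x y ∈ lambdaSpan V := by
  induction hx using Submodule.span_induction with
  | mem x h =>
    obtain ⟨i, L, hL, rfl⟩ := h
    induction hy using Submodule.span_induction with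
    | mem y h =>
      obtain ⟨j, L', hL', rfl⟩ := h
      rw [fullBracket_tmul, ← pow_add]
      by_cases hij : i + j = 0
      · have hL := hL.resolve_left (by omega)
        have hL' := hL'.resolve_left (by omega)
        by_cases h2 : 2 ≤ L.length
        · exact X_pow_tmul_mem_lambdaSpan _ (ω.bracket_mem_symGE_two h2 L')
        by_cases h2' : 2 ≤ L'.length
        · rw [ω.oddBracket.bracket_comm (wprod_mem L) (wprod_mem L'), TensorProduct.tmul_smul]
          exact Submodule.smul_mem _ _ (X_pow_tmul_mem_lambdaSpan _ (ω.bracket_mem_symGE_two h2' L))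
        match L, L', hL, hL', h2, h2' with
        | [], L', _, _, _, _ =>
          rw [wprod_nil, OddBracket.bracket_one_left, TensorProduct.tmul_zero]; exact zero_mem _
        | L, [], _, _, _, _ =>
          rw [wprod_nil, OddBracket.bracket_one_right, TensorProduct.tmul_zero]; exact zero_mem _
        | [l], [m], hL, hL', _, _ =>
          have h3 : ∀ l : List (HomEl (Module.Dual ℚ V)), wprod [l] = cycGen l := by simp [wprod]
          have h4 : ∀ l : List (HomEl (Module.Dual ℚ V)), (∀ x, [l] ≠ [[x]]) → l.length ≠ 1 := by
            intro l h h1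
            obtain ⟨x, rfl⟩ := List.length_eq_one_iff.1 h1
            exact h x rfl
          rw [h3, h3]
          exact ω.X_pow_tmul_bracket_cycGen_mem _ (h4 l hL) (h4 m hL')
        | _ :: _ :: _, _, _, _, h2, _ => simp at h2
        | _, _ :: _ :: _, _, _, _, h2' => simp at h2'
      · obtain ⟨k, hk⟩ := Nat.exists_eq_succ_of_ne_zero hij
        rw [hk]
        exact X_pow_succ_tmul_mem_lambdaSpan k _
    | zero => rw [map_zero]; exact zero_mem _
    | add x y _ _ hx hy => rw [map_add]; exact add_mem hx hy
    | smul c x _ hx => rw [map_smul]; exact Submodule.smul_mem _ _ hx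
  | zero => rw [map_zero]; exact zero_mem _
  | add x y _ _ hx hy => rw [map_add]; exact add_mem hx hy
  | smul c x _ hx => rw [map_smul]; exact Submodule.smul_mem _ _ hx

theorem reducedBracket_mem_Lambda (a b : Lambda V) : ω.reducedBracket a b ∈ Lambda V := by
  obtain ⟨a, ha⟩ := a
  obtain ⟨b, hb⟩ := b
  obtain ⟨x, rfl⟩ := (constants V).mkQ_surjective a
  obtain ⟨y, rfl⟩ := (constants V).mkQ_surjective b
  exact mkQ_mem_Lambda.2 (ω.fullBracket_mem_lambdaSpan (mkQ_mem_Lambda.1 ha) (mkQ_mem_Lambda.1 hb))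

/-- The bracket of `Λ_{γ,ν}[V]`. -/
def lambdaBracket : Lambda V →ₗ[ℚ] Lambda V →ₗ[ℚ] Lambda V :=
  LinearMap.mk₂ ℚ (fun a b => ⟨ω.reducedBracket a b, ω.reducedBracket_mem_Lambda a b⟩)
    (fun a b c => Subtype.ext (LinearMap.congr_fun (map_add ω.reducedBracket a.1 b.1) c.1))
    (fun c a b => Subtype.ext (LinearMap.congr_fun (map_smul ω.reducedBracket c a.1) b.1))
    (fun a b c => Subtype.ext (map_add (ω.reducedBracket a.1) b.1 c.1))
    (fun c a b => Subtype.ext (map_smul (ω.reducedBracket a.1) c b.1))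

theorem coe_lambdaBracket (a b : Lambda V) :
    (ω.lambdaBracket a b : ReducedDGLA V) = ω.reducedBracket a b := rfl

theorem lambdaBracket_mem {p q : ZMod 2} {a b : Lambda V} (ha : a ∈ lambdaHom V p)
    (hb : b ∈ lambdaHom V q) : ω.lambdaBracket a b ∈ lambdaHom V (p + q + 1) := by
  obtain ⟨x, hx, h⟩ := ha
  obtain ⟨y, hy, h'⟩ := hb
  refine ⟨_, ω.fullBracket_mem hx hy, ?_⟩
  rw [← reducedBracket_mkQ, h, h']
  rfl

theorem lambdaBracket_comm {p q : ZMod 2} {a b : Lambda V} (ha : a ∈ lambdaHom V p)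
    (hb : b ∈ lambdaHom V q) : ω.lambdaBracket a b = sgn (p * q) • ω.lambdaBracket b a := by
  obtain ⟨x, hx, h⟩ := ha
  obtain ⟨y, hy, h'⟩ := hb
  refine Subtype.ext ?_
  rw [Submodule.subtype_apply] at h h'
  rw [Submodule.coe_smul, coe_lambdaBracket, coe_lambdaBracket, ← h, ← h', reducedBracket_mkQ,
    reducedBracket_mkQ, ω.fullBracket_symm hx hy, map_smul]

theorem lambdaBracket_jacobi {p q : ZMod 2} {a b : Lambda V} (ha : a ∈ lambdaHom V p)
    (hb : b ∈ lambdaHom V q) (c : Lambda V) : ω.lambdaBracket a (ω.lambdaBracket b c) =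
      sgn (p + 1) • ω.lambdaBracket (ω.lambdaBracket a b) c +
        sgn ((p + 1) * (q + 1)) • ω.lambdaBracket b (ω.lambdaBracket a c) := by
  obtain ⟨x, hx, h⟩ := ha
  obtain ⟨y, hy, h'⟩ := hb
  obtain ⟨z, hz⟩ := (constants V).mkQ_surjective c.1
  refine Subtype.ext ?_
  rw [Submodule.subtype_apply] at h h'
  simp only [Submodule.coe_add, Submodule.coe_smul, coe_lambdaBracket, ← h, ← h', ← hz,
    reducedBracket_mkQ, ω.fullBracket_jacobi hx hy z, map_smul, map_add]

variable [FiniteDimensional ℚ V]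

theorem Delta_nu_pow (j : ℕ) : ω.oddCobracket.Delta (nu V ^ j) = 0 := by
  induction j with
  | zero => rw [pow_zero, OddCobracket.Delta_one]
  | succ j ih =>
    rw [pow_succ, OddCobracket.Delta_mul, ih, nu_eq_cycGen, Delta_cycGen, cutsum_nil, zero_mul,
      mul_zero, add_zero]

theorem fullD_constants {x : FullDGLA V} (hx : x ∈ constants V) : ω.fullD x = 0 :=
  constants_induction (C := fun x => ω.fullD x = 0) (map_zero _)
    (fun i j => by
      rw [fullD_tmul, delta_nu_pow, Delta_nu_pow, TensorProduct.tmul_zero, TensorProduct.tmul_zero,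
        add_zero])
    (fun x y hx hy => by rw [map_add, hx, hy, add_zero])
    (fun c x hx => by rw [map_smul, hx, smul_zero]) hx

/-- The differential of `𝔩' = 𝔩 / ℚ[γ, ν]`. -/
def reducedD : ReducedDGLA V →ₗ[ℚ] ReducedDGLA V :=
  (constants V).mapQ (constants V) ω.fullD fun x hx => by
    rw [Submodule.mem_comap, ω.fullD_constants hx]; exact zero_mem _

theorem reducedD_mkQ (x : FullDGLA V) :
    ω.reducedD ((constants V).mkQ x) = (constants V).mkQ (ω.fullD x) := rfl

/-- The summand `γδ` only produces multiples of `γ`, and `Δ` only products of at least two cyclic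
words. -/
theorem fullD_mem_lambdaSpan (x : FullDGLA V) : ω.fullD x ∈ lambdaSpan V := by
  induction x using TensorProduct.induction_on with
  | zero => rw [map_zero]; exact zero_mem _
  | tmul a x =>
    induction a using Polynomial.induction_on' with
    | add a b ha hb => rw [TensorProduct.add_tmul, map_add]; exact add_mem ha hb
    | monomial n c =>
      rw [← Polynomial.smul_X_eq_monomial, ← TensorProduct.smul_tmul', map_smul, fullD_tmul,
        ← pow_succ']
      exact Submodule.smul_mem _ _ (add_mem (X_pow_succ_tmul_mem_lambdaSpan n _)
        (X_pow_tmul_mem_lambdaSpan n (ω.Delta_mem_symGE_two x)))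
  | add x y hx hy => rw [map_add]; exact add_mem hx hy

end OddSymplecticForm

theorem OddDGLie.eq_of {L : Type*} [AddCommGroup L] [Module ℚ L] {gr : ZMod 2 → Submodule ℚ L}
    {S T : OddDGLie L gr} (h : S.bracket = T.bracket) (h' : S.d = T.d) : S = T := by
  cases S
  cases T
  cases h
  cases h'
  rfl

namespace OddSymplecticForm
variable {V : Type*} [AddCommGroup V] [Module ℚ V] [SuperSpace V] [FiniteDimensional ℚ V]
variable (ω : OddSymplecticForm V)

theorem reducedD_mem_Lambda (a : Lambda V) : ω.reducedD a ∈ Lambda V := by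
  obtain ⟨a, ha⟩ := a
  obtain ⟨x, rfl⟩ := (constants V).mkQ_surjective a
  exact mkQ_mem_Lambda.2 (ω.fullD_mem_lambdaSpan x)

/-- The differential of `Λ_{γ,ν}[V]`. -/
def lambdaD : Lambda V →ₗ[ℚ] Lambda V :=
  LinearMap.codRestrict (Lambda V) (ω.reducedD ∘ₗ (Lambda V).subtype) ω.reducedD_mem_Lambda

theorem coe_lambdaD (a : Lambda V) : (ω.lambdaD a : ReducedDGLA V) = ω.reducedD a := rfl

theorem lambdaD_mem {p : ZMod 2} {a : Lambda V} (ha : a ∈ lambdaHom V p) :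
    ω.lambdaD a ∈ lambdaHom V (p + 1) := by
  obtain ⟨x, hx, h⟩ := ha
  refine ⟨_, ω.fullD_mem hx, ?_⟩
  rw [← reducedD_mkQ, h]
  rfl

theorem lambdaD_lambdaD (a : Lambda V) : ω.lambdaD (ω.lambdaD a) = 0 := by
  obtain ⟨x, hx⟩ := (constants V).mkQ_surjective a.1
  refine Subtype.ext ?_
  rw [coe_lambdaD, coe_lambdaD, ← hx, reducedD_mkQ, reducedD_mkQ, ω.fullD_fullD, map_zero,
    Submodule.coe_zero]

theorem lambdaD_lambdaBracket {p : ZMod 2} {a : Lambda V} (ha : a ∈ lambdaHom V p) (b : Lambda V) :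
    ω.lambdaD (ω.lambdaBracket a b) + ω.lambdaBracket (ω.lambdaD a) b +
      sgn p • ω.lambdaBracket a (ω.lambdaD b) = 0 := by
  obtain ⟨x, hx, h⟩ := ha
  obtain ⟨y, hy⟩ := (constants V).mkQ_surjective b.1
  refine Subtype.ext ?_
  rw [Submodule.subtype_apply] at h
  simp only [Submodule.coe_add, Submodule.coe_smul, coe_lambdaBracket, coe_lambdaD, ← h, ← hy,
    reducedBracket_mkQ, reducedD_mkQ]
  rw [← map_smul, ← map_add, ← map_add, ω.fullD_fullBracket hx y, map_zero, Submodule.coe_zero]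

/-- The structure that the differential `γδ + Δ` and the bracket of `𝔩` induce on `Λ_{γ,ν}[V]`. -/
def lambdaDGLie : OddDGLie (Lambda V) (lambdaHom V) where
  bracket := ω.lambdaBracket
  d := ω.lambdaD
  grading := lambdaHom_isInternal
  bracket_mem _ _ _ ha _ hb := ω.lambdaBracket_mem ha hb
  d_mem _ _ ha := ω.lambdaD_mem ha
  symm _ _ _ ha _ hb := ω.lambdaBracket_comm ha hb
  jacobi _ _ _ ha _ hb := ω.lambdaBracket_jacobi ha hb
  d_d := ω.lambdaD_lambdaD
  d_bracket _ _ ha := ω.lambdaD_lambdaBracket ha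

end OddSymplecticForm

end NCSymp

end

theorem mainTheorem4 {V : Type*} [AddCommGroup V] [Module ℚ V] [FiniteDimensional ℚ V]
    [NCSymp.SuperSpace V] (ω : NCSymp.OddSymplecticForm V) :
    ∃! S : NCSymp.OddDGLie (NCSymp.Lambda V) (NCSymp.lambdaHom V),
      ∀ (x y : NCSymp.FullDGLA V)
        (hx : (NCSymp.constants V).mkQ x ∈ NCSymp.Lambda V)
        (hy : (NCSymp.constants V).mkQ y ∈ NCSymp.Lambda V),
        (S.d ⟨(NCSymp.constants V).mkQ x, hx⟩ : NCSymp.ReducedDGLA V) =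
            (NCSymp.constants V).mkQ (ω.fullD x) ∧
          (S.bracket ⟨(NCSymp.constants V).mkQ x, hx⟩ ⟨(NCSymp.constants V).mkQ y, hy⟩ :
              NCSymp.ReducedDGLA V) =
            (NCSymp.constants V).mkQ (ω.fullBracket x y) := by
  refine ⟨ω.lambdaDGLie, fun x y hx hy => ⟨rfl, rfl⟩, fun S hS => NCSymp.OddDGLie.eq_of ?_ ?_⟩
  · refine LinearMap.ext fun a => LinearMap.ext fun b => ?_
    obtain ⟨a, ha⟩ := a
    obtain ⟨b, hb⟩ := b
    obtain ⟨x, rfl⟩ := (NCSymp.constants V).mkQ_surjective a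
    obtain ⟨y, rfl⟩ := (NCSymp.constants V).mkQ_surjective b
    exact Subtype.ext (hS x y ha hb).2
  · refine LinearMap.ext fun a => ?_
    obtain ⟨a, ha⟩ := a
    obtain ⟨x, rfl⟩ := (NCSymp.constants V).mkQ_surjective a
    exact Subtype.ext (hS x x ha ha).1
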